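/- **Theorem (Tree types of binary quintics).** Let $K$ be a field of characteristic $0$ that is algebraically closed and complete with respect to a non-trivial non-archimedean valuation $v\colon K\to\mathbb{R}\cup\{\infty\}$, and whose residue characteristic is not $2$, $3$ or $11$. *Invariants.* For binary forms $g,h$ in $x,z$ put $$\langle g,h\rangle_r=\sum_{i=0}^{r}(-1)^i\binom{r}{i}\frac{\partial^r g}{\partial x^{r-i}\partial z^{i}}\,\frac{\partial^r h}{\partial x^{i}\partial z^{r-i}} .$$ For the universal quintic $f=a_0x^5+a_1x^4z+a_2x^3z^2+a_3x^2z^3+a_4xz^4+a_5z^5$ let $$I_4=\langle f^2,f^2\rangle_{10},\quad I_8=\langle f^4,f^4\rangle_{20},\quad I_{12}=\langle f^6,f^6\rangle_{30},\quad I_{18}=\langle\langle f^5,f^6\rangle_{10},f^7\rangle_{35},$$ let $\Delta$ be the discriminant of $f$, and let $H=\beta I_{12}-396\,\alpha^3 I_4^3$, where $$\alpha=2^{-17}3^{-7}5^{-3}7^{-1},\qquad \beta=2^{-50}3^{-27}5^{-14}7^{-7}11^{-4}13^{-3}17^{-1}19^{-1}23^{-1}29^{-1}.$$ These are homogeneous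 polynomials in $\mathbb{Q}[a_0,\dots,a_5]$ of degrees $\deg I_4=4$, $\deg I_8=8$, $\deg I_{12}=12$, $\deg I_{18}=18$, $\deg\Delta=8$, $\deg H=12$. Now replace each of the six by its rational multiple (unique up to sign) that has integer coefficients with greatest common divisor $1$, keep the notation, and let $S=\{I_4,I_8,I_{12},I_{18},\Delta,H\}$. *Tree.* Let $f=a_0x^5+\dots+a_5z^5$ with $a_i\in K$ be separable, i.e. $\Delta(f)\neq 0$, so that $f$ has five distinct zeros in $\mathbb{P}^1(K)$. The tree of $f$ is the union of the paths between these zeros in the Berkovich analytification of $\mathbb{P}^1_K$; its leaves are the five zeros and its other vertices are its points of valency at least three. Forgetting the labels of the leaves, it has exactly one of the following types. Type I: one inner vertex, with five leaves. Type II: two inner vertices joined by an edge, one with two leaves and the other with three. Type III: three inner vertices forming a chain, with two leaves at each end and one leaf at the middle vertex. *Claim.* Write $v(I)$ for the valuation of the value of $I$ at $f$. Then: (I) The tree of $f$ is of Type I if and only if $8v(I)\ge\deg(I)\,v(\Delta)$ for all $I\in S$. (II) The tree of $f$ is of Type II if and only if [$v(\Delta)>2v(I_4)$ or $9v(\Delta)>4v(I_{18})$]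 and $12v(I)\ge\deg(I)\,v(H)$ for all $I\in S$. (III) The tree of $f$ is of Type III if and only if $v(\Delta)>2v(I_4)$ and $v(H)>3v(I_4)$. -/

import Mathlib

open scoped NNReal LinearAlgebra.Projectivization

noncomputable section

namespace BinaryQuintic

/-! ## Invariants of the universal binary quintic -/

/-- The `r`-th transvectant
`⟨g,h⟩_r = ∑ (-1)^i (r choose i) (∂^r g / ∂x^(r-i)∂z^i) (∂^r h / ∂x^i∂z^(r-i))`
of binary forms in `x = X 0` and `z = X 1`. -/
def transvectant {A : Type*} [CommRing A] (r : ℕ) (g h : MvPolynomial (Fin 2) A) :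
    MvPolynomial (Fin 2) A :=
  ∑ i ∈ Finset.range (r + 1), (-1) ^ i * (r.choose i : MvPolynomial (Fin 2) A) *
    ((MvPolynomial.pderiv 0)^[r - i] ((MvPolynomial.pderiv 1)^[i] g)) *
    ((MvPolynomial.pderiv 0)^[i] ((MvPolynomial.pderiv 1)^[r - i] h))

/-- The coefficient ring `ℚ[a₀, …, a₅]`. -/
abbrev CoeffRing : Type := MvPolynomial (Fin 6) ℚ

/-- The universal binary quintic `a₀ x⁵ + a₁ x⁴ z + ⋯ + a₅ z⁵`, without binomial factors. -/
def universalQuintic : MvPolynomial (Fin 2) CoeffRing :=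
  ∑ i : Fin 6, MvPolynomial.C (MvPolynomial.X i) *
    MvPolynomial.X 0 ^ (5 - (i : ℕ)) * MvPolynomial.X 1 ^ (i : ℕ)

/-- `⟨f²,f²⟩₁₀`; this and the next three transvectants are forms of degree `0` in `x, z`, and are
identified with their constant coefficient. -/
def rawI4 : CoeffRing :=
  MvPolynomial.constantCoeff (transvectant 10 (universalQuintic ^ 2) (universalQuintic ^ 2))

/-- `⟨f⁴,f⁴⟩₂₀`. -/
def rawI8 : CoeffRing :=
  MvPolynomial.constantCoeff (transvectant 20 (universalQuintic ^ 4) (universalQuintic ^ 4))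

/-- `⟨f⁶,f⁶⟩₃₀`. -/
def rawI12 : CoeffRing :=
  MvPolynomial.constantCoeff (transvectant 30 (universalQuintic ^ 6) (universalQuintic ^ 6))

/-- `⟨⟨f⁵,f⁶⟩₁₀,f⁷⟩₃₅`. -/
def rawI18 : CoeffRing :=
  MvPolynomial.constantCoeff
    (transvectant 35 (transvectant 10 (universalQuintic ^ 5) (universalQuintic ^ 6))
      (universalQuintic ^ 7))

/-- The discriminant of the universal quintic `a₀ x⁵ + ⋯ + a₅` (in the affine chart `z = 1`). -/
def rawDisc : CoeffRing :=
  Polynomial.discr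
    (∑ i : Fin 6, Polynomial.C (MvPolynomial.X i : CoeffRing) * Polynomial.X ^ (5 - (i : ℕ)))

def alphaConst : ℚ := 1 / (2 ^ 17 * 3 ^ 7 * 5 ^ 3 * 7)

def betaConst : ℚ :=
  1 / (2 ^ 50 * 3 ^ 27 * 5 ^ 14 * 7 ^ 7 * 11 ^ 4 * 13 ^ 3 * 17 * 19 * 23 * 29)

/-- `H = β I₁₂ - 396 α³ I₄³`. -/
def rawH : CoeffRing :=
  MvPolynomial.C betaConst * rawI12 - MvPolynomial.C (396 * alphaConst ^ 3) * rawI4 ^ 3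

/-- `P` is a rational multiple of `F` with integer coefficients whose greatest common divisor
is `1`. -/
def IsPrimitiveScaling {σ : Type*} (F : MvPolynomial σ ℚ) (P : MvPolynomial σ ℤ) : Prop :=
  (∃ c : ℚ, c ≠ 0 ∧ MvPolynomial.map (Int.castRingHom ℚ) P = MvPolynomial.C c * F) ∧
    ∀ n : ℤ, (∀ m, n ∣ P.coeff m) → IsUnit n

theorem exists_isPrimitiveScaling {σ : Type*} (F : MvPolynomial σ ℚ) (hF : F ≠ 0) :
    ∃ P, IsPrimitiveScaling F P := by
  classical
  obtain ⟨b, hb⟩ := IsLocalization.exist_integer_multiples (nonZeroDivisors ℤ) F.support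
    (fun m => F.coeff m)
  have hb0 : ((b : ℤ) : ℚ) ≠ 0 := by
    exact_mod_cast nonZeroDivisors.coe_ne_zero b
  choose! y hy using hb
  let G : MvPolynomial σ ℤ := ∑ m ∈ F.support, MvPolynomial.monomial m (y m)
  have hG : MvPolynomial.map (Int.castRingHom ℚ) G = MvPolynomial.C ((b : ℤ) : ℚ) * F := by
    conv_rhs => rw [MvPolynomial.as_sum F, Finset.mul_sum]
    simp only [G, map_sum, MvPolynomial.map_monomial, MvPolynomial.C_mul_monomial]
    refine Finset.sum_congr rfl fun m hm => ?_
    have := hy m hm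
    simp only [eq_intCast, zsmul_eq_mul] at this ⊢
    rw [this]
  have hG0 : G ≠ 0 := by
    intro h
    rw [h, map_zero] at hG
    exact mul_ne_zero (by simp) hF hG.symm
  set g : ℤ := G.support.gcd (fun m => G.coeff m) with hg
  have hgd : ∀ m, g ∣ G.coeff m := by
    intro m
    by_cases hm : m ∈ G.support
    · exact Finset.gcd_dvd hm
    · rw [MvPolynomial.notMem_support_iff.mp hm]; exact dvd_zero _
  obtain ⟨P, hP⟩ := (MvPolynomial.C_dvd_iff_dvd_coeff g G).mpr hgd
  have hg0 : g ≠ 0 := by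
    rintro h
    rw [h] at hP
    simp at hP
    exact hG0 hP
  have hgq : (g : ℚ) ≠ 0 := by exact_mod_cast hg0
  refine ⟨P, ⟨(g : ℚ)⁻¹ * (b : ℤ), mul_ne_zero (inv_ne_zero hgq) hb0, ?_⟩, fun n hn => ?_⟩
  · rw [MvPolynomial.C_mul, mul_assoc, ← hG, hP, map_mul, MvPolynomial.map_C, ← mul_assoc,
      ← MvPolynomial.C_mul]
    simp [hgq]
  · have h1 : g * n ∣ g := by
      conv_rhs => rw [hg]
      refine Finset.dvd_gcd fun m _ => ?_
      rw [hP, MvPolynomial.coeff_C_mul]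
      exact mul_dvd_mul_left g (hn m)
    obtain ⟨k, hk⟩ := h1
    have : n * k = 1 := by
      apply mul_left_cancel₀ hg0
      rw [← mul_assoc, ← hk, mul_one]
    exact IsUnit.of_mul_eq_one k this

/-- The scaling of a polynomial to coprime integer coefficients (unique up to sign). -/
def primitiveScaling {σ : Type*} (F : MvPolynomial σ ℚ) : MvPolynomial σ ℤ :=
  open Classical in if h : F = 0 then 0 else (exists_isPrimitiveScaling F h).choose

/-- The index set `S = {I₄, I₈, I₁₂, I₁₈, Δ, H}`. -/
inductive Inv : Type
  | I4 | I8 | I12 | I18 | disc | H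

/-- The degrees of the invariants in the coefficients `a₀, …, a₅`. -/
def Inv.deg : Inv → ℕ
  | .I4 => 4
  | .I8 => 8
  | .I12 => 12
  | .I18 => 18
  | .disc => 8
  | .H => 12

/-- The invariants, scaled to have coprime integer coefficients. -/
def Inv.poly : Inv → MvPolynomial (Fin 6) ℤ
  | .I4 => primitiveScaling rawI4
  | .I8 => primitiveScaling rawI8
  | .I12 => primitiveScaling rawI12
  | .I18 => primitiveScaling rawI18
  | .disc => primitiveScaling rawDisc
  | .H => primitiveScaling rawH

/-- The value of an invariant on the quintic `a₀ x⁵ + a₁ x⁴ z + ⋯ + a₅ z⁵` over `K`. -/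
def Inv.eval {K : Type*} [Field K] (I : Inv) (a : Fin 6 → K) : K :=
  MvPolynomial.aeval a I.poly

/-- A binary quintic is separable if its discriminant does not vanish. -/
def IsSeparable {K : Type*} [Field K] (a : Fin 6 → K) : Prop :=
  Inv.disc.eval a ≠ 0

/-- The zeros in `ℙ¹(K)` of the quintic `a₀ x⁵ + a₁ x⁴ z + ⋯ + a₅ z⁵`. -/
def zeros {K : Type*} [Field K] (a : Fin 6 → K) : Set (ℙ K (Fin 2 → K)) :=
  {P | ∑ i : Fin 6, a i * P.rep 0 ^ (5 - (i : ℕ)) * P.rep 1 ^ (i : ℕ) = 0}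

/-! ## The Berkovich projective line and the tree spanned by a set of points -/

section Tree

variable (K : Type*) [NontriviallyNormedField K]

/-- The linear forms in the homogeneous coordinates `x, z`. -/
abbrev LinForm : Type _ := Module.Dual K (Fin 2 → K)

/-- Nonzero non-archimedean seminorms on the linear forms. As `K` is algebraically closed, every
form in `x, z` is a product of linear ones, so a multiplicative seminorm on `K[x,z]` extending the
absolute value of `K` is determined by its values on linear forms; these are the seminorms that
occur. -/
def FormSeminorm : Type _ :=
  {N : Seminorm K (LinForm K) // N ≠ 0 ∧ IsNonarchimedean N}

/-- Two seminorms are homothetic if they differ by a positive real factor. -/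
def homothety : Setoid (FormSeminorm K) where
  r N N' := ∃ c : ℝ, 0 < c ∧ ∀ l : LinForm K, N.1 l = c * N'.1 l
  iseqv :=
    { refl := fun N => ⟨1, one_pos, fun l => (one_mul _).symm⟩
      symm := by
        rintro N N' ⟨c, hc, h⟩
        refine ⟨c⁻¹, inv_pos.mpr hc, fun l => ?_⟩
        rw [h l, inv_mul_cancel_left₀ hc.ne']
      trans := by
        rintro N N' N'' ⟨c, hc, h⟩ ⟨d, hd, h'⟩
        exact ⟨c * d, mul_pos hc hd, fun l => by rw [h l, h' l, mul_assoc]⟩ }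

/-- The points of the Berkovich analytification of `ℙ¹`. -/
def BerkovichLine : Type _ := Quotient (homothety K)

variable {K}

/-- The seminorm `l ↦ max (s‖l(p)‖) (t‖l(q)‖)` on linear forms. -/
def weightedSeminorm (p q : Fin 2 → K) (s t : ℝ≥0) : Seminorm K (LinForm K) :=
  s • (normSeminorm K K).comp (Module.Dual.eval K (Fin 2 → K) p) ⊔
    t • (normSeminorm K K).comp (Module.Dual.eval K (Fin 2 → K) q)

theorem weightedSeminorm_apply (p q : Fin 2 → K) (s t : ℝ≥0) (l : LinForm K) :
    weightedSeminorm p q s t l = max (s * ‖l p‖) (t * ‖l q‖) := rfl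

theorem weightedSeminorm_ne_zero {p q : Fin 2 → K} (hp : p ≠ 0) (hq : q ≠ 0) {s t : ℝ≥0}
    (h : s ≠ 0 ∨ t ≠ 0) : weightedSeminorm p q s t ≠ 0 := by
  intro h0
  have hz : ∀ l : LinForm K, max (s * ‖l p‖) (t * ‖l q‖) = (0 : ℝ) := fun l => by
    rw [← weightedSeminorm_apply, h0]; rfl
  have aux : ∀ {v : Fin 2 → K}, v ≠ 0 → ∃ i, v i ≠ 0 := fun hv => Function.ne_iff.mp hv
  rcases h with h | h
  · obtain ⟨i, hi⟩ := aux hp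
    have h1 := (le_max_left _ _).trans (hz (LinearMap.proj i)).le
    have h2 : (0 : ℝ) < s * ‖p i‖ := mul_pos (by positivity) (norm_pos_iff.mpr hi)
    exact absurd h1 (not_le.mpr h2)
  · obtain ⟨i, hi⟩ := aux hq
    have h1 := (le_max_right _ _).trans (hz (LinearMap.proj i)).le
    have h2 : (0 : ℝ) < t * ‖q i‖ := mul_pos (by positivity) (norm_pos_iff.mpr hi)
    exact absurd h1 (not_le.mpr h2)

variable [IsUltrametricDist K]

theorem isNonarchimedean_weightedSeminorm (p q : Fin 2 → K) (s t : ℝ≥0) :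
    IsNonarchimedean (weightedSeminorm p q s t) := by
  have key : ∀ (r : ℝ≥0) (v : Fin 2 → K) (l l' : LinForm K),
      (r : ℝ) * ‖(l + l') v‖ ≤ max (r * ‖l v‖) (r * ‖l' v‖) := by
    intro r v l l'
    rw [← mul_max_of_nonneg _ _ r.coe_nonneg]
    exact mul_le_mul_of_nonneg_left (IsUltrametricDist.norm_add_le_max _ _) r.coe_nonneg
  intro l l'
  simp only [weightedSeminorm_apply]
  refine max_le ((key s p l l').trans ?_) ((key t q l l').trans ?_)
  · exact max_le_max (le_max_left _ _) (le_max_left _ _)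
  · exact max_le_max (le_max_right _ _) (le_max_right _ _)

/-- The path in the Berkovich line from `P ∈ ℙ¹(K)` (at time `0`) to `Q ∈ ℙ¹(K)` (at time `1`):
at time `τ` it is at the class of `l ↦ max ((1 - τ)‖l(p)‖) (τ‖l(q)‖)`, where `p` and `q` represent
`P` and `Q`. Other representatives only change the parametrization. -/
def path (P Q : ℙ K (Fin 2 → K)) (τ : unitInterval) : BerkovichLine K :=
  Quotient.mk (homothety K)
    ⟨weightedSeminorm P.rep Q.rep (unitInterval.toNNReal (unitInterval.symm τ))
        (unitInterval.toNNReal τ),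
      weightedSeminorm_ne_zero P.rep_nonzero Q.rep_nonzero (by
        by_contra! h
        have h1 : 1 - (τ : ℝ) = 0 := congrArg NNReal.toReal h.1
        have h2 : (τ : ℝ) = 0 := congrArg NNReal.toReal h.2
        linarith),
      isNonarchimedean_weightedSeminorm _ _ _ _⟩

/-- The type 1 point of the Berkovich line given by `P ∈ ℙ¹(K)`: the class of `l ↦ ‖l(p)‖`. -/
def classicalPoint (P : ℙ K (Fin 2 → K)) : BerkovichLine K := path P P 0

/-- The branch points (vertices of valency at least three) of the tree in the Berkovich line
spanned by `Z`, that is, of the union of the paths between points of `Z`: the points at which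
three distinct points of `Z` lie in pairwise different directions, which means that the point is
in the interior of the three paths between them. -/
def branchPoints (Z : Set (ℙ K (Fin 2 → K))) : Set (BerkovichLine K) :=
  {ξ | ∃ P ∈ Z, ∃ Q ∈ Z, ∃ R ∈ Z, P ≠ Q ∧ Q ≠ R ∧ P ≠ R ∧
    ξ ∈ path P Q '' Set.Ioo 0 1 ∧ ξ ∈ path Q R '' Set.Ioo 0 1 ∧ ξ ∈ path P R '' Set.Ioo 0 1}

/-- The vertices of the tree spanned by `Z`: the leaves, which are the points of `Z`, and the
branch points. -/
def vertices (Z : Set (ℙ K (Fin 2 → K))) : Set (BerkovichLine K) :=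
  classicalPoint '' Z ∪ branchPoints Z

/-- The graph underlying the tree spanned by `Z`: two vertices are joined by an edge if they are
consecutive vertices on a path between two points of `Z`. -/
def treeGraph (Z : Set (ℙ K (Fin 2 → K))) : SimpleGraph (vertices Z) :=
  SimpleGraph.fromRel fun u v => ∃ P ∈ Z, ∃ Q ∈ Z, P ≠ Q ∧ ∃ σ τ : unitInterval, σ < τ ∧
    path P Q σ = u ∧ path P Q τ = v ∧ ∀ ρ ∈ Set.Ioo σ τ, path P Q ρ ∉ vertices Z

end Tree

/-! ## The three unmarked tree types with five leaves -/

/-- Five leaves `1, …, 5` at one vertex `0`. -/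
def typeI : SimpleGraph (Fin 6) :=
  SimpleGraph.fromEdgeSet {s(0, 1), s(0, 2), s(0, 3), s(0, 4), s(0, 5)}

/-- An edge between `0` and `1`, with two leaves at `0` and three leaves at `1`. -/
def typeII : SimpleGraph (Fin 7) :=
  SimpleGraph.fromEdgeSet {s(0, 1), s(0, 2), s(0, 3), s(1, 4), s(1, 5), s(1, 6)}

/-- A chain `0, 1, 2`, with two leaves at each end and one leaf at the middle vertex. -/
def typeIII : SimpleGraph (Fin 8) :=
  SimpleGraph.fromEdgeSet {s(0, 1), s(1, 2), s(0, 3), s(0, 4), s(1, 5), s(2, 6), s(2, 7)}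

/-- The tree of the quintic with coefficients `a` has the combinatorial type `T`. -/
def HasTreeType {K : Type*} [NontriviallyNormedField K] [IsUltrametricDist K] {n : ℕ}
    (a : Fin 6 → K) (T : SimpleGraph (Fin n)) : Prop :=
  Nonempty (treeGraph (zeros a) ≃g T)

/-! ## Valuation and residue field -/

/-- The valuation `v(x) = -log ‖x‖`, with `v(0) = ∞`. -/
def val {K : Type*} [NormedField K] (x : K) : WithTop ℝ :=
  open Classical in if x = 0 then ⊤ else ((-Real.log ‖x‖ : ℝ) : WithTop ℝ)

/-- The residue field of the valuation ring `{x | ‖x‖ ≤ 1}`. -/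
abbrev ResidueField (K : Type*) [NontriviallyNormedField K] [IsUltrametricDist K] : Type _ :=
  IsLocalRing.ResidueField (NormedField.valuation (K := K)).valuationSubring

end BinaryQuintic

end

/-! Factor `f` over the algebraically closed field `K` and order its five zeros so that {0, 1} and
{2, 3} are cherries of the tree, a unit determinant meaning a degenerate cherry. A projective change
of coordinates sends zeros 0, 2, 4 to (1 : 0), (0 : 1), (1 : 1) and the others to (1 : y), (x : 1),
with x and y integral and every determinant of unit norm except possibly those of the two cherries,
which have norms |y| and |x| (`exists_isNormalized`). The tree is of Type I, II or III according to
whether none, one or both of these norms are less than one; if only one is, it can be taken to be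
|y|.

An invariant of degree d of a quintic has weight 5d/2, so the change of coordinates multiplies the
norms of all invariants by the d-th powers of one constant (`exists_norm_eval_eq`). The inequalities
of the theorem are homogeneous and may therefore be tested on the normalized form. There all
invariants are integral and |Δ| = |xy|².

If |x| = |y| = 1, then |Δ| = 1 and everything about Type I follows from integrality. If |y| < 1, the
reduction has a double root at infinity, and a translation (3 is a unit) brings it to z²(x³ + s x z²
+ t z³). On this slice, up to units, I₄ is s, H is 4s³ + 27t², which is minus the discriminant of
the cubic and has norm |x|², and I₁₈ is t(4s³ + 27t²). Hence |H| = 1 exactly if |x| = 1. If |x| < 1,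
then |I₄| = 1. If |x| = 1, then s or t is a unit, so |I₄| = 1 or |I₁₈| = 1. Of I₈ and I₁₂ only
integrality is used.

"Up to units" refers to the primitive integral scalings, whose scaling factors have to be known up
to units without expanding the invariants in six variables. A primitive polynomial takes a value of
norm one at some quintic of good reduction (`exists_norm_aeval_eq_one`), and such a quintic is
integrally equivalent to one on the two-parameter slice xz(x³ + s x² z + t x z² + z³)
(`exists_transform_genericSlice`). On that slice a kernel computation bounds the unscaled invariant
from above; a value on the double-root slice bounds the scaling factor from the other side
(`IsDetecting.norm_eval_doubleRootSlice`).

For the tree, a point on a path between zeros is encoded by the values of its seminorm on the five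
linear forms vanishing at the zeros. Betweenness and order along a path become (in)equalities
between these values and the norms of determinants (`path_eq_path_position_iff`). A finite table of
such values determines the graph (`IsTreeModel.exists_equiv`), and the three tables are checked
symbolically in |y| and |x|. The types have 6, 7 and 8 vertices and so exclude one another. -/

noncomputable section

namespace BinaryQuintic

/-! ### Transvectants and linear substitutions. -/

section Transvectant

open MvPolynomial

variable {A : Type*} [CommRing A]

theorem transvectant_zero (g h : MvPolynomial (Fin 2) A) : transvectant 0 g h = g * h := by
  simp [transvectant]

/-- The commutator of two derivations is a derivation, so it vanishes as soon as it kills the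
variables. -/
theorem pderiv_iterate_comm (i j : Fin 2) (m n : ℕ) (g : MvPolynomial (Fin 2) A) :
    (pderiv i)^[m] ((pderiv j)^[n] g) = (pderiv j)^[n] ((pderiv i)^[m] g) := by
  have hc : Function.Commute (pderiv (R := A) i) (pderiv (R := A) j) := fun g => by
    have h : ⁅(pderiv i : Derivation A (MvPolynomial (Fin 2) A) (MvPolynomial (Fin 2) A)), pderiv (R := A) j⁆ = 0 := by
      apply MvPolynomial.derivation_ext
      intro k
      simp only [Derivation.commutator_apply, pderiv_X, Derivation.coe_zero, Pi.zero_apply]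
      fin_cases i <;> fin_cases j <;> fin_cases k <;> simp
    have := congrArg (fun D => D g) h
    simpa [Derivation.commutator_apply, sub_eq_zero] using this
  exact (hc.iterate_iterate m n).eq g

/-- This is Cayley's Omega process: the r-th transvectant is the r-th power of ∂₀ ⊗ ∂₁ − ∂₁ ⊗ ∂₀
followed by multiplication, and Pascal's rule splits off one factor. Bilinearity, base change and
covariance all follow by induction from this recursion. -/
theorem transvectant_succ (r : ℕ) (g h : MvPolynomial (Fin 2) A) :
    transvectant (r + 1) g h = transvectant r (pderiv 0 g) (pderiv 1 h) -
      transvectant r (pderiv 1 g) (pderiv 0 h) := by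
  have hs := Finset.sum_choose_succ_mul (R := MvPolynomial (Fin 2) A)
    (fun i k => (-1) ^ i * ((pderiv 0)^[k] ((pderiv 1)^[i] g)) *
      ((pderiv 0)^[i] ((pderiv 1)^[k] h))) r
  have e : transvectant (r + 1) g h = ∑ i ∈ Finset.range (r + 2),
      ((r + 1).choose i : MvPolynomial (Fin 2) A) * ((-1) ^ i *
        ((pderiv 0)^[r + 1 - i] ((pderiv 1)^[i] g)) *
          ((pderiv 0)^[i] ((pderiv 1)^[r + 1 - i] h))) :=
    Finset.sum_congr rfl fun i _ => by ring
  rw [e, hs, sub_eq_add_neg]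
  congr 1
  · refine Finset.sum_congr rfl fun i hi => ?_
    have hi' : r + 1 - i = (r - i) + 1 := by
      have := Finset.mem_range.mp hi
      omega
    rw [hi', pderiv_iterate_comm 0 1 _ i g, Function.iterate_succ_apply,
      ← pderiv_iterate_comm 0 1 _ i, Function.iterate_succ_apply (pderiv 1) _ h]
    ring
  · rw [transvectant, ← Finset.sum_neg_distrib]
    refine Finset.sum_congr rfl fun i hi => ?_
    rw [Function.iterate_succ_apply, pderiv_iterate_comm 0 1 (i + 1) _ h,
      Function.iterate_succ_apply (pderiv 0), ← pderiv_iterate_comm 0 1 i _ (pderiv 0 h)]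
    ring

theorem transvectant_add_left (r : ℕ) (f g h : MvPolynomial (Fin 2) A) :
    transvectant r (f + g) h = transvectant r f h + transvectant r g h := by
  induction r generalizing f g h with
  | zero => simp only [transvectant_zero]; ring
  | succ r ih => simp only [transvectant_succ, map_add, ih]; ring

theorem transvectant_add_right (r : ℕ) (f g h : MvPolynomial (Fin 2) A) :
    transvectant r f (g + h) = transvectant r f g + transvectant r f h := by
  induction r generalizing f g h with
  | zero => simp only [transvectant_zero]; ring
  | succ r ih => simp only [transvectant_succ, map_add, ih]; ring

theorem transvectant_C_mul_left (r : ℕ) (c : A) (g h : MvPolynomial (Fin 2) A) :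
    transvectant r (C c * g) h = C c * transvectant r g h := by
  induction r generalizing g h with
  | zero => simp only [transvectant_zero]; ring
  | succ r ih => simp only [transvectant_succ, pderiv_C_mul, ih]; ring

theorem transvectant_C_mul_right (r : ℕ) (c : A) (g h : MvPolynomial (Fin 2) A) :
    transvectant r g (C c * h) = C c * transvectant r g h := by
  induction r generalizing g h with
  | zero => simp only [transvectant_zero]; ring
  | succ r ih => simp only [transvectant_succ, pderiv_C_mul, ih]; ring

theorem transvectant_sum_left {ι : Type*} (r : ℕ) (s : Finset ι)
    (g : ι → MvPolynomial (Fin 2) A) (h : MvPolynomial (Fin 2) A) :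
    transvectant r (∑ i ∈ s, g i) h = ∑ i ∈ s, transvectant r (g i) h :=
  map_sum (AddMonoidHom.mk' (fun g => transvectant r g h)
    fun _ _ => transvectant_add_left r _ _ h) g s

theorem transvectant_sum_right {ι : Type*} (r : ℕ) (s : Finset ι)
    (g : MvPolynomial (Fin 2) A) (h : ι → MvPolynomial (Fin 2) A) :
    transvectant r g (∑ i ∈ s, h i) = ∑ i ∈ s, transvectant r g (h i) :=
  map_sum (AddMonoidHom.mk' (fun h => transvectant r g h)
    fun _ _ => transvectant_add_right r g _ _) h s

theorem map_transvectant {B : Type*} [CommRing B] (φ : A →+* B) (r : ℕ)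
    (g h : MvPolynomial (Fin 2) A) :
    map φ (transvectant r g h) = transvectant r (map φ g) (map φ h) := by
  induction r generalizing g h with
  | zero => simp only [transvectant_zero, map_mul]
  | succ r ih => simp only [transvectant_succ, map_sub, ih, pderiv_map]

/-- The linear substitution `x ↦ m₀₀ x + m₀₁ z`, `z ↦ m₁₀ x + m₁₁ z`. -/
def linSubst (m : Matrix (Fin 2) (Fin 2) A) :
    MvPolynomial (Fin 2) A →ₐ[A] MvPolynomial (Fin 2) A :=
  aeval fun i => C (m i 0) * X 0 + C (m i 1) * X 1

@[simp] theorem linSubst_X (m : Matrix (Fin 2) (Fin 2) A) (i : Fin 2) :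
    linSubst m (X i) = C (m i 0) * X 0 + C (m i 1) * X 1 := by
  simp [linSubst]

@[simp] theorem linSubst_C (m : Matrix (Fin 2) (Fin 2) A) (c : A) :
    linSubst m (C c) = C c := (linSubst m).commutes c

theorem pderiv_linSubst (m : Matrix (Fin 2) (Fin 2) A) (j : Fin 2) (g : MvPolynomial (Fin 2) A) :
    pderiv j (linSubst m g) =
      C (m 0 j) * linSubst m (pderiv 0 g) + C (m 1 j) * linSubst m (pderiv 1 g) := by
  induction g using MvPolynomial.induction_on with
  | C a => simp
  | add p q hp hq => simp only [map_add, hp, hq]; ring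
  | mul_X p i hp =>
    simp only [map_mul, linSubst_X, Derivation.leibniz, hp, smul_eq_mul, map_add, pderiv_C,
      pderiv_X]
    fin_cases i <;> fin_cases j <;> simp <;> ring

/-- By the chain rule a linear substitution multiplies ∂₀ ⊗ ∂₁ − ∂₁ ⊗ ∂₀ by its determinant. -/
theorem transvectant_linSubst (m : Matrix (Fin 2) (Fin 2) A) (r : ℕ)
    (g h : MvPolynomial (Fin 2) A) :
    transvectant r (linSubst m g) (linSubst m h) =
      C (m.det ^ r) * linSubst m (transvectant r g h) := by
  induction r generalizing g h with
  | zero => simp [transvectant_zero]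
  | succ r ih =>
    simp only [transvectant_succ, pderiv_linSubst, transvectant_add_left, transvectant_add_right,
      transvectant_C_mul_left, transvectant_C_mul_right, ih, map_sub, Matrix.det_fin_two, pow_succ,
      map_mul]
    ring

theorem constantCoeff_linSubst (m : Matrix (Fin 2) (Fin 2) A) (g : MvPolynomial (Fin 2) A) :
    constantCoeff (linSubst m g) = constantCoeff g := by
  have : (constantCoeff.comp (linSubst m : _ →+* MvPolynomial (Fin 2) A)) =
      (constantCoeff : MvPolynomial (Fin 2) A →+* A) := by
    apply MvPolynomial.ringHom_ext
    · intro r; simp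
    · intro i; simp
  exact congrArg (fun φ => φ g) this

theorem iterate_pderiv_zero (k a b : ℕ) (c : A) :
    (pderiv 0)^[k] (C c * X 0 ^ a * X 1 ^ b) =
      (C ((a.descFactorial k : A) * c) * X 0 ^ (a - k) * X 1 ^ b : MvPolynomial (Fin 2) A) := by
  induction k with
  | zero => simp
  | succ k ih =>
    rw [Function.iterate_succ_apply', ih]
    simp only [Derivation.leibniz, pderiv_C, Derivation.leibniz_pow, pderiv_X, smul_eq_mul,
      Nat.descFactorial_succ]
    simp [Nat.sub_sub]
    ring

theorem iterate_pderiv_one (k a b : ℕ) (c : A) :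
    (pderiv 1)^[k] (C c * X 0 ^ a * X 1 ^ b) =
      (C ((b.descFactorial k : A) * c) * X 0 ^ a * X 1 ^ (b - k) : MvPolynomial (Fin 2) A) := by
  induction k with
  | zero => simp
  | succ k ih =>
    rw [Function.iterate_succ_apply', ih]
    simp only [Derivation.leibniz, pderiv_C, Derivation.leibniz_pow, pderiv_X, smul_eq_mul,
      Nat.descFactorial_succ]
    simp [Nat.sub_sub]
    ring

/-- The coefficient of the `r`-th transvectant of the monomials `x ^ a z ^ b` and `x ^ c z ^ d`. -/
def transCoeff (r a b c d : ℕ) : ℤ :=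
  ∑ i ∈ Finset.range (r + 1), (-1) ^ i * (r.choose i * b.descFactorial i *
    a.descFactorial (r - i) * d.descFactorial (r - i) * c.descFactorial i : ℕ)

theorem transvectant_monomials (r a b c d : ℕ) (s t : A) :
    transvectant r (C s * X 0 ^ a * X 1 ^ b) (C t * X 0 ^ c * X 1 ^ d) =
      C ((transCoeff r a b c d : A) * (s * t)) * X 0 ^ (a + c - r) * X 1 ^ (b + d - r) := by
  simp only [transvectant, transCoeff, Int.cast_sum, Finset.sum_mul, map_sum]
  refine Finset.sum_congr rfl fun i hi => ?_
  have hir : i ≤ r := by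
    have := Finset.mem_range.mp hi
    omega
  simp only [iterate_pderiv_zero, iterate_pderiv_one]
  -- If some derivative has higher order than the exponent, the truncated exponents on the two sides
  -- need not agree, but a descending factorial vanishes and both terms are zero.
  by_cases h : i ≤ b ∧ r - i ≤ a ∧ r - i ≤ d ∧ i ≤ c
  · obtain ⟨h1, h2, h3, h4⟩ := h
    have e1 : a + c - r = (a - (r - i)) + (c - i) := by omega
    have e2 : b + d - r = (b - i) + (d - (r - i)) := by omega
    rw [e1, e2]
    push_cast
    simp only [map_mul, map_pow, map_neg, map_one, map_natCast, pow_add]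
    ring
  · have h0 : (r.choose i * b.descFactorial i * a.descFactorial (r - i) *
        d.descFactorial (r - i) * c.descFactorial i : ℕ) = 0 := by
      simp only [mul_eq_zero, Nat.descFactorial_eq_zero_iff_lt]
      omega
    have h0' : ((b.descFactorial i : A) * a.descFactorial (r - i) *
        d.descFactorial (r - i) * c.descFactorial i : A) * r.choose i = 0 := by
      have := congrArg (Nat.cast : ℕ → A) h0
      push_cast at this
      linear_combination this
    rw [h0]
    simp only [Nat.cast_zero, mul_zero, Int.cast_zero, zero_mul, map_zero]
    have h1 := congrArg (C : A → MvPolynomial (Fin 2) A) h0'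
    simp only [map_mul, map_natCast, map_zero] at h1
    simp only [map_mul, map_natCast]
    linear_combination ((-1) ^ i * C s * X 0 ^ (a - (r - i)) * X 1 ^ (b - i) * C t *
      X 0 ^ (c - i) * X 1 ^ (d - (r - i))) * h1

end Transvectant

/-! ### Binary quintics given by coefficients or by zeros. -/

section Forms

open MvPolynomial

variable {A B : Type*} [CommRing A] [CommRing B]

/-- The binary quintic with coefficients `a`. -/
def quintic (a : Fin 6 → A) : MvPolynomial (Fin 2) A :=
  ∑ i : Fin 6, C (a i) * X 0 ^ (5 - (i : ℕ)) * X 1 ^ (i : ℕ)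

/-- The product of the linear forms `z_i x - x_i z` with zeros `(x_i : z_i)`. -/
def rootForm (p : Fin 5 → Fin 2 → A) : MvPolynomial (Fin 2) A :=
  ∏ i, (C (p i 1) * X 0 - C (p i 0) * X 1)

/-- The coefficients of a binary form of degree five. -/
def quinticCoeffs (F : MvPolynomial (Fin 2) A) (i : Fin 6) : A :=
  F.coeff (Finsupp.single 0 (5 - (i : ℕ)) + Finsupp.single 1 (i : ℕ))

theorem map_quintic (φ : A →+* B) (a : Fin 6 → A) :
    map φ (quintic a) = quintic fun i => φ (a i) := by
  simp [quintic]

theorem map_rootForm (φ : A →+* B) (p : Fin 5 → Fin 2 → A) :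
    map φ (rootForm p) = rootForm fun i j => φ (p i j) := by
  simp [rootForm, map_prod]

theorem map_universalQuintic {R : Type*} [CommRing R] [Algebra ℚ R] (a : Fin 6 → R) :
    map (aeval a : CoeffRing →ₐ[ℚ] R).toRingHom universalQuintic = quintic a := by
  simp [universalQuintic, quintic]

theorem quinticCoeffs_map (φ : A →+* B) (F : MvPolynomial (Fin 2) A) (i : Fin 6) :
    quinticCoeffs (map φ F) i = φ (quinticCoeffs F i) :=
  coeff_map φ F _

theorem quintic_eq_sum_monomial (a : Fin 6 → A) :
    quintic a = ∑ i : Fin 6,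
      monomial (Finsupp.single 0 (5 - (i : ℕ)) + Finsupp.single 1 (i : ℕ)) (a i) := by
  refine Finset.sum_congr rfl fun i _ => ?_
  rw [mul_assoc, X_pow_eq_monomial, X_pow_eq_monomial, monomial_mul, C_mul_monomial]
  simp

theorem quintic_quinticCoeffs {F : MvPolynomial (Fin 2) A} (hF : F.IsHomogeneous 5) :
    quintic (quinticCoeffs F) = F := by
  classical
  rw [quintic_eq_sum_monomial]
  ext m
  rw [coeff_sum]
  simp only [coeff_monomial]
  by_cases hm : m 0 + m 1 = 5
  · have h1 : m 1 < 6 := by omega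
    rw [Finset.sum_eq_single (⟨m 1, h1⟩ : Fin 6)]
    · have : Finsupp.single (0 : Fin 2) (5 - m 1) + Finsupp.single 1 (m 1) = m := by
        ext j
        fin_cases j <;> (simp; try omega)
      simp only [quinticCoeffs, this, if_true]
    · intro i _ hi
      rw [if_neg]
      rintro rfl
      exact hi (Fin.ext (by simp))
    · simp
  · rw [Finset.sum_eq_zero]
    · symm
      by_contra h
      have := hF h
      rw [Finsupp.weight_apply, Finsupp.sum_fintype _ _ (by simp)] at this
      simp [Fin.sum_univ_two] at this
      exact hm this
    · intro i _
      rw [if_neg]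
      rintro rfl
      apply hm
      have := i.2
      simp
      omega

theorem quinticCoeffs_quintic (a : Fin 6 → A) : quinticCoeffs (quintic a) = a := by
  ext k
  rw [quinticCoeffs, quintic_eq_sum_monomial, coeff_sum, Finset.sum_eq_single k]
  · simp
  · intro i _ hi
    rw [coeff_monomial, if_neg]
    intro h
    apply hi
    have := congrArg (fun m => m 1) h
    simpa [Fin.ext_iff] using this
  · simp

theorem isHomogeneous_rootForm (p : Fin 5 → Fin 2 → A) : (rootForm p).IsHomogeneous 5 := by
  have : (rootForm p).IsHomogeneous (∑ _i : Fin 5, 1) := by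
    refine IsHomogeneous.prod _ _ _ fun i _ => ?_
    exact (isHomogeneous_C_mul_X _ _).sub (isHomogeneous_C_mul_X _ _)
  simpa using this

theorem quintic_quinticCoeffs_rootForm (c : A) (p : Fin 5 → Fin 2 → A) :
    quintic (quinticCoeffs (C c * rootForm p)) = C c * rootForm p :=
  quintic_quinticCoeffs (by simpa using (isHomogeneous_C (Fin 2) c).mul (isHomogeneous_rootForm p))

/-- The determinant of two vectors in the plane. -/
def det₂ (v w : Fin 2 → A) : A := v 0 * w 1 - v 1 * w 0

theorem det₂_mulVec (g : Matrix (Fin 2) (Fin 2) A) (v w : Fin 2 → A) :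
    det₂ (g.mulVec v) (g.mulVec w) = g.det * det₂ v w := by
  simp [det₂, Matrix.mulVec, dotProduct, Fin.sum_univ_two, Matrix.det_fin_two]
  ring

theorem det₂_smul_smul (s t : A) (v w : Fin 2 → A) : det₂ (s • v) (t • w) = s * t * det₂ v w := by
  simp [det₂]
  ring

/-- The factor with zero v is −det(v, (x, z)), and det(u g q, g(x, z)) = u det(g) det(q, (x, z)). So
substituting g undoes g on the zeros. -/
theorem linSubst_rootForm (g : Matrix (Fin 2) (Fin 2) A) (u : Fin 5 → A) (q : Fin 5 → Fin 2 → A) :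
    linSubst g (rootForm fun i => u i • g.mulVec (q i)) =
      C ((∏ i, u i) * g.det ^ 5) * rootForm q := by
  have h5 : g.det ^ 5 = ∏ _i : Fin 5, g.det := by simp
  rw [h5, ← Finset.prod_mul_distrib, map_prod, rootForm, rootForm, map_prod,
    ← Finset.prod_mul_distrib]
  refine Finset.prod_congr rfl fun i _ => ?_
  simp only [map_sub, map_mul, linSubst_C, linSubst_X, Pi.smul_apply, smul_eq_mul, Matrix.mulVec,
    dotProduct, Fin.sum_univ_two, Matrix.det_fin_two, map_add]
  ring

/-- The full transvectant of the `n`-th power of a form with itself. -/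
def powerTransvectant (n r : ℕ) (F : MvPolynomial (Fin 2) A) : A :=
  constantCoeff (transvectant r (F ^ n) (F ^ n))

/-- `⟨⟨F⁵,F⁶⟩₁₀,F⁷⟩₃₅`. -/
def oddTransvectant (F : MvPolynomial (Fin 2) A) : A :=
  constantCoeff (transvectant 35 (transvectant 10 (F ^ 5) (F ^ 6)) (F ^ 7))

theorem map_powerTransvectant (φ : A →+* B) (n r : ℕ) (F : MvPolynomial (Fin 2) A) :
    powerTransvectant n r (map φ F) = φ (powerTransvectant n r F) := by
  rw [powerTransvectant, powerTransvectant, ← constantCoeff_map, map_transvectant, map_pow]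

theorem map_oddTransvectant (φ : A →+* B) (F : MvPolynomial (Fin 2) A) :
    oddTransvectant (map φ F) = φ (oddTransvectant F) := by
  simp only [oddTransvectant, ← constantCoeff_map, map_transvectant, map_pow]

theorem powerTransvectant_C_mul (n r : ℕ) (c : A) (F : MvPolynomial (Fin 2) A) :
    powerTransvectant n r (C c * F) = c ^ (2 * n) * powerTransvectant n r F := by
  simp only [powerTransvectant, mul_pow, ← C_pow, transvectant_C_mul_left,
    transvectant_C_mul_right, map_mul, constantCoeff_C]
  ring

theorem oddTransvectant_C_mul (c : A) (F : MvPolynomial (Fin 2) A) :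
    oddTransvectant (C c * F) = c ^ 18 * oddTransvectant F := by
  simp only [oddTransvectant, mul_pow, ← C_pow, transvectant_C_mul_left,
    transvectant_C_mul_right, map_mul, constantCoeff_C]
  ring

theorem powerTransvectant_linSubst (n r : ℕ) (g : Matrix (Fin 2) (Fin 2) A)
    (F : MvPolynomial (Fin 2) A) :
    powerTransvectant n r (linSubst g F) = g.det ^ r * powerTransvectant n r F := by
  simp only [powerTransvectant, ← map_pow (linSubst g), transvectant_linSubst, map_mul,
    constantCoeff_C, constantCoeff_linSubst]

/-- The inner transvectant contributes exponent 10 and the outer one 35. -/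
theorem oddTransvectant_linSubst (g : Matrix (Fin 2) (Fin 2) A) (F : MvPolynomial (Fin 2) A) :
    oddTransvectant (linSubst g F) = g.det ^ 45 * oddTransvectant F := by
  simp only [oddTransvectant, ← map_pow (linSubst g), transvectant_linSubst,
    transvectant_C_mul_left, map_mul, constantCoeff_C, constantCoeff_linSubst]
  ring

end Forms

/-! ### The invariants before scaling: degrees and weights. -/

section Raw

open MvPolynomial

/-- The invariants before scaling. -/
def Inv.raw : Inv → CoeffRing
  | .I4 => rawI4
  | .I8 => rawI8
  | .I12 => rawI12
  | .I18 => rawI18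
  | .disc => rawDisc
  | .H => rawH

/-- The weights of the invariants. -/
def Inv.weight : Inv → ℕ
  | .I4 => 10
  | .I8 => 20
  | .I12 => 30
  | .I18 => 45
  | .disc => 20
  | .H => 30

theorem Inv.two_mul_weight (I : Inv) : 2 * I.weight = 5 * I.deg := by
  cases I <;> rfl

theorem Inv.poly_eq (I : Inv) : I.poly = primitiveScaling I.raw := by
  cases I <;> rfl

theorem isPrimitiveScaling_primitiveScaling {σ : Type*} {F : MvPolynomial σ ℚ} (hF : F ≠ 0) :
    IsPrimitiveScaling F (primitiveScaling F) := by
  rw [primitiveScaling, dif_neg hF]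
  exact (exists_isPrimitiveScaling F hF).choose_spec

theorem exists_primitiveScaling_eq {σ : Type*} (F : MvPolynomial σ ℚ) :
    ∃ c : ℚ, c ≠ 0 ∧ map (Int.castRingHom ℚ) (primitiveScaling F) = C c * F := by
  by_cases hF : F = 0
  · exact ⟨1, one_ne_zero, by simp [primitiveScaling, hF]⟩
  · exact (isPrimitiveScaling_primitiveScaling hF).1

variable {R : Type*} [CommRing R] [Algebra ℚ R]

theorem aeval_rawI4 (a : Fin 6 → R) : aeval a rawI4 = powerTransvectant 2 10 (quintic a) := by
  rw [← map_universalQuintic, map_powerTransvectant]; rfl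

theorem aeval_rawI8 (a : Fin 6 → R) : aeval a rawI8 = powerTransvectant 4 20 (quintic a) := by
  rw [← map_universalQuintic, map_powerTransvectant]; rfl

theorem aeval_rawI12 (a : Fin 6 → R) : aeval a rawI12 = powerTransvectant 6 30 (quintic a) := by
  rw [← map_universalQuintic, map_powerTransvectant]; rfl

theorem aeval_rawI18 (a : Fin 6 → R) : aeval a rawI18 = oddTransvectant (quintic a) := by
  rw [← map_universalQuintic, map_oddTransvectant]; rfl

theorem aeval_rawH (a : Fin 6 → R) : aeval a rawH =
    algebraMap ℚ R betaConst * powerTransvectant 6 30 (quintic a) -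
      algebraMap ℚ R (396 * alphaConst ^ 3) * powerTransvectant 2 10 (quintic a) ^ 3 := by
  simp only [rawH, map_sub, map_mul, map_pow, aeval_rawI4, aeval_rawI12, algHom_C]

/-- The discriminant is left out here and in the next lemma since it is not defined by
transvectants; its behaviour comes from the root formula `aeval_rawDisc`. -/
theorem Inv.aeval_raw_C_mul {I : Inv} (hI : I ≠ .disc) {a b : Fin 6 → R} {c : R}
    (h : quintic a = C c * quintic b) : aeval a I.raw = c ^ I.deg * aeval b I.raw := by
  cases I
  case disc => exact absurd rfl hI
  all_goals
    simp only [Inv.raw, aeval_rawI4, aeval_rawI8, aeval_rawI12, aeval_rawI18, aeval_rawH, h,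
      powerTransvectant_C_mul, oddTransvectant_C_mul, Inv.deg]
  ring

theorem Inv.aeval_raw_linSubst {I : Inv} (hI : I ≠ .disc) {a b : Fin 6 → R}
    {g : Matrix (Fin 2) (Fin 2) R} (h : quintic a = linSubst g (quintic b)) :
    aeval a I.raw = g.det ^ I.weight * aeval b I.raw := by
  cases I
  case disc => exact absurd rfl hI
  all_goals
    simp only [Inv.raw, aeval_rawI4, aeval_rawI8, aeval_rawI12, aeval_rawI18, aeval_rawH, h,
      powerTransvectant_linSubst, oddTransvectant_linSubst, Inv.weight]
  ring

theorem Inv.exists_eval_eq (I : Inv) : ∃ c : ℚ, c ≠ 0 ∧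
    ∀ {K : Type*} [Field K] [CharZero K] (a : Fin 6 → K), I.eval a = c * aeval a I.raw := by
  obtain ⟨c, hc, h⟩ := exists_primitiveScaling_eq I.raw
  refine ⟨c, hc, fun {K} _ _ a => ?_⟩
  have := congrArg (aeval a : CoeffRing →ₐ[ℚ] K) h
  rw [← algebraMap_int_eq, map_mul, algHom_C, aeval_map_algebraMap] at this
  rw [Inv.eval, I.poly_eq]
  simpa using this

end Raw

/-! ### The discriminant as a product over pairs of zeros. -/

section Discriminant

open MvPolynomial

theorem natDegree_sum_universal :
    (∑ i : Fin 6, Polynomial.C (X i : CoeffRing) * Polynomial.X ^ (5 - (i : ℕ))).natDegree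
      = 5 := by
  have h0 : (X 0 : CoeffRing) ≠ 0 := X_ne_zero 0
  simp only [Fin.sum_univ_six]
  norm_num
  compute_degree!

/-- The usual sign (−1)^(n(n−1)/2) is +1 for n = 5. -/
theorem X_zero_mul_rawDisc :
    (X 0 : CoeffRing) * rawDisc = Polynomial.resultant
      (∑ i : Fin 6, Polynomial.C (X i : CoeffRing) * Polynomial.X ^ (5 - (i : ℕ)))
      (∑ i : Fin 6, Polynomial.C (X i : CoeffRing) * Polynomial.X ^ (5 - (i : ℕ))).derivative
      5 4 := by
  have hd := natDegree_sum_universal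
  have := Polynomial.resultant_deriv
    (f := ∑ i : Fin 6, Polynomial.C (X i : CoeffRing) * Polynomial.X ^ (5 - (i : ℕ)))
    (Polynomial.natDegree_pos_iff_degree_pos.mp (by rw [hd]; norm_num))
  have hl : (∑ i : Fin 6, Polynomial.C (X i : CoeffRing) *
      Polynomial.X ^ (5 - (i : ℕ))).leadingCoeff = X 0 := by
    rw [Polynomial.leadingCoeff, hd]
    simp [Fin.sum_univ_six, Polynomial.coeff_X_pow]
  rw [hl, hd] at this
  rw [this, rawDisc]
  norm_num

/-- The product of the squares of the determinants of all pairs of vectors. -/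
def detSqProd {A : Type*} [CommRing A] (p : Fin 5 → Fin 2 → A) : A :=
  (det₂ (p 0) (p 1) * det₂ (p 0) (p 2) * det₂ (p 0) (p 3) * det₂ (p 0) (p 4) *
    det₂ (p 1) (p 2) * det₂ (p 1) (p 3) * det₂ (p 1) (p 4) * det₂ (p 2) (p 3) *
    det₂ (p 2) (p 4) * det₂ (p 3) (p 4)) ^ 2

/-- The resultant is c⁴ ∏ f'(tᵢ), and each f'(tᵢ) is c times the product of tᵢ − tⱼ over j ≠ i. Each
of the ten differences occurs once with either sign, so the total sign is (−1)¹⁰ = 1. -/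
theorem resultant_derivative_prod {K : Type*} [Field K] [CharZero K] (c : K) (hc : c ≠ 0)
    (t : Fin 5 → K) :
    Polynomial.resultant (Polynomial.C c * ∏ i, (Polynomial.X - Polynomial.C (t i)))
      (Polynomial.C c * ∏ i, (Polynomial.X - Polynomial.C (t i))).derivative 5 4 =
      c ^ 9 * detSqProd fun i => ![t i, 1] := by
  have hm : (∏ i, (Polynomial.X - Polynomial.C (t i))).Monic :=
    Polynomial.monic_prod_of_monic _ _ fun i _ => Polynomial.monic_X_sub_C _
  have hn : (∏ i, (Polynomial.X - Polynomial.C (t i))).natDegree = 5 := by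
    rw [Polynomial.natDegree_prod_of_monic _ _ fun i _ => Polynomial.monic_X_sub_C _]
    simp
  set f := Polynomial.C c * ∏ i, (Polynomial.X - Polynomial.C (t i)) with hf
  have hfn : f.natDegree = 5 := by rw [hf, Polynomial.natDegree_C_mul hc, hn]
  have hs : f.Splits := by
    refine (Polynomial.Splits.C c).mul ?_
    exact Polynomial.Splits.prod fun i _ => Polynomial.Splits.X_sub_C _
  have hr : f.roots = Finset.univ.val.map t := by
    rw [hf, Polynomial.roots_C_mul _ hc]
    have := Polynomial.roots_multiset_prod_X_sub_C (Finset.univ.val.map t)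
    rwa [Multiset.map_map] at this
  have := Polynomial.resultant_eq_prod_eval f f.derivative 4
    ((Polynomial.natDegree_derivative_le f).trans (by rw [hfn])) hs
  rw [hfn] at this
  rw [this, hr]
  have hlc : f.leadingCoeff = c := by
    rw [hf, Polynomial.leadingCoeff_mul, hm]; simp
  rw [hlc, Multiset.map_map]
  change c ^ 4 * ∏ i, (f.derivative.eval (t i)) = _
  have hs : ∀ i j, t j - t i = -(t i - t j) := fun i j => by ring
  have hd : ∀ i j, det₂ ![t i, 1] ![t j, 1] = t i - t j := fun i j => by simp [det₂]
  simp only [hf, Fin.prod_univ_five, Polynomial.derivative_mul, Polynomial.derivative_C,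
    Polynomial.derivative_sub, Polynomial.derivative_X, Polynomial.eval_add, Polynomial.eval_mul,
    Polynomial.eval_sub, Polynomial.eval_X, Polynomial.eval_C, detSqProd, hd, sub_self, zero_mul, mul_zero, zero_add, add_zero, sub_zero,
    one_mul, mul_one]
  rw [hs 0 1, hs 0 2, hs 0 3, hs 0 4, hs 1 2, hs 1 3, hs 1 4, hs 2 3, hs 2 4, hs 3 4]
  generalize t 0 - t 1 = d01, t 0 - t 2 = d02, t 0 - t 3 = d03, t 0 - t 4 = d04,
    t 1 - t 2 = d12, t 1 - t 3 = d13, t 1 - t 4 = d14, t 2 - t 3 = d23, t 2 - t 4 = d24,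
    t 3 - t 4 = d34
  ring

theorem detSqProd_smul {A : Type*} [CommRing A] (u : Fin 5 → A) (p : Fin 5 → Fin 2 → A) :
    detSqProd (fun i => u i • p i) = (∏ i, u i) ^ 8 * detSqProd p := by
  simp only [detSqProd, det₂_smul_smul, Fin.prod_univ_five]
  ring

theorem detSqProd_mulVec {A : Type*} [CommRing A] (g : Matrix (Fin 2) (Fin 2) A)
    (p : Fin 5 → Fin 2 → A) :
    detSqProd (fun i => g.mulVec (p i)) = g.det ^ 20 * detSqProd p := by
  simp only [detSqProd, det₂_mulVec]
  ring

theorem map_detSqProd {A B : Type*} [CommRing A] [CommRing B] (φ : A →+* B)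
    (p : Fin 5 → Fin 2 → A) :
    φ (detSqProd p) = detSqProd fun i j => φ (p i j) := by
  simp [detSqProd, det₂]

/-- When no zero lies at infinity, dehomogenizing gives a polynomial of exact degree 5 with leading
coefficient c ∏ zᵢ = a₀ ≠ 0, which can be cancelled from the resultant formula. -/
theorem aeval_rawDisc_of_ne_zero {K : Type*} [Field K] [CharZero K] {a : Fin 6 → K} {c : K}
    {p : Fin 5 → Fin 2 → K} (hc : c ≠ 0) (hp : ∀ i, p i 1 ≠ 0)
    (h : quintic a = C c * rootForm p) :
    aeval a rawDisc = c ^ 8 * detSqProd p := by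
  have hpoly : ∑ i : Fin 6, Polynomial.C (a i) * Polynomial.X ^ (5 - (i : ℕ)) =
      Polynomial.C (c * ∏ i, p i 1) *
        ∏ i, (Polynomial.X - Polynomial.C (p i 0 / p i 1)) := by
    have := congrArg (eval₂Hom Polynomial.C ![(Polynomial.X : Polynomial K), 1]) h
    simp only [quintic, rootForm, map_sum, map_mul, map_pow, map_prod, map_sub,
      coe_eval₂Hom, eval₂_C, eval₂_X, Matrix.cons_val_zero, Matrix.cons_val_one, one_pow,
      mul_one] at this
    rw [this, Polynomial.C_mul, mul_assoc, map_prod, ← Finset.prod_mul_distrib]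
    refine congrArg (Polynomial.C c * ·) (Finset.prod_congr rfl fun i _ => ?_)
    rw [mul_sub, ← Polynomial.C_mul, mul_div_cancel₀ _ (hp i)]
  have hP : ∏ i, p i 1 ≠ 0 := Finset.prod_ne_zero_iff.mpr fun i _ => hp i
  have ha : a 0 = c * ∏ i, p i 1 := by
    have := congrArg (fun f => Polynomial.coeff f 5) hpoly
    have hm : (∏ i, (Polynomial.X - Polynomial.C (p i 0 / p i 1))).Monic :=
      Polynomial.monic_prod_of_monic _ _ fun i _ => Polynomial.monic_X_sub_C _
    have hn : (∏ i, (Polynomial.X - Polynomial.C (p i 0 / p i 1))).natDegree = 5 := by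
      rw [Polynomial.natDegree_prod_of_monic _ _ fun i _ => Polynomial.monic_X_sub_C _]
      simp
    rw [Polynomial.Monic, Polynomial.leadingCoeff, hn] at hm
    simp only [Polynomial.coeff_C_mul, hm, mul_one] at this
    rw [← this]
    simp [Fin.sum_univ_six, Polynomial.coeff_X_pow]
  have h1 := congrArg (aeval a : CoeffRing →ₐ[ℚ] K).toRingHom X_zero_mul_rawDisc
  have hmap : (∑ i : Fin 6, Polynomial.C (X i : CoeffRing) * Polynomial.X ^ (5 - (i : ℕ))).map
      (aeval a : CoeffRing →ₐ[ℚ] K).toRingHom =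
        ∑ i : Fin 6, Polynomial.C (a i) * Polynomial.X ^ (5 - (i : ℕ)) := by
    simp [Polynomial.map_sum]
  rw [← Polynomial.resultant_map_map, ← Polynomial.derivative_map, map_mul, hmap] at h1
  simp only [AlgHom.toRingHom_eq_coe, RingHom.coe_coe, aeval_X] at h1
  rw [hpoly, resultant_derivative_prod _ (mul_ne_zero hc hP), ha] at h1
  have h2 : detSqProd p = (∏ i, p i 1) ^ 8 * detSqProd fun i => ![p i 0 / p i 1, 1] := by
    have h3 : p = fun i => p i 1 • ![p i 0 / p i 1, 1] := by
      ext i j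
      fin_cases j
      · simp [mul_div_cancel₀ _ (hp i)]
      · simp
    conv_lhs => rw [h3, detSqProd_smul]
  rw [h2]
  apply mul_left_cancel₀ (mul_ne_zero hc hP)
  rw [h1]
  ring

/-- Deformation removes the restriction to the affine chart: replace c by c + ε and every zᵢ by zᵢ +
ε. The difference of the two sides is a polynomial in ε that vanishes for all but finitely many ε,
hence also at ε = 0. -/
theorem aeval_rawDisc {K : Type*} [Field K] [CharZero K] {a : Fin 6 → K} {c : K}
    {p : Fin 5 → Fin 2 → K} (h : quintic a = C c * rootForm p) :
    aeval a rawDisc = c ^ 8 * detSqProd p := by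
  let c' : Polynomial K := Polynomial.C c + Polynomial.X
  let p' : Fin 5 → Fin 2 → Polynomial K := fun i j =>
    Polynomial.C (p i j) + if j = 1 then Polynomial.X else 0
  let a' : Fin 6 → Polynomial K := quinticCoeffs (C c' * rootForm p')
  let D : Polynomial K := aeval a' rawDisc - c' ^ 8 * detSqProd p'
  have hev : ∀ e : K, D.eval e = aeval (fun i => (a' i).eval e) rawDisc -
      (c'.eval e) ^ 8 * detSqProd fun i j => (p' i j).eval e := by
    intro e
    have h1 := comp_aeval_apply (f := a') (Polynomial.evalRingHom e).toRatAlgHom rawDisc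
    have h2 := map_detSqProd (Polynomial.evalRingHom e) p'
    change (aeval a' rawDisc).eval e = aeval (fun i => (a' i).eval e) rawDisc at h1
    simp only [Polynomial.coe_evalRingHom] at h2
    simp only [D, Polynomial.eval_sub, Polynomial.eval_mul, Polynomial.eval_pow, h1, h2]
  have hq : ∀ e : K, quintic (fun i => (a' i).eval e) =
      C (c'.eval e) * rootForm fun i j => (p' i j).eval e := by
    intro e
    have h1 := map_quintic (Polynomial.evalRingHom e) a'
    rw [quintic_quinticCoeffs_rootForm, map_mul, map_rootForm, map_C] at h1
    exact h1.symm
  have hz : D = 0 := by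
    apply Polynomial.eq_zero_of_infinite_isRoot
    have hfin : ({-c} ∪ Set.range fun i => -p i 1 : Set K).Finite :=
      (Set.finite_singleton _).union (Set.finite_range _)
    refine hfin.infinite_compl.mono fun e he => ?_
    simp only [Set.mem_compl_iff, Set.mem_union, Set.mem_singleton_iff, Set.mem_range, not_or,
      not_exists] at he
    change D.eval e = 0
    rw [hev, sub_eq_zero]
    refine aeval_rawDisc_of_ne_zero ?_ ?_ (hq e)
    · simp only [c', Polynomial.eval_add, Polynomial.eval_C, Polynomial.eval_X]
      intro h0
      exact he.1 (by linear_combination h0)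
    · intro i h0
      simp only [p', if_true, Polynomial.eval_add, Polynomial.eval_C, Polynomial.eval_X] at h0
      exact he.2 i (by linear_combination -h0)
  have h0 := hev 0
  have hp0 : (fun i j => (p' i j).eval 0) = p := by
    ext i j
    simp only [p']
    split_ifs <;> simp
  have hc0 : c'.eval 0 = c := by simp [c']
  have ha0 : (fun i => (a' i).eval 0) = a := by
    have h1 := hq 0
    rw [hp0, hc0, ← h] at h1
    rw [← quinticCoeffs_quintic (fun i => (a' i).eval 0), h1, quinticCoeffs_quintic]
  rw [hz, hp0, hc0, ha0, Polynomial.eval_zero] at h0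
  exact (sub_eq_zero.mp h0.symm)

end Discriminant

section Lists

/-! ### Computable polynomials, as lists of coefficients -/

/-- Addition of coefficient lists. -/
def listAdd {R : Type*} (add : R → R → R) : List R → List R → List R
  | [], q => q
  | p, [] => p
  | a :: p, b :: q => add a b :: listAdd add p q

/-- Multiplication of coefficient lists. -/
def listMul {R : Type*} (zero : R) (add mul : R → R → R) : List R → List R → List R
  | [], _ => []
  | a :: p, q => listAdd add (q.map (mul a)) (zero :: listMul zero add mul p q)

/-- The value at `x` of the polynomial with the given list of coefficients. -/
def listEval {R S : Type*} [CommRing S] (φ : R → S) (x : S) : List R → S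
  | [] => 0
  | a :: p => φ a + x * listEval φ x p

variable {R S : Type*} [CommRing S] {φ : R → S} {x : S} {o : R} {fa fm : R → R → R}

theorem listEval_add (ha : ∀ a b, φ (fa a b) = φ a + φ b) (p q : List R) :
    listEval φ x (listAdd fa p q) = listEval φ x p + listEval φ x q := by
  induction p generalizing q with
  | nil => simp [listAdd, listEval]
  | cons a p ih =>
    cases q with
    | nil => simp [listAdd, listEval]
    | cons b q => simp only [listAdd, listEval, ih, ha]; ring

theorem listEval_map_mul (hm : ∀ a b, φ (fm a b) = φ a * φ b) (a : R) (p : List R) :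
    listEval φ x (p.map (fm a)) = φ a * listEval φ x p := by
  induction p with
  | nil => simp [listEval]
  | cons b p ih => simp only [List.map, listEval, ih, hm]; ring

theorem listEval_mul (h0 : φ o = 0) (ha : ∀ a b, φ (fa a b) = φ a + φ b)
    (hm : ∀ a b, φ (fm a b) = φ a * φ b) (p q : List R) :
    listEval φ x (listMul o fa fm p q) = listEval φ x p * listEval φ x q := by
  induction p with
  | nil => simp [listMul, listEval]
  | cons a p ih =>
    simp only [listMul, listEval, listEval_add ha, listEval_map_mul hm, ih, h0]
    ring

/-- Polynomials in two variables with integer coefficients, as lists of terms: `(i, j, c)` stands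
for `c s ^ i t ^ j`. -/
abbrev Poly₂ : Type := List (ℕ × ℕ × ℤ)

/-- The sum of `m :: p` and a polynomial, where `f` adds `p`. -/
def Poly₂.addCons (m : ℕ × ℕ × ℤ) (p : Poly₂) (f : Poly₂ → Poly₂) : Poly₂ → Poly₂
  | [] => m :: p
  | n :: q =>
    if m.1 = n.1 then
      if m.2.1 = n.2.1 then (m.1, m.2.1, m.2.2 + n.2.2) :: f q
      else if m.2.1 < n.2.1 then m :: f (n :: q) else n :: addCons m p f q
    else if m.1 < n.1 then m :: f (n :: q) else n :: addCons m p f q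

/-- Addition, which keeps the lists sorted. -/
def Poly₂.add : Poly₂ → Poly₂ → Poly₂
  | [] => id
  | m :: p => addCons m p (add p)

def Poly₂.smul (n : ℤ) (p : Poly₂) : Poly₂ := p.map fun m => (m.1, m.2.1, n * m.2.2)

def Poly₂.mul : Poly₂ → Poly₂ → Poly₂
  | [], _ => []
  | m :: p, q => add (q.map fun n => (m.1 + n.1, m.2.1 + n.2.1, m.2.2 * n.2.2)) (mul p q)

def Poly₂.eval (s t : S) (p : Poly₂) : S :=
  (p.map fun m => (m.2.2 : S) * s ^ m.1 * t ^ m.2.1).sum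

variable (s t : S)

@[simp] theorem Poly₂.eval_nil : Poly₂.eval s t [] = 0 := rfl

@[simp] theorem Poly₂.eval_cons (m : ℕ × ℕ × ℤ) (p : Poly₂) :
    Poly₂.eval s t (m :: p) = m.2.2 * s ^ m.1 * t ^ m.2.1 + Poly₂.eval s t p := by
  simp [Poly₂.eval]

theorem Poly₂.eval_addCons (m : ℕ × ℕ × ℤ) (p : Poly₂) (f : Poly₂ → Poly₂)
    (hf : ∀ q, Poly₂.eval s t (f q) = Poly₂.eval s t p + Poly₂.eval s t q) (q : Poly₂) :
    Poly₂.eval s t (addCons m p f q) = Poly₂.eval s t (m :: p) + Poly₂.eval s t q := by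
  induction q with
  | nil => simp [addCons]
  | cons n q ih =>
    simp only [eval_cons] at ih
    simp only [addCons]
    split_ifs with h1 h2 h3 h3
    · simp only [eval_cons, hf, ← h1, ← h2]; push_cast; ring
    all_goals simp only [eval_cons, hf, ih]; ring

theorem Poly₂.eval_add (p q : Poly₂) :
    Poly₂.eval s t (Poly₂.add p q) = Poly₂.eval s t p + Poly₂.eval s t q := by
  induction p generalizing q with
  | nil => simp [add]
  | cons m p ih => exact eval_addCons s t m p _ ih q

theorem Poly₂.eval_smul (n : ℤ) (p : Poly₂) :
    Poly₂.eval s t (Poly₂.smul n p) = n * Poly₂.eval s t p := by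
  induction p with
  | nil => simp [smul]
  | cons m p ih =>
    simp only [smul, List.map, eval_cons] at ih ⊢
    rw [ih]; push_cast; ring

theorem Poly₂.eval_mul (p q : Poly₂) :
    Poly₂.eval s t (Poly₂.mul p q) = Poly₂.eval s t p * Poly₂.eval s t q := by
  have h : ∀ (m : ℕ × ℕ × ℤ) (q : Poly₂), Poly₂.eval s t
      (q.map fun n => (m.1 + n.1, m.2.1 + n.2.1, m.2.2 * n.2.2)) =
        m.2.2 * s ^ m.1 * t ^ m.2.1 * Poly₂.eval s t q := by
    intro m q
    induction q with
    | nil => simp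
    | cons n q ih => simp only [List.map, eval_cons, ih]; push_cast; ring
  induction p with
  | nil => simp [mul]
  | cons m p ih => simp only [mul, eval_add, h, ih, eval_cons]; ring

/-- Sum of a list of polynomials. -/
def Poly₂.sum (l : List Poly₂) : Poly₂ := l.foldr Poly₂.add []

theorem Poly₂.eval_sum (l : List Poly₂) :
    Poly₂.eval s t (Poly₂.sum l) = (l.map (Poly₂.eval s t)).sum := by
  induction l with
  | nil => rfl
  | cons a l ih => simp only [sum, List.foldr, List.map, List.sum_cons, eval_add] at ih ⊢; rw [ih]

/-- Polynomials in one variable with coefficients in `Poly₂`. -/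
abbrev Poly₃ : Type := List Poly₂

def Poly₃.mul : Poly₃ → Poly₃ → Poly₃ := listMul [] Poly₂.add Poly₂.mul

def Poly₃.pow (p : Poly₃) : ℕ → Poly₃
  | 0 => [[(0, 0, 1)]]
  | n + 1 => Poly₃.mul p (Poly₃.pow p n)

/-- The polynomial over `S` obtained by substituting `s` and `t`. -/
def Poly₃.toPoly (p : Poly₃) : Polynomial S :=
  listEval (fun a => Polynomial.C (Poly₂.eval s t a)) Polynomial.X p

theorem Poly₃.toPoly_mul (p q : Poly₃) : Poly₃.toPoly s t (Poly₃.mul p q) = Poly₃.toPoly s t p * Poly₃.toPoly s t q :=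
  listEval_mul (by simp [Poly₂.eval]) (fun _ _ => by rw [Poly₂.eval_add, map_add])
    (fun _ _ => by rw [Poly₂.eval_mul, map_mul]) _ _

theorem Poly₃.toPoly_pow (p : Poly₃) (n : ℕ) : Poly₃.toPoly s t (Poly₃.pow p n) = Poly₃.toPoly s t p ^ n := by
  induction n with
  | zero => simp [pow, toPoly, listEval, Poly₂.eval]
  | succ n ih => rw [pow, toPoly_mul, ih, pow_succ']

theorem Poly₃.coeff_toPoly (p : Poly₃) (i : ℕ) :
    (Poly₃.toPoly s t p).coeff i = Poly₂.eval s t (p.getD i []) := by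
  induction p generalizing i with
  | nil => simp [toPoly, listEval, Poly₂.eval]
  | cons a p ih =>
    simp only [toPoly, listEval] at ih ⊢
    cases i with
    | zero => simp
    | succ i => simp [ih]

/-- The coefficients of `⟨p,q⟩_r`, a constant, for forms `p`, `q` of degree `r`. -/
def pairing (r : ℕ) (p q : Poly₃) : Poly₂ :=
  Poly₂.sum ((List.range (r + 1)).map fun i =>
    Poly₂.smul ((-1) ^ (r - i) * (r.factorial * i.factorial * (r - i).factorial : ℕ))
      (Poly₂.mul (p.getD i []) (q.getD (r - i) [])))

/-- The transvectant `⟨p,q⟩_r` for forms `p`, `q` of degrees `m`, `n`. -/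
def listTransvectant (r m n : ℕ) (p q : Poly₃) : Poly₃ :=
  (List.range (m + n - 2 * r + 1)).map fun k =>
    Poly₂.sum ((List.range (m + 1)).map fun i =>
      if i ≤ k + r ∧ k + r ≤ n + i then
        Poly₂.smul (transCoeff r i (m - i) (k + r - i) (n - (k + r - i)))
          (Poly₂.mul (p.getD i []) (q.getD (k + r - i) []))
      else [])

end Lists

/-! ### Transvectants computed on coefficient lists. -/

section ListTransvectant

open MvPolynomial

variable {S : Type*} [CommRing S]

theorem homogenize_eq_sum (p : Polynomial S) (n : ℕ) :
    p.homogenize n = ∑ i ∈ Finset.range (n + 1), C (p.coeff i) * X 0 ^ i * X 1 ^ (n - i) := by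
  rw [Polynomial.homogenize, Finset.Nat.sum_antidiagonal_eq_sum_range_succ_mk]
  refine Finset.sum_congr rfl fun i _ => ?_
  rw [mul_assoc, X_pow_eq_monomial, X_pow_eq_monomial, monomial_mul, C_mul_monomial, mul_one,
    mul_one]
  congr 2
  ext j
  fin_cases j <;> simp

theorem transCoeff_eq_zero_left {r a b c d : ℕ} (h : a + c < r) : transCoeff r a b c d = 0 := by
  refine Finset.sum_eq_zero fun i hi => ?_
  have : a.descFactorial (r - i) = 0 ∨ c.descFactorial i = 0 := by
    simp only [Nat.descFactorial_eq_zero_iff_lt]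
    omega
  rcases this with h | h <;> simp [h]

theorem transCoeff_eq_zero_right {r a b c d : ℕ} (h : b + d < r) : transCoeff r a b c d = 0 := by
  refine Finset.sum_eq_zero fun i hi => ?_
  have : d.descFactorial (r - i) = 0 ∨ b.descFactorial i = 0 := by
    simp only [Nat.descFactorial_eq_zero_iff_lt]
    omega
  rcases this with h | h <;> simp [h]

/-- Only the summand with index r − i survives; in every other one some variable is differentiated
more often than it occurs. -/
theorem transCoeff_full {r i : ℕ} (h : i ≤ r) : transCoeff r i (r - i) (r - i) i =
    (-1) ^ (r - i) * (r.factorial * i.factorial * (r - i).factorial : ℕ) := by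
  rw [transCoeff, Finset.sum_eq_single (r - i)]
  · have e : r - (r - i) = i := by omega
    rw [e, Nat.descFactorial_self, Nat.descFactorial_self, Nat.choose_symm h,
      ← Nat.choose_mul_factorial_mul_factorial h]
    push_cast
    ring
  · intro m hm hne
    have hm' := Finset.mem_range.mp hm
    have : (r - i).descFactorial m = 0 ∨ i.descFactorial (r - m) = 0 := by
      simp only [Nat.descFactorial_eq_zero_iff_lt]
      omega
    rcases this with h | h <;> simp [h]
  · intro h
    exact absurd (Finset.mem_range.mpr (by omega)) h

/-- For forms of degree r the r-th transvectant is a pairing in which xⁱ zʳ⁻ⁱ meets only the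
monomial with complementary exponents. -/
theorem constantCoeff_transvectant_homogenize (r : ℕ) (p q : Polynomial S) :
    constantCoeff (transvectant r (p.homogenize r) (q.homogenize r)) =
      ∑ i ∈ Finset.range (r + 1), ((-1) ^ (r - i) *
        (r.factorial * i.factorial * (r - i).factorial : ℕ) : ℤ) *
          (p.coeff i * q.coeff (r - i)) := by
  simp only [homogenize_eq_sum, transvectant_sum_left, transvectant_sum_right, map_sum,
    transvectant_monomials]
  rw [Finset.sum_comm]
  refine Finset.sum_congr rfl fun i hi => ?_
  have hi' : i ≤ r := by
    have := Finset.mem_range.mp hi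
    omega
  rw [Finset.sum_eq_single (r - i)]
  · have e1 : i + (r - i) - r = 0 := by omega
    have e2 : r - i + (r - (r - i)) - r = 0 := by omega
    have e3 : r - (r - i) = i := by omega
    rw [e1, e2, e3, transCoeff_full hi']
    simp
  · intro j hj hne
    have hj' := Finset.mem_range.mp hj
    have : i + j - r ≠ 0 ∨ r - i + (r - j) - r ≠ 0 := by omega
    rcases this with h | h <;> simp [h]
  · intro h
    exact absurd (Finset.mem_range.mpr (by omega)) h

/-- A reindexing by k = i + j − r. The hypotheses `h1` and `h2` discard the pairs for which k or the
complementary exponent would be negative, where truncated subtraction would give wrong monomials. -/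
theorem coeff_transvectant_sum {r m n : ℕ} (hm : r ≤ m) (hn : r ≤ n) (g : ℕ → ℕ → S)
    (h1 : ∀ i j, i + j < r → g i j = 0) (h2 : ∀ i j, i ≤ m → j ≤ n → m + n < i + j + r → g i j = 0)
    (M : ℕ → MvPolynomial (Fin 2) S) :
    ∑ i ∈ Finset.range (m + 1), ∑ j ∈ Finset.range (n + 1), C (g i j) * M (i + j - r) =
      ∑ k ∈ Finset.range (m + n - 2 * r + 1),
        C (∑ i ∈ Finset.range (m + 1), if i ≤ k + r ∧ k + r ≤ n + i then g i (k + r - i) else 0) *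
          M k := by
  simp only [map_sum, Finset.sum_mul]
  rw [Finset.sum_comm (s := Finset.range (m + n - 2 * r + 1))]
  refine Finset.sum_congr rfl fun i hi => ?_
  have hi' := Finset.mem_range.mp hi
  rw [← Finset.sum_filter_add_sum_filter_not (Finset.range (n + 1))
    (fun j => r ≤ i + j ∧ i + j + r ≤ m + n)]
  rw [Finset.sum_eq_zero (s := Finset.filter (fun j => ¬ _) _), add_zero]
  · have : ∀ k, C (if i ≤ k + r ∧ k + r ≤ n + i then g i (k + r - i) else 0) * M k =
        if i ≤ k + r ∧ k + r ≤ n + i then C (g i (k + r - i)) * M k else 0 := by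
      intro k
      split_ifs <;> simp
    simp only [this]
    rw [← Finset.sum_filter]
    refine Finset.sum_nbij' (fun j => i + j - r) (fun k => k + r - i) ?_ ?_ ?_ ?_ ?_
    · intro j hj
      simp only [Finset.mem_filter, Finset.mem_range] at hj ⊢
      omega
    · intro k hk
      simp only [Finset.mem_filter, Finset.mem_range] at hk ⊢
      omega
    · intro j hj
      simp only [Finset.mem_filter, Finset.mem_range] at hj
      omega
    · intro k hk
      simp only [Finset.mem_filter, Finset.mem_range] at hk
      omega
    · intro j hj
      simp only [Finset.mem_filter, Finset.mem_range] at hj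
      have e : i + j - r + r - i = j := by omega
      rw [e]
  · intro j hj
    simp only [Finset.mem_filter, Finset.mem_range, not_and_or, not_le] at hj
    rcases hj.2 with h | h
    · rw [h1 i j h]; simp
    · rw [h2 i j (by omega) (by omega) h]; simp

theorem transvectant_homogenize {r m n : ℕ} (hm : r ≤ m) (hn : r ≤ n) (p q : Polynomial S) :
    transvectant r (p.homogenize m) (q.homogenize n) =
      ∑ k ∈ Finset.range (m + n - 2 * r + 1),
        C (∑ i ∈ Finset.range (m + 1), if i ≤ k + r ∧ k + r ≤ n + i then
          (transCoeff r i (m - i) (k + r - i) (n - (k + r - i)) : S) *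
            (p.coeff i * q.coeff (k + r - i)) else 0) *
          (X 0 ^ k * X 1 ^ (m + n - 2 * r - k)) := by
  rw [← coeff_transvectant_sum hm hn (fun i j => (transCoeff r i (m - i) j (n - j) : S) *
      (p.coeff i * q.coeff j)) _ _ (fun k => X 0 ^ k * X 1 ^ (m + n - 2 * r - k))]
  · simp only [homogenize_eq_sum, transvectant_sum_left, transvectant_sum_right,
      transvectant_monomials]
    rw [Finset.sum_comm]
    refine Finset.sum_congr rfl fun i hi => Finset.sum_congr rfl fun j hj => ?_
    have hi' := Finset.mem_range.mp hi
    have hj' := Finset.mem_range.mp hj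
    by_cases h : i + j < r
    · rw [transCoeff_eq_zero_left h]; simp
    · have e : m - i + (n - j) - r = m + n - 2 * r - (i + j - r) := by omega
      rw [e, mul_assoc]
  · intro i j h
    simp only [transCoeff_eq_zero_left h, Int.cast_zero, zero_mul]
  · intro i j hi hj h
    have : m - i + (n - j) < r := by omega
    simp only [transCoeff_eq_zero_right this, Int.cast_zero, zero_mul]

theorem list_sum_map_range {M : Type*} [AddCommMonoid M] (n : ℕ) (f : ℕ → M) :
    ((List.range n).map f).sum = ∑ i ∈ Finset.range n, f i := by
  rw [Finset.sum_range, ← List.sum_ofFn, List.ofFn_eq_map, ← List.map_coe_finRange_eq_range,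
    List.map_map]
  rfl

variable (s t : S)

theorem eval_pairing (r : ℕ) (p q : Poly₃) :
    Poly₂.eval s t (pairing r p q) = constantCoeff (transvectant r
      ((Poly₃.toPoly s t p).homogenize r) ((Poly₃.toPoly s t q).homogenize r)) := by
  rw [constantCoeff_transvectant_homogenize, pairing, Poly₂.eval_sum, List.map_map,
    list_sum_map_range]
  refine Finset.sum_congr rfl fun i _ => ?_
  simp only [Function.comp_apply, Poly₂.eval_smul, Poly₂.eval_mul, Poly₃.coeff_toPoly]

theorem toPoly_listTransvectant {r m n : ℕ} (hm : r ≤ m) (hn : r ≤ n) (p q : Poly₃) :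
    transvectant r ((Poly₃.toPoly s t p).homogenize m) ((Poly₃.toPoly s t q).homogenize n) =
      (Poly₃.toPoly s t (listTransvectant r m n p q)).homogenize (m + n - 2 * r) := by
  rw [transvectant_homogenize hm hn, homogenize_eq_sum]
  refine Finset.sum_congr rfl fun k hk => ?_
  rw [mul_assoc]
  congr 2
  rw [Poly₃.coeff_toPoly, listTransvectant, List.getD_eq_getElem?_getD, List.getElem?_map,
    List.getElem?_range (Finset.mem_range.mp hk), Option.map_some, Option.getD_some,
    Poly₂.eval_sum, List.map_map, list_sum_map_range]
  refine Finset.sum_congr rfl fun i _ => ?_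
  simp only [Function.comp_apply]
  split_ifs
  · simp only [Poly₂.eval_smul, Poly₂.eval_mul, Poly₃.coeff_toPoly]
  · rfl

theorem homogenize_pow {p : Polynomial S} {m : ℕ} (h : p.natDegree ≤ m) (n : ℕ) :
    (p.homogenize m) ^ n = (p ^ n).homogenize (m * n) := by
  induction n with
  | zero => simp
  | succ n ih =>
    rw [pow_succ, pow_succ, ih, mul_add, mul_one, Polynomial.homogenize_mul _ _ _ h]
    exact (Polynomial.natDegree_pow_le).trans (by rw [mul_comm]; exact Nat.mul_le_mul_right n h)

/-- The value of `powerTransvectant n r` on a binary form. -/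
def listPowerTransvectant (n r : ℕ) (f : Poly₃) : Poly₂ :=
  pairing r (Poly₃.pow f n) (Poly₃.pow f n)

/-- The value of `oddTransvectant` on a binary quintic. -/
def listOddTransvectant (f : Poly₃) : Poly₂ :=
  pairing 35 (listTransvectant 10 25 30 (Poly₃.pow f 5) (Poly₃.pow f 6)) (Poly₃.pow f 7)

variable {f : Poly₃} (hf : (Poly₃.toPoly s t f).natDegree ≤ 5)
include hf

theorem eval_listPowerTransvectant (n : ℕ) :
    powerTransvectant n (5 * n) ((Poly₃.toPoly s t f).homogenize 5) =
      Poly₂.eval s t (listPowerTransvectant n (5 * n) f) := by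
  rw [powerTransvectant, listPowerTransvectant, eval_pairing, homogenize_pow hf,
    Poly₃.toPoly_pow]

theorem eval_listOddTransvectant :
    oddTransvectant ((Poly₃.toPoly s t f).homogenize 5) =
      Poly₂.eval s t (listOddTransvectant f) := by
  rw [oddTransvectant, listOddTransvectant, eval_pairing, homogenize_pow hf,
    homogenize_pow hf, homogenize_pow hf, ← Poly₃.toPoly_pow, ← Poly₃.toPoly_pow,
    ← Poly₃.toPoly_pow, toPoly_listTransvectant s t (by norm_num) (by norm_num)]

end ListTransvectant

/-! ### Kernel computations on the two slices. -/

section Slices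

open MvPolynomial

/-- The quintic `x z (x³ + s x² z + t x z² + z³)`. -/
def genericSlice {S : Type*} [CommRing S] (s t : S) : Fin 6 → S := ![0, 1, s, t, 1, 0]

/-- The quintic `z² (x³ + s x z² + t z³)`. -/
def doubleRootSlice {S : Type*} [CommRing S] (s t : S) : Fin 6 → S := ![0, 0, 1, 0, s, t]

def genericSliceList : Poly₃ := [[], [(0, 0, 1)], [(0, 1, 1)], [(1, 0, 1)], [(0, 0, 1)]]

def doubleRootSliceList : Poly₃ := [[(0, 1, 1)], [(1, 0, 1)], [], [(0, 0, 1)]]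

/-- `A³ I₁₂ - 396 B I₄³` for `α = 1 / A` and `β = 1 / B`. -/
def listH (f : Poly₃) : Poly₂ :=
  Poly₂.add
    (Poly₂.smul ((2 ^ 17 * 3 ^ 7 * 5 ^ 3 * 7) ^ 3) (listPowerTransvectant 6 30 f))
    (Poly₂.smul (-396 * (2 ^ 50 * 3 ^ 27 * 5 ^ 14 * 7 ^ 7 * 11 ^ 4 * 13 ^ 3 * 17 * 19 * 23 * 29))
      (Poly₂.mul (listPowerTransvectant 2 10 f)
        (Poly₂.mul (listPowerTransvectant 2 10 f) (listPowerTransvectant 2 10 f))))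

/-- All coefficients are divisible by `n`. -/
def Poly₂.allDvd (n : ℤ) (p : Poly₂) : Bool := p.all fun m => m.2.2 % n == 0

/-- This and `contentI18` divide all coefficients of the respective invariant on the generic slice,
and dividing by them on the double-root slice leaves a polynomial that takes unit values outside
residue characteristics 2 and 3. -/
def contentI4 : ℤ := 2 ^ 16 * 3 ^ 6 * 5 ^ 3 * 7

/-- The factor 1 / (α³ β), by which `listH` exceeds H; it only clears denominators. -/
def contentH : ℤ := (2 ^ 17 * 3 ^ 7 * 5 ^ 3 * 7) ^ 3 *
  (2 ^ 50 * 3 ^ 27 * 5 ^ 14 * 7 ^ 7 * 11 ^ 4 * 13 ^ 3 * 17 * 19 * 23 * 29)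

def contentI18 : ℤ := 2 ^ 77 * 3 ^ 38 * 5 ^ 19 * 7 ^ 12 * 11 ^ 6 * 13 ^ 4 * 17 ^ 3 * 19 ^ 2 *
  23 ^ 2 * 29 * 31 * 37 * 41 * 43

theorem allDvd_I4 :
    Poly₂.allDvd contentI4 (listPowerTransvectant 2 10 genericSliceList) = true := by
  decide +kernel

/-- The factor 22 = 2 · 11 makes H integral on the generic slice; it is through this factor that
residue characteristic 11 is excluded. -/
theorem allDvd_H : Poly₂.allDvd contentH (Poly₂.smul 22 (listH genericSliceList)) = true := by
  decide +kernel

theorem allDvd_I18 : Poly₂.allDvd contentI18 (listOddTransvectant genericSliceList) = true := by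
  decide +kernel

/-- List addition keeps terms whose coefficients cancel, so zero terms are filtered out before
comparing. -/
theorem I4_doubleRootSliceList :
    (listPowerTransvectant 2 10 doubleRootSliceList).filter (fun m => m.2.2 != 0) =
      [(1, 0, 6 * contentI4)] := by
  decide +kernel

/-- The result 4s³ + 27t² is minus the discriminant of x³ + s x + t: on forms with a double root, H
detects a further collision among the other three zeros. -/
theorem H_doubleRootSliceList :
    (listH doubleRootSliceList).filter (fun m => m.2.2 != 0) =
      [(0, 2, 27 * contentH), (3, 0, 4 * contentH)] := by
  decide +kernel

/-- The result is −27 t (4s³ + 27t²), so where H is a unit, I₁₈ detects t. -/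
theorem I18_doubleRootSliceList :
    (listOddTransvectant doubleRootSliceList).filter (fun m => m.2.2 != 0) =
      [(0, 3, -27 * (27 * contentI18)), (3, 1, -4 * (27 * contentI18))] := by
  decide +kernel

end Slices

/-! ### Splitting a quintic into linear factors. -/

section Factorization

open MvPolynomial

theorem quintic_eq_homogenize {S : Type*} [CommRing S] (a : Fin 6 → S) :
    quintic a =
      (∑ i : Fin 6, Polynomial.C (a i) * Polynomial.X ^ (5 - (i : ℕ))).homogenize 5 := by
  rw [Polynomial.homogenize_finsetSum, quintic]
  refine Finset.sum_congr rfl fun i _ => ?_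
  have h : 5 - (i : ℕ) ≤ 5 := Nat.sub_le _ _
  have h' : 5 - (5 - (i : ℕ)) = i := by omega
  rw [Polynomial.homogenize_C_mul, Polynomial.homogenize_X_pow h, h', mul_assoc]

/-- The linear form `z₀ x - x₀ z` with zero `(x₀ : z₀)`. -/
def rootFactor {S : Type*} [CommRing S] (v : Fin 2 → S) : MvPolynomial (Fin 2) S :=
  C (v 1) * X 0 - C (v 0) * X 1

theorem homogenize_prod_X_sub_C {F : Type*} [Field F] (l : List F) :
    ((l.map fun t => Polynomial.X - Polynomial.C t).prod).homogenize l.length =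
      (l.map fun t => rootFactor ![t, 1]).prod := by
  induction l with
  | nil => simp
  | cons t l ih =>
    simp only [List.map_cons, List.prod_cons, List.length_cons, ← ih]
    rw [Nat.add_comm l.length, Polynomial.homogenize_mul _ _ (by simp) ?_]
    · congr 1
      rw [Polynomial.homogenize_sub, Polynomial.homogenize_X one_ne_zero, Polynomial.homogenize_C]
      simp [rootFactor]
    · refine (Polynomial.natDegree_list_prod_le _).trans ?_
      rw [List.map_map]
      refine (List.sum_le_card_nsmul _ 1 ?_).trans (by simp)
      intro n hn
      obtain ⟨t, -, rfl⟩ := List.mem_map.mp hn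
      simp

theorem exists_quintic_eq_C_mul_rootForm {F : Type*} [Field F] [IsAlgClosed F] (a : Fin 6 → F) :
    ∃ (c : F) (p : Fin 5 → Fin 2 → F), quintic a = C c * rootForm p := by
  set f : Polynomial F := ∑ i : Fin 6, Polynomial.C (a i) * Polynomial.X ^ (5 - (i : ℕ)) with hf
  have hdeg : f.natDegree ≤ 5 := by
    refine Polynomial.natDegree_sum_le_of_forall_le _ _ fun i _ => ?_
    exact (Polynomial.natDegree_C_mul_X_pow_le _ _).trans (Nat.sub_le _ _)
  have hs := IsAlgClosed.splits f
  set l := f.roots.toList with hl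
  have hlen : l.length = f.natDegree := by
    rw [hl, Multiset.length_toList, ← hs.natDegree_eq_card_roots]
  have hprod : f = Polynomial.C f.leadingCoeff *
      (l.map fun t => Polynomial.X - Polynomial.C t).prod := by
    conv_lhs => rw [hs.eq_prod_roots]
    rw [hl, ← Multiset.prod_coe, ← Multiset.map_coe, Multiset.coe_toList]
  -- The missing roots are placed at infinity. The representative (−1, 0) is chosen because its
  -- linear factor is exactly z, without a sign.
  let L : List (Fin 2 → F) :=
    l.map (fun t => ![t, 1]) ++ List.replicate (5 - f.natDegree) ![-1, 0]
  have hL : L.length = 5 := by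
    simp [L, hlen]
    omega
  refine ⟨f.leadingCoeff, fun i => L.get (Fin.cast hL.symm i), ?_⟩
  have h1 : rootForm (fun i => L.get (Fin.cast hL.symm i)) = (L.map rootFactor).prod := by
    conv_rhs => rw [← List.ofFn_get L, List.map_ofFn, List.prod_ofFn]
    exact (Fintype.prod_equiv (finCongr hL) _ _ fun i => by simp [rootFactor]).symm
  have h2 : (5 : ℕ) = (5 - f.natDegree) + l.length := by omega
  rw [h1, quintic_eq_homogenize, ← hf]
  conv_lhs => rw [hprod, Polynomial.homogenize_C_mul]
  congr 1
  conv_lhs => rw [← one_mul (List.prod _), h2]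
  rw [Polynomial.homogenize_mul, homogenize_prod_X_sub_C, Polynomial.homogenize_one]
  · simp only [L, List.map_append, List.prod_append, List.map_map, List.map_replicate,
      List.prod_replicate]
    rw [mul_comm]
    congr 1
    simp [rootFactor]
  · simp
  · refine (Polynomial.natDegree_list_prod_le _).trans ?_
    rw [List.map_map]
    refine (List.sum_le_card_nsmul _ 1 ?_).trans (by simp)
    intro n hn
    obtain ⟨t, -, rfl⟩ := List.mem_map.mp hn
    simp

end Factorization

/-! ### Reduction, and unit values of primitive polynomials. -/

section ResidueField

open MvPolynomial

variable {K : Type*} [NontriviallyNormedField K] [IsUltrametricDist K]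

variable (K) in
/-- The ring of integers `{x | ‖x‖ ≤ 1}`. -/
abbrev Integers : ValuationSubring K := (NormedField.valuation (K := K)).valuationSubring

theorem mem_integers {x : K} : x ∈ Integers K ↔ ‖x‖ ≤ 1 := by
  rw [Valuation.mem_valuationSubring_iff, NormedField.valuation_apply, ← NNReal.coe_le_coe]
  simp

theorem residue_ne_zero_iff (x : Integers K) :
    IsLocalRing.residue (Integers K) x ≠ 0 ↔ ‖(x : K)‖ = 1 := by
  rw [ne_eq, IsLocalRing.residue_eq_zero_iff, IsLocalRing.mem_maximalIdeal, mem_nonunits_iff,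
    not_not, Valuation.Integers.isUnit_iff_valuation_eq_one
      (Valuation.valuationSubring.integers _)]
  change NormedField.valuation (x : K) = 1 ↔ _
  rw [NormedField.valuation_apply, ← NNReal.coe_inj]
  simp

theorem norm_natCast_eq_one_of_ringChar_ne {p : ℕ} (hp : p.Prime)
    (h : ringChar (ResidueField K) ≠ p) : ‖(p : K)‖ = 1 := by
  have key : IsLocalRing.residue (Integers K) (p : Integers K) ≠ 0 := fun h0 => by
    have hd : ringChar (ResidueField K) ∣ p := ringChar.dvd (by simpa using h0)
    rcases (Nat.dvd_prime hp).mp hd with h1 | h1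
    · exact CharP.ringChar_ne_one h1
    · exact h h1
  simpa using (residue_ne_zero_iff _).mp key

/-- A root in K of a monic lift is integral, hence lies in the valuation ring, and reduces to a
root. -/
instance isAlgClosed_residueField [IsAlgClosed K] : IsAlgClosed (ResidueField K) := by
  refine IsAlgClosed.of_exists_root _ fun p hp hirr => ?_
  have hl : p ∈ Polynomial.lifts (IsLocalRing.residue (Integers K)) := by
    rw [Polynomial.lifts_iff_coeff_lifts]
    intro n
    exact IsLocalRing.residue_surjective _
  obtain ⟨q, hq, hdeg, hmon⟩ := Polynomial.lifts_and_natDegree_eq_and_monic hl hp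
  have hne : (q.map (algebraMap (Integers K) K)).degree ≠ 0 := by
    rw [hmon.degree_map, Polynomial.degree_eq_natDegree hmon.ne_zero, hdeg]
    exact_mod_cast hirr.natDegree_pos.ne'
  obtain ⟨x, hx⟩ := IsAlgClosed.exists_root (q.map (algebraMap (Integers K) K)) hne
  have hint : IsIntegral (Integers K) x :=
    ⟨q, hmon, by rwa [Polynomial.IsRoot, Polynomial.eval_map] at hx⟩
  obtain ⟨y, rfl⟩ := IsIntegrallyClosed.isIntegral_iff.mp hint
  refine ⟨IsLocalRing.residue _ y, ?_⟩
  rw [Polynomial.IsRoot, Polynomial.eval_map_algebraMap, Polynomial.aeval_algebraMap_apply] at hx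
  have hy : q.eval y = 0 := by
    have := (FaithfulSMul.algebraMap_injective (Integers K) K) (hx.trans (map_zero _).symm)
    simpa using this
  rw [← hq, Polynomial.eval_map_apply, hy, map_zero]

/-- A polynomial vanishing at all points over an infinite field is zero, so the residue
characteristic would divide all coefficients and be a unit in ℤ. This excludes characteristic 0 as
well. -/
theorem exists_aeval_ne_zero_of_primitive [IsAlgClosed K] {P : MvPolynomial (Fin 6) ℤ}
    (hP : ∀ n : ℤ, (∀ m, n ∣ P.coeff m) → IsUnit n) :
    ∃ a : Fin 6 → ResidueField K, aeval a P ≠ 0 := by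
  have : Infinite (ResidueField K) := IsAlgClosed.instInfinite
  by_contra! h
  have h0 : map (Int.castRingHom (ResidueField K)) P = 0 := by
    refine MvPolynomial.funext fun a => ?_
    rw [eval_map, map_zero]
    exact h a
  have hu := hP (ringChar (ResidueField K)) fun m => by
    have := congrArg (coeff m) h0
    rw [coeff_map, coeff_zero] at this
    exact (CharP.intCast_eq_zero_iff (ResidueField K) _ _).mp this
  rw [Int.isUnit_iff] at hu
  have h1 : ringChar (ResidueField K) = 1 := by omega
  exact CharP.ringChar_ne_one h1

theorem map_aeval_quinticCoeffs {A B : Type*} [CommRing A] [CommRing B] (φ : A →+* B)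
    (F : MvPolynomial (Fin 2) A) (P : MvPolynomial (Fin 6) ℤ) :
    φ (aeval (quinticCoeffs F) P) = aeval (quinticCoeffs (map φ F)) P := by
  have : quinticCoeffs (map φ F) = fun i => φ (quinticCoeffs F i) :=
    funext (quinticCoeffs_map φ _)
  rw [this]
  exact comp_aeval_apply _ φ.toIntAlgHom P

/-- A polynomial with coprime integer coefficients takes a value of norm one at the coefficients of
a quintic with good reduction. -/
theorem exists_norm_aeval_eq_one [IsAlgClosed K] {P : MvPolynomial (Fin 6) ℤ}
    (hP : ∀ n : ℤ, (∀ m, n ∣ P.coeff m) → IsUnit n) :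
    ∃ (c : K) (p : Fin 5 → Fin 2 → K), ‖c‖ = 1 ∧ (∀ i j, ‖p i j‖ ≤ 1) ∧
      (∀ i j, i ≠ j → ‖det₂ (p i) (p j)‖ = 1) ∧
      ‖aeval (quinticCoeffs (C c * rootForm p)) P‖ = 1 := by
  have : Infinite (ResidueField K) := IsAlgClosed.instInfinite
  let k := ResidueField K
  obtain ⟨a, ha⟩ := exists_aeval_ne_zero_of_primitive (K := K) hP
  obtain ⟨c₀, p₀, h₀⟩ := exists_quintic_eq_C_mul_rootForm a
  -- The leading factor and the ten coordinates of the zeros become indeterminates. The value of P,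
  -- the leading factor and all determinants are then nonzero polynomials, so they are
  -- simultaneously nonzero at some point over the infinite residue field; lifting that point gives
  -- the quintic.
  let R := MvPolynomial (Option (Fin 5 × Fin 2)) k
  let c₁ : R := X none
  let p₁ : Fin 5 → Fin 2 → R := fun i j => X (some (i, j))
  let Q : R := aeval (quinticCoeffs (C c₁ * rootForm p₁)) P
  have hnat : ∀ {A B : Type _} [CommRing A] [CommRing B] (φ : A →+* B) (c : A)
      (p : Fin 5 → Fin 2 → A), φ (aeval (quinticCoeffs (C c * rootForm p)) P) =
        aeval (quinticCoeffs (C (φ c) * rootForm fun i j => φ (p i j))) P := by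
    intro A B _ _ φ c p
    rw [map_aeval_quinticCoeffs, map_mul, map_C, map_rootForm]
  have hQ : Q ≠ 0 := by
    intro h
    let e : Option (Fin 5 × Fin 2) → k := fun o => o.elim c₀ fun ij => p₀ ij.1 ij.2
    have h1 := hnat (eval e) c₁ p₁
    change eval e Q = _ at h1
    rw [h, map_zero] at h1
    simp only [c₁, p₁, eval_X, e, Option.elim] at h1
    rw [← h₀, quinticCoeffs_quintic] at h1
    exact ha h1.symm
  have hc₁ : c₁ ≠ 0 := X_ne_zero _
  have hd₁ : ∀ i j, i ≠ j → det₂ (p₁ i) (p₁ j) ≠ 0 := by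
    intro i j hij h
    have := congrArg (eval fun o : Option (Fin 5 × Fin 2) => o.elim (0 : k) fun ij =>
      if ij = (i, 0) ∨ ij = (j, 1) then 1 else 0) h
    simp [det₂, p₁, hij, hij.symm] at this
  have hprod : Q * c₁ * ∏ ij ∈ Finset.univ.offDiag, det₂ (p₁ ij.1) (p₁ ij.2) ≠ 0 := by
    refine mul_ne_zero (mul_ne_zero hQ hc₁) (Finset.prod_ne_zero_iff.mpr fun ij h => ?_)
    exact hd₁ _ _ (Finset.mem_offDiag.mp h).2.2
  obtain ⟨e, he⟩ : ∃ e, eval e (Q * c₁ *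
      ∏ ij ∈ Finset.univ.offDiag, det₂ (p₁ ij.1) (p₁ ij.2)) ≠ 0 := by
    by_contra! h
    exact hprod (MvPolynomial.funext fun e => by rw [h e, map_zero])
  simp only [map_mul, map_prod, mul_ne_zero_iff] at he
  obtain ⟨⟨heQ, hec⟩, hed⟩ := he
  choose e' he' using fun o => IsLocalRing.residue_surjective (R := Integers K) (e o)
  refine ⟨e' none, fun i j => e' (some (i, j)), ?_, fun i j => mem_integers.mp (e' _).2, ?_, ?_⟩
  · rw [← residue_ne_zero_iff, he']
    simpa [c₁] using hec
  · intro i j hij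
    have h1 := Finset.prod_ne_zero_iff.mp hed (i, j) (by simp [hij])
    have h2 := residue_ne_zero_iff
      (det₂ (fun k => e' (some (i, k))) fun k => e' (some (j, k)))
    have h3 : IsLocalRing.residue (Integers K)
        (det₂ (fun k => e' (some (i, k))) fun k => e' (some (j, k))) =
        eval e (det₂ (p₁ i) (p₁ j)) := by
      simp [det₂, p₁, he']
    rw [h3] at h2
    simpa [det₂] using h2.mp h1
  · have h1 := hnat (eval e) c₁ p₁
    have h2 := hnat (IsLocalRing.residue (Integers K)) (e' none) fun i j => e' (some (i, j))
    have h3 := hnat (Integers K).subtype (e' none) fun i j => e' (some (i, j))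
    simp only [he'] at h2
    simp only [c₁, p₁, eval_X] at h1
    have h4 := (residue_ne_zero_iff _).mp (h2.trans h1.symm ▸ heQ)
    exact (congrArg norm h3).symm.trans h4

end ResidueField

/-! ### Values of the invariants on the slices. -/

section SliceValues

open MvPolynomial

variable {K : Type*} [Field K] [CharZero K]

omit [CharZero K] in
theorem toPoly_genericSliceList (s t : K) :
    Poly₃.toPoly s t genericSliceList =
      ∑ i : Fin 6, Polynomial.C (genericSlice s t i) * Polynomial.X ^ (5 - (i : ℕ)) := by
  simp [Poly₃.toPoly, genericSliceList, listEval, genericSlice, Fin.sum_univ_six]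
  ring

omit [CharZero K] in
theorem toPoly_doubleRootSliceList (s t : K) :
    Poly₃.toPoly s t doubleRootSliceList =
      ∑ i : Fin 6, Polynomial.C (doubleRootSlice s t i) * Polynomial.X ^ (5 - (i : ℕ)) := by
  simp [Poly₃.toPoly, doubleRootSliceList, listEval, doubleRootSlice, Fin.sum_univ_six]
  ring

omit [CharZero K] in
theorem natDegree_sum_C_mul_X_pow_le (a : Fin 6 → K) :
    (∑ i : Fin 6, Polynomial.C (a i) * Polynomial.X ^ (5 - (i : ℕ))).natDegree ≤ 5 :=
  Polynomial.natDegree_sum_le_of_forall_le _ _ fun _ _ =>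
    (Polynomial.natDegree_C_mul_X_pow_le _ _).trans (Nat.sub_le _ _)

/-- Values of the invariants at a quintic whose coefficients are given by a list. -/
theorem aeval_raw_of_toPoly {s t : K} {f : Poly₃} {a : Fin 6 → K}
    (h : Poly₃.toPoly s t f =
      ∑ i : Fin 6, Polynomial.C (a i) * Polynomial.X ^ (5 - (i : ℕ))) :
    aeval a rawI4 = Poly₂.eval s t (listPowerTransvectant 2 10 f) ∧
    aeval a rawI18 = Poly₂.eval s t (listOddTransvectant f) ∧
    contentH * aeval a rawH = Poly₂.eval s t (listH f) := by
  have hd : (Poly₃.toPoly s t f).natDegree ≤ 5 := h ▸ natDegree_sum_C_mul_X_pow_le a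
  have hq : quintic a = (Poly₃.toPoly s t f).homogenize 5 := by
    rw [h, quintic_eq_homogenize]
  have h4 := eval_listPowerTransvectant s t hd 2
  have h12 := eval_listPowerTransvectant s t hd 6
  norm_num only at h4 h12
  refine ⟨?_, ?_, ?_⟩
  · rw [aeval_rawI4, hq, h4]
  · rw [aeval_rawI18, hq, eval_listOddTransvectant s t hd]
  · rw [aeval_rawH, hq, h4, h12, listH, Poly₂.eval_add, Poly₂.eval_smul, Poly₂.eval_smul,
      Poly₂.eval_mul, Poly₂.eval_mul, betaConst, alphaConst, contentH]
    simp only [eq_ratCast]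
    push_cast
    field_simp
    ring

omit [CharZero K] in
theorem Poly₂.eval_eq_mul_of_allDvd {n : ℤ} {p : Poly₂} (h : Poly₂.allDvd n p = true) :
    ∃ q : Poly₂, ∀ s t : K, Poly₂.eval s t p = n * Poly₂.eval s t q := by
  refine ⟨p.map fun m => (m.1, m.2.1, m.2.2 / n), fun s t => ?_⟩
  rw [← Poly₂.eval_smul]
  congr 1
  rw [Poly₂.smul, List.map_map]
  refine (List.map_id p).symm.trans (List.map_congr_left fun m hm => ?_)
  have h1 := List.all_eq_true.mp h m hm
  have h2 : n ∣ m.2.2 := Int.dvd_of_emod_eq_zero (by simpa using h1)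
  simp [Int.mul_ediv_cancel' h2]

omit [CharZero K] in
theorem Poly₂.eval_filter (p : Poly₂) (s t : K) :
    Poly₂.eval s t (p.filter fun m => m.2.2 != 0) = Poly₂.eval s t p := by
  induction p with
  | nil => rfl
  | cons m p ih =>
    by_cases h : m.2.2 = 0
    · rw [List.filter_cons_of_neg (by simp [h]), ih, eval_cons, h]; simp
    · rw [List.filter_cons_of_pos (by simp [h]), eval_cons, eval_cons, ih]

theorem contentH_ne_zero : (contentH : K) ≠ 0 := by
  rw [Int.cast_ne_zero, contentH]; norm_num

theorem contentI4_ne_zero : (contentI4 : K) ≠ 0 := by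
  rw [Int.cast_ne_zero, contentI4]; norm_num

theorem contentI18_ne_zero : (contentI18 : K) ≠ 0 := by
  rw [Int.cast_ne_zero, contentI18]; norm_num

theorem aeval_doubleRootSlice_rawI4 (s t : K) :
    aeval (doubleRootSlice s t) rawI4 = contentI4 * (6 * s) := by
  rw [(aeval_raw_of_toPoly (toPoly_doubleRootSliceList s t)).1, ← Poly₂.eval_filter,
    I4_doubleRootSliceList]
  simp
  ring

theorem aeval_doubleRootSlice_rawH (s t : K) :
    aeval (doubleRootSlice s t) rawH = 27 * t ^ 2 + 4 * s ^ 3 := by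
  have h := (aeval_raw_of_toPoly (toPoly_doubleRootSliceList s t)).2.2
  rw [← Poly₂.eval_filter, H_doubleRootSliceList] at h
  apply mul_left_cancel₀ (contentH_ne_zero (K := K))
  rw [h]
  simp
  ring

theorem aeval_doubleRootSlice_rawI18 (s t : K) :
    aeval (doubleRootSlice s t) rawI18 =
      contentI18 * (-27 * t * (27 * t ^ 2 + 4 * s ^ 3)) := by
  rw [(aeval_raw_of_toPoly (toPoly_doubleRootSliceList s t)).2.1, ← Poly₂.eval_filter,
    I18_doubleRootSliceList]
  simp
  ring

variable (K) in
theorem exists_aeval_genericSlice :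
    (∃ q : Poly₂, ∀ s t : K,
      aeval (genericSlice s t) rawI4 = contentI4 * Poly₂.eval s t q) ∧
    (∃ q : Poly₂, ∀ s t : K,
      aeval (genericSlice s t) rawI18 = contentI18 * Poly₂.eval s t q) ∧
    (∃ q : Poly₂, ∀ s t : K, 22 * aeval (genericSlice s t) rawH = Poly₂.eval s t q) := by
  refine ⟨?_, ?_, ?_⟩
  · obtain ⟨q, hq⟩ := Poly₂.eval_eq_mul_of_allDvd (K := K) allDvd_I4
    exact ⟨q, fun s t => by
      rw [(aeval_raw_of_toPoly (toPoly_genericSliceList s t)).1, hq]⟩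
  · obtain ⟨q, hq⟩ := Poly₂.eval_eq_mul_of_allDvd (K := K) allDvd_I18
    exact ⟨q, fun s t => by
      rw [(aeval_raw_of_toPoly (toPoly_genericSliceList s t)).2.1, hq]⟩
  · obtain ⟨q, hq⟩ := Poly₂.eval_eq_mul_of_allDvd (K := K) allDvd_H
    refine ⟨q, fun s t => mul_left_cancel₀ (contentH_ne_zero (K := K)) ?_⟩
    rw [← hq, Poly₂.eval_smul, ← (aeval_raw_of_toPoly (toPoly_genericSliceList s t)).2.2]
    push_cast
    ring

theorem quintic_smul {S : Type*} [CommRing S] (c : S) (a : Fin 6 → S) :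
    quintic (c • a) = C c * quintic a := by
  simp only [quintic, Finset.mul_sum, Pi.smul_apply, smul_eq_mul, C_mul]
  exact Finset.sum_congr rfl fun i _ => by ring

theorem Inv.aeval_raw_transform {I : Inv} (hI : I ≠ .disc) {a b : Fin 6 → K}
    {g : Matrix (Fin 2) (Fin 2) K} {e : K} (h : linSubst g (quintic a) = C e * quintic b) :
    g.det ^ I.weight * aeval a I.raw = e ^ I.deg * aeval b I.raw := by
  rw [← quintic_smul] at h
  rw [← Inv.aeval_raw_linSubst hI h.symm, Inv.aeval_raw_C_mul hI (quintic_smul e b)]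

end SliceValues

/-! ### Quintics of good reduction and the generic slice. -/

section Normalization

open MvPolynomial

variable {K : Type*} [NontriviallyNormedField K] [IsUltrametricDist K] [CharZero K]

omit [CharZero K] in
theorem Poly₂.norm_eval_le_one {s t : K} (hs : ‖s‖ ≤ 1) (ht : ‖t‖ ≤ 1) (q : Poly₂) :
    ‖Poly₂.eval s t q‖ ≤ 1 := by
  rw [← mem_integers] at *
  refine list_sum_mem fun x hx => ?_
  obtain ⟨m, -, rfl⟩ := List.mem_map.mp hx
  exact mul_mem (mul_mem (intCast_mem _ _) (pow_mem hs _)) (pow_mem ht _)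

omit [CharZero K] in
theorem norm_aeval_int_le_one {a : Fin 6 → K} (ha : ∀ i, ‖a i‖ ≤ 1) (P : MvPolynomial (Fin 6) ℤ) :
    ‖aeval a P‖ ≤ 1 := by
  have h := comp_aeval_apply (fun i => (⟨a i, mem_integers.mpr (ha i)⟩ : Integers K))
    (Integers K).subtype.toIntAlgHom P
  rw [← mem_integers]
  change (aeval (fun i => a i)) P ∈ _
  exact h ▸ Subtype.property _

/-- The three invariants that detect the tree type. -/
inductive IsDetecting : Inv → Prop
  | I4 : IsDetecting .I4
  | I18 : IsDetecting .I18
  | H : IsDetecting .H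

theorem IsDetecting.ne_disc {I : Inv} (h : IsDetecting I) : I ≠ .disc := by
  cases h <;> simp

/-- The content of the detecting invariants, up to powers of `2`, `3` and `11`. -/
def Inv.content : Inv → ℤ
  | .I4 => contentI4
  | .I18 => contentI18
  | _ => 1

/-- The detecting invariants on the slice of forms with a double root, up to their content. -/
def Inv.lead (I : Inv) (s t : K) : K :=
  match I with
  | .I4 => 6 * s
  | .I18 => -27 * t * (27 * t ^ 2 + 4 * s ^ 3)
  | _ => 27 * t ^ 2 + 4 * s ^ 3

omit [IsUltrametricDist K] in
theorem IsDetecting.aeval_doubleRootSlice {I : Inv} (h : IsDetecting I) (s t : K) :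
    aeval (doubleRootSlice s t) I.raw = I.content * I.lead s t := by
  cases h
  · exact aeval_doubleRootSlice_rawI4 s t
  · exact aeval_doubleRootSlice_rawI18 s t
  · exact (aeval_doubleRootSlice_rawH s t).trans (by simp [Inv.content, Inv.lead])

omit [IsUltrametricDist K] in
theorem IsDetecting.content_ne_zero {I : Inv} (h : IsDetecting I) : (I.content : K) ≠ 0 := by
  cases h
  · exact contentI4_ne_zero
  · exact contentI18_ne_zero
  · simp [Inv.content]

theorem IsDetecting.norm_aeval_genericSlice_le {I : Inv} (h : IsDetecting I)
    (h2 : ‖(2 : K)‖ = 1) (h11 : ‖(11 : K)‖ = 1) {s t : K} (hs : ‖s‖ ≤ 1) (ht : ‖t‖ ≤ 1) :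
    ‖aeval (genericSlice s t) I.raw‖ ≤ ‖(I.content : K)‖ := by
  obtain ⟨⟨q4, h4⟩, ⟨q18, h18⟩, ⟨qH, hH⟩⟩ := exists_aeval_genericSlice K
  cases h
  · change ‖aeval (genericSlice s t) rawI4‖ ≤ _
    rw [h4, norm_mul]
    exact mul_le_of_le_one_right (norm_nonneg _) (Poly₂.norm_eval_le_one hs ht _)
  · change ‖aeval (genericSlice s t) rawI18‖ ≤ _
    rw [h18, norm_mul]
    exact mul_le_of_le_one_right (norm_nonneg _) (Poly₂.norm_eval_le_one hs ht _)
  · change ‖aeval (genericSlice s t) rawH‖ ≤ _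
    have h22 : ‖(22 : K)‖ = 1 := by
      rw [show (22 : K) = 2 * 11 by norm_num, norm_mul, h2, h11, one_mul]
    have := congrArg norm (hH s t)
    rw [norm_mul, h22, one_mul] at this
    rw [this]
    simpa [Inv.content] using Poly₂.norm_eval_le_one hs ht _

omit [CharZero K] in
/-- A quintic with good reduction is equivalent over the ring of integers to one of the form
`x z (x³ + s x² z + t x z² + z³)`. -/
theorem exists_transform_genericSlice [IsAlgClosed K] {p : Fin 5 → Fin 2 → K}
    (hp : ∀ i j, ‖p i j‖ ≤ 1) (hd : ∀ i j, i ≠ j → ‖det₂ (p i) (p j)‖ = 1) :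
    ∃ (g : Matrix (Fin 2) (Fin 2) K) (e s t : K), ‖g.det‖ = 1 ∧ ‖e‖ = 1 ∧ ‖s‖ ≤ 1 ∧ ‖t‖ ≤ 1 ∧
      linSubst g (rootForm p) = C e * quintic (genericSlice s t) := by
  let d := det₂ (p 0) (p 1)
  have hd0 : d ≠ 0 := norm_ne_zero_iff.mp (by rw [hd 0 1 (by decide)]; exact one_ne_zero)
  let x : Fin 5 → K := fun i => det₂ (p i) (p 1)
  let z : Fin 5 → K := fun i => det₂ (p 0) (p i)
  have hx : ∀ i, i ≠ 1 → ‖x i‖ = 1 := fun i hi => hd i 1 hi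
  have hz : ∀ i, i ≠ 0 → ‖z i‖ = 1 := fun i hi => hd 0 i hi.symm
  let b₀ := z 2 * z 3 * z 4
  let b₃ := -(x 2 * x 3 * x 4)
  have hb₀ : ‖b₀‖ = 1 := by
    simp only [b₀, norm_mul, hz 2 (by decide), hz 3 (by decide), hz 4 (by decide), one_mul]
  have hb₃ : ‖b₃‖ = 1 := by
    simp only [b₃, norm_neg, norm_mul, hx 2 (by decide), hx 3 (by decide), hx 4 (by decide),
      one_mul]
  have hb₃0 : b₃ ≠ 0 := norm_ne_zero_iff.mp (by rw [hb₃]; exact one_ne_zero)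
  -- Once two zeros are at (1 : 0) and (0 : 1), the remaining cubic has outer coefficients `b₀` and
  -- `b₃`. Rescaling z by the unit v with v³ b₃ = b₀ makes them equal.
  obtain ⟨v, hv⟩ := IsAlgClosed.exists_pow_nat_eq (b₀ / b₃) (n := 3) (by norm_num)
  have hvn : ‖v‖ = 1 := by
    have := congrArg norm hv
    rw [norm_pow, norm_div, hb₀, hb₃, div_one] at this
    exact (pow_eq_one_iff_of_nonneg (norm_nonneg _) (by norm_num)).mp this
  have hv0 : v ≠ 0 := norm_ne_zero_iff.mp (by rw [hvn]; exact one_ne_zero)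
  have hv' : v ^ 3 * b₃ = b₀ := by rw [hv, div_mul_cancel₀ _ hb₃0]
  let s := -(x 2 * z 3 * z 4 + z 2 * x 3 * z 4 + z 2 * z 3 * x 4) / (v ^ 2 * b₃)
  let t := (x 2 * x 3 * z 4 + x 2 * z 3 * x 4 + z 2 * x 3 * x 4) / (v * b₃)
  have hxle : ∀ i, x i ∈ Integers K := fun i => by
    simp only [x, det₂]
    exact sub_mem (mul_mem (mem_integers.mpr (hp _ _)) (mem_integers.mpr (hp _ _)))
      (mul_mem (mem_integers.mpr (hp _ _)) (mem_integers.mpr (hp _ _)))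
  have hzle : ∀ i, z i ∈ Integers K := fun i => by
    simp only [z, det₂]
    exact sub_mem (mul_mem (mem_integers.mpr (hp _ _)) (mem_integers.mpr (hp _ _)))
      (mul_mem (mem_integers.mpr (hp _ _)) (mem_integers.mpr (hp _ _)))
  -- The columns are `p 0` and `v • p 1`, so these zeros move to (1 : 0) and (0 : 1); the zero i
  -- acquires the factor z i · x − v x i · z.
  refine ⟨!![p 0 0, p 1 0 * v; p 0 1, p 1 1 * v], -(d ^ 2 * v ^ 4 * b₃), s, t, ?_, ?_, ?_, ?_, ?_⟩
  · have : (!![p 0 0, p 1 0 * v; p 0 1, p 1 1 * v]).det = d * v := by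
      simp [Matrix.det_fin_two, d, det₂]; ring
    rw [this, norm_mul, hvn, hd 0 1 (by decide), one_mul]
  · simp [norm_mul, hvn, hb₃, d, hd 0 1 (by decide)]
  · have : ‖v ^ 2 * b₃‖ = 1 := by simp [hvn, hb₃]
    rw [norm_div, this, div_one, norm_neg, ← mem_integers]
    exact add_mem (add_mem (mul_mem (mul_mem (hxle _) (hzle _)) (hzle _))
      (mul_mem (mul_mem (hzle _) (hxle _)) (hzle _))) (mul_mem (mul_mem (hzle _) (hzle _)) (hxle _))
  · have : ‖v * b₃‖ = 1 := by simp [hvn, hb₃]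
    rw [norm_div, this, div_one, ← mem_integers]
    exact add_mem (add_mem (mul_mem (mul_mem (hxle _) (hxle _)) (hzle _))
      (mul_mem (mul_mem (hxle _) (hzle _)) (hxle _))) (mul_mem (mul_mem (hzle _) (hxle _)) (hxle _))
  · have hs : v ^ 2 * b₃ * s = -(x 2 * z 3 * z 4 + z 2 * x 3 * z 4 + z 2 * z 3 * x 4) :=
      mul_div_cancel₀ _ (mul_ne_zero (pow_ne_zero 2 hv0) hb₃0)
    have ht : v * b₃ * t = x 2 * x 3 * z 4 + x 2 * z 3 * x 4 + z 2 * x 3 * x 4 :=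
      mul_div_cancel₀ _ (mul_ne_zero hv0 hb₃0)
    have hfac : ∀ i, linSubst !![p 0 0, p 1 0 * v; p 0 1, p 1 1 * v]
        (C (p i 1) * X 0 - C (p i 0) * X 1) = C (z i) * X 0 - C v * C (x i) * X 1 := by
      intro i
      simp only [map_sub, map_mul, linSubst_C, linSubst_X, x, z, det₂]
      simp
      ring
    have hz0 : z 0 = 0 := by simp only [z, det₂]; ring
    have hx1 : x 1 = 0 := by simp only [x, det₂]; ring
    have hz1 : z 1 = d := rfl
    have hx0 : x 0 = d := rfl
    have hb : b₃ = -(x 2 * x 3 * x 4) := rfl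
    have hb' : v ^ 3 * b₃ = z 2 * z 3 * z 4 := hv'
    clear_value s t d x z b₃
    rw [rootForm, map_prod, Finset.prod_congr rfl fun i _ => hfac i, Fin.prod_univ_five, hz0, hx1,
      hz1, hx0]
    have hs' := congrArg (C : K → MvPolynomial (Fin 2) K) hs
    have ht' := congrArg (C : K → MvPolynomial (Fin 2) K) ht
    have hv'' := congrArg (C : K → MvPolynomial (Fin 2) K) hb'
    have hb'' := congrArg (C : K → MvPolynomial (Fin 2) K) hb
    simp only [map_mul, map_pow, map_neg, map_add] at hs' ht' hv'' hb''
    simp only [quintic, genericSlice, Fin.sum_univ_six, map_mul, map_pow, map_neg]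
    simp
    linear_combination (-(C d ^ 2 * C v * X 0 * X 1)) * (X 0 ^ 3 * hv'' + C v * X 0 ^ 2 * X 1 * hs' +
      C v ^ 2 * X 0 * X 1 ^ 2 * ht' + C v ^ 3 * X 1 ^ 3 * hb'')

end Normalization

/-! ### Determining the primitive scalings up to units. -/

section Units

open MvPolynomial

variable {K : Type*} [NontriviallyNormedField K] [IsUltrametricDist K] [CharZero K] [IsAlgClosed K]

omit [IsUltrametricDist K] [IsAlgClosed K] in
theorem Inv.norm_aeval_raw_transform {I : Inv} (hI : I ≠ .disc) {a b : Fin 6 → K}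
    {g : Matrix (Fin 2) (Fin 2) K} {e : K} (hg : ‖g.det‖ = 1) (he : ‖e‖ = 1)
    (h : linSubst g (quintic a) = C e * quintic b) : ‖aeval a I.raw‖ = ‖aeval b I.raw‖ := by
  have := congrArg norm (Inv.aeval_raw_transform hI h)
  simpa [hg, he] using this

/-- Quintics of good reduction lie in integral orbits of the generic slice, and integral equivalence
preserves norms of invariants, so divisibility on the slice suffices. -/
theorem IsDetecting.norm_aeval_raw_le {I : Inv} (h : IsDetecting I)
    (h2 : ‖(2 : K)‖ = 1) (h11 : ‖(11 : K)‖ = 1) {c : K} {p : Fin 5 → Fin 2 → K}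
    (hc : ‖c‖ = 1) (hp : ∀ i j, ‖p i j‖ ≤ 1) (hd : ∀ i j, i ≠ j → ‖det₂ (p i) (p j)‖ = 1) :
    ‖aeval (quinticCoeffs (C c * rootForm p)) I.raw‖ ≤ ‖(I.content : K)‖ := by
  obtain ⟨g, e, s, t, hg, he, hs, ht, hge⟩ := exists_transform_genericSlice hp hd
  rw [Inv.norm_aeval_raw_transform h.ne_disc hg (e := c * e) (b := genericSlice s t)]
  · exact h.norm_aeval_genericSlice_le h2 h11 hs ht
  · rw [norm_mul, hc, he, one_mul]
  · rw [quintic_quinticCoeffs_rootForm, map_mul, linSubst_C, hge, C_mul, mul_assoc]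

omit [CharZero K] in
theorem exists_norm_eval_eq_one {I : Inv} (hI : I.raw ≠ 0) :
    ∃ (c : K) (p : Fin 5 → Fin 2 → K), ‖c‖ = 1 ∧ (∀ i j, ‖p i j‖ ≤ 1) ∧
      (∀ i j, i ≠ j → ‖det₂ (p i) (p j)‖ = 1) ∧
      ‖I.eval (quinticCoeffs (C c * rootForm p))‖ = 1 := by
  have := exists_norm_aeval_eq_one (K := K) (isPrimitiveScaling_primitiveScaling hI).2
  rwa [← I.poly_eq] at this

omit [IsUltrametricDist K] [CharZero K] [IsAlgClosed K] in
theorem norm_detSqProd_eq_one {p : Fin 5 → Fin 2 → K}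
    (hd : ∀ i j, i ≠ j → ‖det₂ (p i) (p j)‖ = 1) : ‖detSqProd p‖ = 1 := by
  simp [detSqProd, hd]

theorem rawDisc_ne_zero : rawDisc ≠ 0 := by
  intro h
  have h1 := aeval_rawDisc (K := ℚ)
    (quintic_quinticCoeffs_rootForm (A := ℚ) 1 fun i => ![(i : ℚ), 1])
  rw [h, map_zero] at h1
  revert h1
  simp [detSqProd, det₂]
  norm_num

/-- The scaling factor of Δ is a unit: at a good quintic where the primitive polynomial has norm
one, the root formula has norm one too. -/
theorem norm_eval_disc {c : K} {p : Fin 5 → Fin 2 → K} {a : Fin 6 → K}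
    (h : quintic a = C c * rootForm p) : ‖Inv.disc.eval a‖ = ‖c ^ 8 * detSqProd p‖ := by
  obtain ⟨m, hm, he⟩ := Inv.disc.exists_eval_eq
  have h1 : ∀ {c : K} {p : Fin 5 → Fin 2 → K} {a : Fin 6 → K}, quintic a = C c * rootForm p →
      Inv.disc.eval a = m * (c ^ 8 * detSqProd p) := fun h => by
    rw [he, ← aeval_rawDisc h]; rfl
  obtain ⟨c', p', hc', -, hd, hn⟩ := exists_norm_eval_eq_one (K := K) (I := .disc) rawDisc_ne_zero
  rw [h1 (quintic_quinticCoeffs_rootForm _ _), norm_mul, norm_mul, norm_pow, hc',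
    norm_detSqProd_eq_one hd] at hn
  have hm1 : ‖(m : K)‖ = 1 := by simpa using hn
  rw [h1 h, norm_mul, hm1, one_mul]

/-- On the slice of forms with a double root, the detecting invariants have the same absolute
value as their leading terms. -/
theorem IsDetecting.norm_eval_doubleRootSlice {I : Inv} (h : IsDetecting I)
    (h2 : ‖(2 : K)‖ = 1) (h3 : ‖(3 : K)‖ = 1) (h11 : ‖(11 : K)‖ = 1) (s t : K) :
    ‖I.eval (doubleRootSlice s t)‖ = ‖I.lead s t‖ := by
  obtain ⟨m, hm, he⟩ := I.exists_eval_eq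
  have h6 : ‖(6 : K)‖ = 1 := by
    rw [show (6 : K) = 2 * 3 by norm_num, norm_mul, h2, h3, one_mul]
  have h27 : ‖(27 : K)‖ = 1 := by
    rw [show (27 : K) = 3 ^ 3 by norm_num, norm_pow, h3, one_pow]
  obtain ⟨s₀, t₀, hs₀, ht₀, hl⟩ : ∃ s₀ t₀ : K, ‖s₀‖ ≤ 1 ∧ ‖t₀‖ ≤ 1 ∧ ‖I.lead s₀ t₀‖ = 1 := by
    cases h
    · exact ⟨1, 0, by simp, by simp, by simp [Inv.lead, h6]⟩
    · exact ⟨0, 1, by simp, by simp, by simp [Inv.lead, h27]⟩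
    · exact ⟨0, 1, by simp, by simp, by simp [Inv.lead, h27]⟩
  have hev : ∀ s t : K, I.eval (doubleRootSlice s t) = m * I.content * I.lead s t := fun s t => by
    rw [he, h.aeval_doubleRootSlice, mul_assoc]
  -- Upper bound: the scaled polynomial has integer coefficients and is evaluated where the leading
  -- term is a unit.
  have hle : ‖(m * I.content : K)‖ ≤ 1 := by
    have h1 := norm_aeval_int_le_one (a := doubleRootSlice s₀ t₀) (fun i => by
      fin_cases i <;> simp [doubleRootSlice, hs₀, ht₀]) I.poly
    change ‖I.eval _‖ ≤ 1 at h1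
    rwa [hev, norm_mul, hl, mul_one] at h1
  have hraw : I.raw ≠ 0 := by
    intro h0
    have h1 := h.aeval_doubleRootSlice s₀ t₀
    rw [h0, map_zero] at h1
    have h2 := congrArg norm h1.symm
    rw [norm_mul, hl, mul_one, norm_zero, norm_eq_zero] at h2
    exact h.content_ne_zero h2
  -- Lower bound: at a good quintic the scaled invariant has norm one, while the unscaled one is
  -- bounded by its content.
  have hge : 1 ≤ ‖(m * I.content : K)‖ := by
    obtain ⟨c, p, hc, hp, hd, hn⟩ := exists_norm_eval_eq_one (K := K) hraw
    rw [← hn, he, norm_mul, norm_mul]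
    exact mul_le_mul_of_nonneg_left (h.norm_aeval_raw_le h2 h11 hc hp hd) (norm_nonneg _)
  rw [hev, norm_mul, le_antisymm hle hge, one_mul]

omit [IsUltrametricDist K] [IsAlgClosed K] in
theorem IsDetecting.norm_eval_transform {I : Inv} (h : IsDetecting I) {a b : Fin 6 → K}
    {g : Matrix (Fin 2) (Fin 2) K} {e : K} (hg : ‖g.det‖ = 1) (he : ‖e‖ = 1)
    (hab : linSubst g (quintic a) = C e * quintic b) : ‖I.eval a‖ = ‖I.eval b‖ := by
  obtain ⟨m, -, hm⟩ := I.exists_eval_eq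
  rw [hm, hm, norm_mul, norm_mul, Inv.norm_aeval_raw_transform h.ne_disc hg he hab]

omit [CharZero K] [IsAlgClosed K] in
theorem norm_quinticCoeffs_le_one {p : Fin 5 → Fin 2 → K} (hp : ∀ i j, ‖p i j‖ ≤ 1) (i : Fin 6) :
    ‖quinticCoeffs (rootForm p) i‖ ≤ 1 := by
  have := quinticCoeffs_map (Integers K).subtype
    (rootForm fun i j => (⟨p i j, mem_integers.mpr (hp i j)⟩ : Integers K)) i
  rw [map_rootForm] at this
  rw [← mem_integers]
  change quinticCoeffs (rootForm fun i j => p i j) i = _ at this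
  rw [this]
  exact Subtype.property _

omit [CharZero K] [IsAlgClosed K] in
/-- Changing the zeros of an integral form by elements of norm less than one does not affect
whether the value of a polynomial with integer coefficients has norm one. -/
theorem norm_aeval_eq_one_congr {p q : Fin 5 → Fin 2 → K} (hp : ∀ i j, ‖p i j‖ ≤ 1)
    (hq : ∀ i j, ‖q i j‖ ≤ 1) (hpq : ∀ i j, ‖p i j - q i j‖ < 1) (P : MvPolynomial (Fin 6) ℤ) :
    ‖aeval (quinticCoeffs (rootForm p)) P‖ = 1 ↔ ‖aeval (quinticCoeffs (rootForm q)) P‖ = 1 := by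
  let ι : ∀ p : Fin 5 → Fin 2 → K, (∀ i j, ‖p i j‖ ≤ 1) → Fin 5 → Fin 2 → Integers K :=
    fun p hp i j => ⟨p i j, mem_integers.mpr (hp i j)⟩
  have hnat : ∀ {A B : Type _} [CommRing A] [CommRing B] (φ : A →+* B)
      (p : Fin 5 → Fin 2 → A), φ (aeval (quinticCoeffs (rootForm p)) P) =
        aeval (quinticCoeffs (rootForm fun i j => φ (p i j))) P := by
    intro A B _ _ φ p
    rw [map_aeval_quinticCoeffs, map_rootForm]
  have key : ∀ p hp, ‖aeval (quinticCoeffs (rootForm p)) P‖ = 1 ↔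
      IsLocalRing.residue (Integers K) (aeval (quinticCoeffs (rootForm (ι p hp))) P) ≠ 0 := by
    intro p hp
    rw [residue_ne_zero_iff]
    have := hnat (Integers K).subtype (ι p hp)
    change ((aeval (quinticCoeffs (rootForm (ι p hp))) P : Integers K) : K) =
      aeval (quinticCoeffs (rootForm fun i j => p i j)) P at this
    rw [this]
  rw [key p hp, key q hq, hnat, hnat]
  have : ∀ i j, IsLocalRing.residue (Integers K) (ι p hp i j) =
      IsLocalRing.residue (Integers K) (ι q hq i j) := by
    intro i j
    rw [← sub_eq_zero, ← map_sub]
    by_contra h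
    exact (hpq i j).ne ((residue_ne_zero_iff _).mp h)
  simp only [this]

end Units

/-! ### Invariants of a normalized quintic. -/

section NormalForm

open MvPolynomial

/-- Five vectors such that, apart from the pairs `{0, 1}` and `{2, 3}`, any two of them are
independent modulo the maximal ideal. -/
structure IsNormalized {K : Type*} [NontriviallyNormedField K] (q : Fin 5 → Fin 2 → K) :
    Prop where
  norm_le : ∀ i j, ‖q i j‖ ≤ 1
  zero : q 0 = ![1, 0]
  two : q 2 = ![0, 1]
  d02 : ‖det₂ (q 0) (q 2)‖ = 1
  d03 : ‖det₂ (q 0) (q 3)‖ = 1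
  d04 : ‖det₂ (q 0) (q 4)‖ = 1
  d12 : ‖det₂ (q 1) (q 2)‖ = 1
  d13 : ‖det₂ (q 1) (q 3)‖ = 1
  d14 : ‖det₂ (q 1) (q 4)‖ = 1
  d24 : ‖det₂ (q 2) (q 4)‖ = 1
  d34 : ‖det₂ (q 3) (q 4)‖ = 1

variable {K : Type*} [NontriviallyNormedField K] [IsUltrametricDist K] [CharZero K] [IsAlgClosed K]
  {q : Fin 5 → Fin 2 → K}

omit [CharZero K] [IsAlgClosed K] in
theorem norm_det₂_le_one {v w : Fin 2 → K} (hv : ∀ i, ‖v i‖ ≤ 1) (hw : ∀ i, ‖w i‖ ≤ 1) :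
    ‖det₂ v w‖ ≤ 1 := by
  simp only [← mem_integers] at *
  exact sub_mem (mul_mem (hv _) (hw _)) (mul_mem (hv _) (hw _))

namespace IsNormalized

variable (hq : IsNormalized q)
include hq

omit [CharZero K] [IsAlgClosed K] in
theorem norm_eval_le_one (I : Inv) : ‖I.eval (quinticCoeffs (rootForm q))‖ ≤ 1 :=
  norm_aeval_int_le_one (norm_quinticCoeffs_le_one hq.norm_le) I.poly

theorem norm_eval_disc : ‖Inv.disc.eval (quinticCoeffs (rootForm q))‖ =
    (‖det₂ (q 0) (q 1)‖ * ‖det₂ (q 2) (q 3)‖) ^ 2 := by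
  have h : quintic (quinticCoeffs (rootForm q)) = C 1 * rootForm q := by
    have := quintic_quinticCoeffs_rootForm 1 q
    rwa [map_one, one_mul] at this ⊢
  rw [BinaryQuintic.norm_eval_disc h, detSqProd]
  simp only [one_pow, one_mul, norm_pow, norm_mul, hq.d02, hq.d03, hq.d04, hq.d12, hq.d13, hq.d14,
    hq.d24, hq.d34, mul_one]

omit [IsAlgClosed K] in
/-- If the first two zeros have the same reduction, then the reduction of the form is equivalent to
a member of the slice of forms with a double root. -/
theorem exists_norm_eval_iff (h3 : ‖(3 : K)‖ = 1) (h01 : ‖det₂ (q 0) (q 1)‖ < 1) :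
    ∃ s t : K, (∀ I, IsDetecting I → (‖I.eval (quinticCoeffs (rootForm q))‖ = 1 ↔
        ‖I.eval (doubleRootSlice s t)‖ = 1)) ∧ ‖s‖ ≤ 1 ∧ ‖t‖ ≤ 1 ∧
      ‖27 * t ^ 2 + 4 * s ^ 3‖ = ‖det₂ (q 2) (q 3)‖ ^ 2 ∧
      (‖det₂ (q 2) (q 3)‖ < 1 → ‖s‖ = 1) := by
  have h30 : (3 : K) ≠ 0 := by norm_num
  have hx1 : ‖q 1 0‖ = 1 := by
    have := hq.d12
    simpa [hq.two, det₂] using this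
  have hz1 : ‖q 1 1‖ < 1 := by simpa [hq.zero, det₂] using h01
  have hz3 : ‖q 3 1‖ = 1 := by simpa [hq.zero, det₂] using hq.d03
  have hz4 : ‖q 4 1‖ = 1 := by simpa [hq.zero, det₂] using hq.d04
  have hx4 : ‖q 4 0‖ = 1 := by simpa [hq.two, det₂] using hq.d24
  have hx3 : ‖q 3 0‖ = ‖det₂ (q 2) (q 3)‖ := by simp [hq.two, det₂]
  have hz30 : q 3 1 ≠ 0 := norm_ne_zero_iff.mp (by rw [hz3]; exact one_ne_zero)
  have hz40 : q 4 1 ≠ 0 := norm_ne_zero_iff.mp (by rw [hz4]; exact one_ne_zero)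
  obtain ⟨t₃, ht₃⟩ : ∃ t, q 3 0 = q 3 1 * t := ⟨q 3 0 / q 3 1, (mul_div_cancel₀ _ hz30).symm⟩
  obtain ⟨t₄, ht₄⟩ : ∃ t, q 4 0 = q 4 1 * t := ⟨q 4 0 / q 4 1, (mul_div_cancel₀ _ hz40).symm⟩
  have ht₃n : ‖t₃‖ = ‖det₂ (q 2) (q 3)‖ := by rw [← hx3, ht₃, norm_mul, hz3, one_mul]
  have ht₄n : ‖t₄‖ = 1 := by rw [← hx4, ht₄, norm_mul, hz4, one_mul]
  have ht₃₄ : ‖t₃ - t₄‖ = 1 := by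
    have := hq.d34
    rw [det₂, ht₃, ht₄, show q 3 1 * t₃ * q 4 1 - q 3 1 * (q 4 1 * t₄) =
      q 3 1 * q 4 1 * (t₃ - t₄) by ring, norm_mul, norm_mul, hz3, hz4, one_mul, one_mul] at this
    exact this
  have ht₃le : ‖t₃‖ ≤ 1 := ht₃n ▸ norm_det₂_le_one (hq.norm_le 2) (hq.norm_le 3)
  -- Translating by the mean of the roots 0, t₃, t₄ kills the quadratic coefficient of the cubic; it
  -- is integral because 3 is a unit.
  obtain ⟨e, he⟩ : ∃ e, 3 * e = t₃ + t₄ := ⟨(t₃ + t₄) / 3, mul_div_cancel₀ _ h30⟩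
  have hele : ‖e‖ ≤ 1 := by
    have := congrArg norm he
    rw [norm_mul, h3, one_mul] at this
    rw [this]
    exact (IsUltrametricDist.norm_add_le_max _ _).trans (max_le ht₃le ht₄n.le)
  let s := -(3 * e ^ 2) + t₃ * t₄
  let t := e * (t₃ - e) * (t₄ - e)
  -- Written so that t₄², a unit, dominates when t₃ reduces to zero; this makes s a unit in that
  -- case.
  have h3s : 3 * s = -(t₄ ^ 2 - t₃ * (t₄ - t₃)) := by
    simp only [s]
    linear_combination (-3 * e - t₃ - t₄) * he
  -- The right side is minus the discriminant of the cubic with roots 0, t₃, t₄.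
  have hdisc : 27 * t ^ 2 + 4 * s ^ 3 = -(t₃ * t₄ * (t₃ - t₄)) ^ 2 := by
    have ht4 : t₄ = 3 * e - t₃ := by linear_combination -he
    simp only [s, t, ht4]
    ring
  -- The second zero is moved onto the first at infinity, which changes no reduction.
  let q' : Fin 5 → Fin 2 → K := fun i => if i = 1 then ![q 1 0, 0] else q i
  have hq' : ∀ i j, ‖q' i j‖ ≤ 1 := by
    intro i j
    simp only [q']
    split_ifs
    · fin_cases j
      · exact hq.norm_le 1 0
      · simp
    · exact hq.norm_le i j
  have hqq' : ∀ i j, ‖q i j - q' i j‖ < 1 := by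
    intro i j
    simp only [q']
    split_ifs with h
    · subst h
      fin_cases j
      · simp
      · simpa using hz1
    · simp
  have hform : linSubst !![1, e; 0, 1] (rootForm q') =
      C (q 1 0 * q 3 1 * q 4 1) * quintic (doubleRootSlice s t) := by
    have hroot : rootForm q' = C (q 1 0 * q 3 1 * q 4 1) *
        (X 1 ^ 2 * X 0 * (X 0 - C t₃ * X 1) * (X 0 - C t₄ * X 1)) := by
      rw [rootForm, Fin.prod_univ_five]
      simp [q', hq.zero, hq.two, ht₃, ht₄]
      ring
    have he' := congrArg (C : K → MvPolynomial (Fin 2) K) he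
    simp only [map_mul, map_add, map_ofNat] at he'
    rw [hroot]
    simp only [quintic, doubleRootSlice, Fin.sum_univ_six, map_mul, map_pow, map_sub, linSubst_C,
      linSubst_X, s, t]
    simp
    left
    rw [show (C 3 : MvPolynomial (Fin 2) K) = 3 from map_ofNat C 3]
    linear_combination (X 1 ^ 3 * (X 0 ^ 2 + 2 * C e * X 0 * X 1)) * he'
  refine ⟨s, t, ?_, ?_, ?_, ?_, ?_⟩
  · intro I hI
    refine (norm_aeval_eq_one_congr hq.norm_le hq' hqq' I.poly).trans ?_
    change ‖I.eval _‖ = 1 ↔ _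
    rw [hI.norm_eval_transform (g := !![1, e; 0, 1]) (e := q 1 0 * q 3 1 * q 4 1)
      (b := doubleRootSlice s t)]
    · simp [Matrix.det_fin_two]
    · simp [hx1, hz3, hz4]
    · rw [quintic_quinticCoeffs (isHomogeneous_rootForm q'), hform]
  · simp only [← mem_integers] at *
    exact add_mem (neg_mem (mul_mem (natCast_mem (Integers K) 3)
      (pow_mem hele 2))) (mul_mem ht₃le (mem_integers.mpr ht₄n.le))
  · simp only [← mem_integers] at *
    exact mul_mem (mul_mem hele (sub_mem ht₃le hele)) (sub_mem (mem_integers.mpr ht₄n.le) hele)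
  · rw [hdisc, norm_neg, norm_pow, norm_mul, norm_mul, ht₃n, ht₄n, ht₃₄, mul_one, mul_one]
  · intro h
    have h1 := congrArg norm h3s
    rw [norm_mul, h3, one_mul, norm_neg] at h1
    have h2 : ‖t₃ * (t₄ - t₃)‖ < ‖t₄ ^ 2‖ := by
      rw [norm_mul, norm_pow, norm_sub_rev t₄, ht₃₄, ht₄n, ht₃n, mul_one, one_pow]
      exact h
    rw [h1, sub_eq_add_neg, IsUltrametricDist.norm_add_eq_max_of_norm_ne_norm
      (by rw [norm_neg]; exact h2.ne'), norm_neg, max_eq_left h2.le, norm_pow, ht₄n, one_pow]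

variable (h2 : ‖(2 : K)‖ = 1) (h3 : ‖(3 : K)‖ = 1) (h11 : ‖(11 : K)‖ = 1)
  (h01 : ‖det₂ (q 0) (q 1)‖ < 1)
include h2 h3 h11 h01

/-- On the double-root slice |H| is the norm of the discriminant of the residual cubic. Among the
differences of the roots 0, t₃, t₄ only t₃ can fail to be a unit, and its norm is that of the second
cherry. -/
theorem norm_eval_H_eq_one_iff :
    ‖Inv.H.eval (quinticCoeffs (rootForm q))‖ = 1 ↔ ‖det₂ (q 2) (q 3)‖ = 1 := by
  obtain ⟨s, t, hI, -, -, hd, -⟩ := hq.exists_norm_eval_iff h3 h01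
  rw [hI _ .H, IsDetecting.H.norm_eval_doubleRootSlice h2 h3 h11]
  change ‖27 * t ^ 2 + 4 * s ^ 3‖ = 1 ↔ _
  rw [hd]
  exact pow_eq_one_iff_of_nonneg (norm_nonneg _) two_ne_zero

theorem norm_eval_I4_eq_one (h23 : ‖det₂ (q 2) (q 3)‖ < 1) :
    ‖Inv.I4.eval (quinticCoeffs (rootForm q))‖ = 1 := by
  obtain ⟨s, t, hI, -, -, -, hs⟩ := hq.exists_norm_eval_iff h3 h01
  rw [hI _ .I4, IsDetecting.I4.norm_eval_doubleRootSlice h2 h3 h11]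
  change ‖6 * s‖ = 1
  rw [show (6 : K) = 2 * 3 by norm_num, norm_mul, norm_mul, h2, h3, hs h23]
  norm_num

/-- If s and t both had norm less than one, so would 4s³ + 27t², which here has norm one. -/
theorem norm_eval_I4_or_I18_eq_one (h23 : ‖det₂ (q 2) (q 3)‖ = 1) :
    ‖Inv.I4.eval (quinticCoeffs (rootForm q))‖ = 1 ∨
      ‖Inv.I18.eval (quinticCoeffs (rootForm q))‖ = 1 := by
  obtain ⟨s, t, hI, hs, ht, hd, -⟩ := hq.exists_norm_eval_iff h3 h01
  rw [hI _ .I4, hI _ .I18, IsDetecting.I4.norm_eval_doubleRootSlice h2 h3 h11,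
    IsDetecting.I18.norm_eval_doubleRootSlice h2 h3 h11]
  change ‖6 * s‖ = 1 ∨ ‖-27 * t * (27 * t ^ 2 + 4 * s ^ 3)‖ = 1
  have h27 : ‖(27 : K)‖ = 1 := by
    rw [show (27 : K) = 3 ^ 3 by norm_num, norm_pow, h3, one_pow]
  rw [show (6 : K) = 2 * 3 by norm_num, norm_mul, norm_mul, h2, h3, norm_mul, norm_mul, norm_neg,
    h27, hd, h23]
  rcases hs.lt_or_eq with hs | hs
  · right
    by_contra hne
    have ht1 : ‖t‖ < 1 := lt_of_le_of_ne ht (by simpa using hne)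
    have h4 : ‖(4 : K)‖ = 1 := by
      rw [show (4 : K) = 2 * 2 by norm_num, norm_mul, h2, one_mul]
    have : ‖27 * t ^ 2 + 4 * s ^ 3‖ < 1 := by
      refine (IsUltrametricDist.norm_add_le_max _ _).trans_lt (max_lt ?_ ?_)
      · rw [norm_mul, h27, one_mul, norm_pow]
        exact pow_lt_one₀ (norm_nonneg _) ht1 two_ne_zero
      · rw [norm_mul, h4, one_mul, norm_pow]
        exact pow_lt_one₀ (norm_nonneg _) hs three_ne_zero
    rw [hd, h23] at this
    norm_num at this
  · left
    rw [hs]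
    norm_num

end IsNormalized

end NormalForm

/-! ### Invariants under projective changes of the zeros. -/

section Scaling

open MvPolynomial

variable {K : Type*} [Field K] [CharZero K]

theorem rootForm_perm {A : Type*} [CommRing A] (σ : Equiv.Perm (Fin 5)) (p : Fin 5 → Fin 2 → A) :
    rootForm (fun i => p (σ i)) = rootForm p :=
  Equiv.prod_comp σ fun i => C (p i 1) * X 0 - C (p i 0) * X 1

/-- Invariants of forms whose zeros are related by a projective transformation. -/
theorem Inv.sq_aeval_raw {a : Fin 6 → K} {g : Matrix (Fin 2) (Fin 2) K} {c : K} {u : Fin 5 → K}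
    {q : Fin 5 → Fin 2 → K} (hg : g.det ≠ 0)
    (ha : quintic a = C c * rootForm fun i => u i • g.mulVec (q i)) (I : Inv) :
    aeval a I.raw ^ 2 =
      ((c * ∏ i, u i) ^ 2 * g.det ^ 5) ^ I.deg * aeval (quinticCoeffs (rootForm q)) I.raw ^ 2 := by
  have hq : quintic (quinticCoeffs (rootForm q)) = C 1 * rootForm q := by
    have := quintic_quinticCoeffs_rootForm 1 q
    rwa [map_one, one_mul] at this ⊢
  by_cases hI : I = .disc
  · subst hI
    change aeval a rawDisc ^ 2 = (_) ^ 8 * aeval _ rawDisc ^ 2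
    rw [aeval_rawDisc ha, aeval_rawDisc hq, detSqProd_smul, detSqProd_mulVec]
    ring
  · have h : linSubst g (quintic a) =
        C (c * ((∏ i, u i) * g.det ^ 5)) * quintic (quinticCoeffs (rootForm q)) := by
      rw [ha, map_mul, linSubst_C, linSubst_rootForm, hq, C_mul (a := c), map_one, one_mul, mul_assoc]
    have h1 := Inv.aeval_raw_transform hI h
    have hw := I.two_mul_weight
    refine mul_left_cancel₀ (pow_ne_zero 2 (pow_ne_zero I.weight hg)) ?_
    rw [← mul_pow, h1]
    -- Twice the weight is five times the degree. Working with squares avoids the half-integral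
    -- exponent and a square root of the determinant in K.
    have : (g.det ^ I.weight) ^ 2 = (g.det ^ 5) ^ I.deg := by
      rw [← pow_mul, mul_comm _ 2, hw, pow_mul]
    rw [this]
    ring

end Scaling

/-! ### From valuations to norms. -/

section Valuation

variable {K : Type*} [NontriviallyNormedField K]

theorem nsmul_val_of_ne_zero {x : K} (hx : x ≠ 0) (n : ℕ) :
    n • val x = ((-Real.log (‖x‖ ^ n) : ℝ) : WithTop ℝ) := by
  rw [val, if_neg hx, ← WithTop.coe_nsmul, Real.log_pow]
  simp

theorem nsmul_val_zero {n : ℕ} (hn : n ≠ 0) : n • val (0 : K) = ⊤ := by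
  rw [val, if_pos rfl]
  obtain ⟨k, rfl⟩ := Nat.exists_eq_succ_of_ne_zero hn
  rw [succ_nsmul, WithTop.add_top]

/-- Zero arguments are covered because invariants other than Δ may vanish; nonzero multiples are
required since 0 • ⊤ = 0. -/
theorem nsmul_val_le_nsmul_val {m n : ℕ} (hm : m ≠ 0) (hn : n ≠ 0) {x y : K} :
    m • val x ≤ n • val y ↔ ‖y‖ ^ n ≤ ‖x‖ ^ m := by
  by_cases hx : x = 0
  · by_cases hy : y = 0
    · simp [hx, hy, nsmul_val_zero, hm, hn]
    · rw [hx, nsmul_val_zero hm, nsmul_val_of_ne_zero hy, norm_zero, zero_pow hm]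
      exact iff_of_false (fun h => WithTop.coe_ne_top (top_le_iff.mp h))
        (not_le.mpr (pow_pos (norm_pos_iff.mpr hy) _))
  · by_cases hy : y = 0
    · rw [hy, nsmul_val_zero hn]
      simp [hn]
    · have h1 : 0 < ‖x‖ ^ m := pow_pos (norm_pos_iff.mpr hx) _
      have h2 : 0 < ‖y‖ ^ n := pow_pos (norm_pos_iff.mpr hy) _
      rw [nsmul_val_of_ne_zero hx, nsmul_val_of_ne_zero hy, WithTop.coe_le_coe, neg_le_neg_iff,
        Real.log_le_log_iff h2 h1]

end Valuation

/-! ### One scaling constant for all invariants. -/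

section Criteria

open MvPolynomial

variable {K : Type*} [NontriviallyNormedField K] [IsUltrametricDist K] [CharZero K]

omit [IsUltrametricDist K] in
/-- The absolute values of the invariants of forms with projectively equivalent zeros differ by
powers of a constant. -/
theorem exists_norm_eval_eq {a : Fin 6 → K} {g : Matrix (Fin 2) (Fin 2) K} {c : K} {u : Fin 5 → K}
    {q : Fin 5 → Fin 2 → K} (hg : g.det ≠ 0) (hc : c ≠ 0) (hu : ∀ i, u i ≠ 0)
    (ha : quintic a = C c * rootForm fun i => u i • g.mulVec (q i)) :
    ∃ μ : ℝ, 0 < μ ∧ ∀ I : Inv,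
      ‖I.eval a‖ = μ ^ I.deg * ‖I.eval (quinticCoeffs (rootForm q))‖ := by
  have h0 : 0 < ‖(c * ∏ i, u i) ^ 2 * g.det ^ 5‖ :=
    norm_pos_iff.mpr (mul_ne_zero (pow_ne_zero _ (mul_ne_zero hc
      (Finset.prod_ne_zero_iff.mpr fun i _ => hu i))) (pow_ne_zero _ hg))
  refine ⟨√‖(c * ∏ i, u i) ^ 2 * g.det ^ 5‖, Real.sqrt_pos.mpr h0, fun I => ?_⟩
  obtain ⟨m, -, he⟩ := I.exists_eval_eq
  have h1 := congrArg norm (Inv.sq_aeval_raw hg ha I)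
  rw [norm_pow, norm_mul, norm_pow _ I.deg, norm_pow _ 2] at h1
  generalize ‖(c * ∏ i, u i) ^ 2 * g.det ^ 5‖ = N at h0 h1
  rw [← pow_left_inj₀ (norm_nonneg _) (by positivity) two_ne_zero, mul_pow, ← pow_mul,
    mul_comm I.deg, pow_mul, Real.sq_sqrt h0.le, he a, he (quinticCoeffs _), norm_mul, norm_mul,
    mul_pow, mul_pow, h1]
  ring

end Criteria

/-! ### Homogeneity of the inequalities. -/

section Conditions

variable {K : Type*} [NontriviallyNormedField K]

/-- The inequalities that characterize Type I. -/
def ConditionI (a : Fin 6 → K) : Prop :=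
  ∀ I : Inv, I.deg • val (Inv.disc.eval a) ≤ 8 • val (I.eval a)

/-- The inequalities that characterize Type II. -/
def ConditionII (a : Fin 6 → K) : Prop :=
  (2 • val (Inv.I4.eval a) < val (Inv.disc.eval a) ∨
    4 • val (Inv.I18.eval a) < 9 • val (Inv.disc.eval a)) ∧
  ∀ I : Inv, I.deg • val (Inv.H.eval a) ≤ 12 • val (I.eval a)

/-- The inequalities that characterize Type III. -/
def ConditionIII (a : Fin 6 → K) : Prop :=
  2 • val (Inv.I4.eval a) < val (Inv.disc.eval a) ∧
    3 • val (Inv.I4.eval a) < val (Inv.H.eval a)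

variable {a b : Fin 6 → K} {μ : ℝ} (hμ : 0 < μ) (hab : ∀ I : Inv, ‖I.eval a‖ = μ ^ I.deg * ‖I.eval b‖)
include hμ hab

/-- Both sides have the same total degree, so the same power of μ cancels. -/
theorem nsmul_val_le_iff_of_scaled {I J : Inv} {m n : ℕ} (hm : m ≠ 0) (hn : n ≠ 0)
    (h : I.deg * m = J.deg * n) :
    m • val (I.eval a) ≤ n • val (J.eval a) ↔ ‖J.eval b‖ ^ n ≤ ‖I.eval b‖ ^ m := by
  rw [nsmul_val_le_nsmul_val hm hn, hab, hab, mul_pow, mul_pow, ← pow_mul, ← pow_mul, h]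
  exact mul_le_mul_iff_right₀ (pow_pos hμ _)

theorem nsmul_val_lt_iff_of_scaled {I J : Inv} {m n : ℕ} (hm : m ≠ 0) (hn : n ≠ 0)
    (h : I.deg * m = J.deg * n) :
    m • val (I.eval a) < n • val (J.eval a) ↔ ‖J.eval b‖ ^ n < ‖I.eval b‖ ^ m := by
  rw [← not_le, nsmul_val_le_iff_of_scaled hμ hab hn hm h.symm, not_le]

theorem conditionI_iff : ConditionI a ↔ ∀ I : Inv, ‖I.eval b‖ ^ 8 ≤ ‖Inv.disc.eval b‖ ^ I.deg :=
  forall_congr' fun I => nsmul_val_le_iff_of_scaled hμ hab (by cases I <;> decide) (by decide)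
    (mul_comm _ _)

theorem conditionII_iff : ConditionII a ↔
    (‖Inv.disc.eval b‖ < ‖Inv.I4.eval b‖ ^ 2 ∨
      ‖Inv.disc.eval b‖ ^ 9 < ‖Inv.I18.eval b‖ ^ 4) ∧
    ∀ I : Inv, ‖I.eval b‖ ^ 12 ≤ ‖Inv.H.eval b‖ ^ I.deg := by
  refine and_congr (or_congr ?_ ?_) (forall_congr' fun I => ?_)
  · simpa using nsmul_val_lt_iff_of_scaled hμ hab (I := .I4) (J := .disc) two_ne_zero one_ne_zero rfl
  · exact nsmul_val_lt_iff_of_scaled hμ hab (by decide) (by decide) rfl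
  · exact nsmul_val_le_iff_of_scaled hμ hab (by cases I <;> decide) (by decide) (mul_comm _ _)

theorem conditionIII_iff : ConditionIII a ↔
    ‖Inv.disc.eval b‖ < ‖Inv.I4.eval b‖ ^ 2 ∧ ‖Inv.H.eval b‖ < ‖Inv.I4.eval b‖ ^ 3 := by
  refine and_congr ?_ ?_
  · simpa using nsmul_val_lt_iff_of_scaled hμ hab (I := .I4) (J := .disc) two_ne_zero one_ne_zero rfl
  · simpa using nsmul_val_lt_iff_of_scaled hμ hab (I := .I4) (J := .H) three_ne_zero one_ne_zero rfl

end Conditions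

/-! ### Which inequalities hold in the three cases. -/

section Classification

variable {K : Type*} [NontriviallyNormedField K] [IsUltrametricDist K] [CharZero K] [IsAlgClosed K]
  {a : Fin 6 → K} {q : Fin 5 → Fin 2 → K} {μ : ℝ}

/-- Here |Δ| = 1. Types II and III would need I₄ or I₁₈ of norm greater than one, against
integrality. -/
theorem IsNormalized.conditions_of_eq_of_eq (hq : IsNormalized q) (hμ : 0 < μ)
    (hab : ∀ I : Inv, ‖I.eval a‖ = μ ^ I.deg * ‖I.eval (quinticCoeffs (rootForm q))‖)
    (h01 : ‖det₂ (q 0) (q 1)‖ = 1) (h23 : ‖det₂ (q 2) (q 3)‖ = 1) :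
    ConditionI a ∧ ¬ ConditionII a ∧ ¬ ConditionIII a := by
  rw [conditionI_iff hμ hab, conditionII_iff hμ hab, conditionIII_iff hμ hab, hq.norm_eval_disc,
    h01, h23]
  have hle : ∀ (I : Inv) n, ‖I.eval (quinticCoeffs (rootForm q))‖ ^ n ≤ 1 := fun I n =>
    pow_le_one₀ (norm_nonneg _) (hq.norm_eval_le_one I)
  refine ⟨fun I => by simpa using hle I 8, fun h => ?_, fun h => ?_⟩
  · rcases h.1 with h | h
    · exact absurd (hle .I4 2) (not_le.mpr (by simpa using h))
    · exact absurd (hle .I18 4) (not_le.mpr (by simpa using h))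
  · exact absurd (hle .I4 2) (not_le.mpr (by simpa using h.1))

variable (hq : IsNormalized q) (h2 : ‖(2 : K)‖ = 1) (h3 : ‖(3 : K)‖ = 1) (h11 : ‖(11 : K)‖ = 1)
  (hμ : 0 < μ) (hab : ∀ I : Inv, ‖I.eval a‖ = μ ^ I.deg * ‖I.eval (quinticCoeffs (rootForm q))‖)
  (h01 : ‖det₂ (q 0) (q 1)‖ < 1)
include hq h2 h3 h11 hμ hab h01

/-- H is a unit and Δ is not. So Condition I fails at H, H dominates all invariants, and the strict
inequality H versus I₄ of Type III contradicts integrality of I₄. -/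
theorem IsNormalized.conditions_of_lt_of_eq (h23 : ‖det₂ (q 2) (q 3)‖ = 1) :
    ¬ ConditionI a ∧ ConditionII a ∧ ¬ ConditionIII a := by
  have hH := (hq.norm_eval_H_eq_one_iff h2 h3 h11 h01).mpr h23
  have hd : ‖Inv.disc.eval (quinticCoeffs (rootForm q))‖ < 1 := by
    rw [hq.norm_eval_disc, h23, mul_one]
    exact pow_lt_one₀ (norm_nonneg _) h01 two_ne_zero
  have hle : ∀ (I : Inv) n, ‖I.eval (quinticCoeffs (rootForm q))‖ ^ n ≤ 1 := fun I n =>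
    pow_le_one₀ (norm_nonneg _) (hq.norm_eval_le_one I)
  rw [conditionI_iff hμ hab, conditionII_iff hμ hab, conditionIII_iff hμ hab]
  refine ⟨fun h => ?_, ⟨?_, fun I => by rw [hH, one_pow]; exact hle I 12⟩, fun h => ?_⟩
  · have := h .H
    rw [hH, one_pow] at this
    exact absurd (pow_lt_one₀ (norm_nonneg _) hd (by decide)) (not_lt.mpr this)
  · rcases hq.norm_eval_I4_or_I18_eq_one h2 h3 h11 h01 h23 with h | h
    · exact .inl (by rwa [h, one_pow])
    · exact .inr (by rw [h, one_pow]; exact pow_lt_one₀ (norm_nonneg _) hd (by decide))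
  · exact absurd (hle .I4 3) (not_le.mpr (hH ▸ h.2))

/-- I₄ is a unit while Δ and H are not, so Conditions I and II both fail at I₄. -/
theorem IsNormalized.conditions_of_lt_of_lt (h23 : ‖det₂ (q 2) (q 3)‖ < 1) :
    ¬ ConditionI a ∧ ¬ ConditionII a ∧ ConditionIII a := by
  have hH : ‖Inv.H.eval (quinticCoeffs (rootForm q))‖ < 1 :=
    lt_of_le_of_ne (hq.norm_eval_le_one .H)
      (mt (hq.norm_eval_H_eq_one_iff h2 h3 h11 h01).mp h23.ne)
  have h4 := hq.norm_eval_I4_eq_one h2 h3 h11 h01 h23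
  have hd : ‖Inv.disc.eval (quinticCoeffs (rootForm q))‖ < 1 := by
    rw [hq.norm_eval_disc]
    exact pow_lt_one₀ (by positivity) (mul_lt_one_of_nonneg_of_lt_one_left (norm_nonneg _) h01 h23.le)
      two_ne_zero
  rw [conditionI_iff hμ hab, conditionII_iff hμ hab, conditionIII_iff hμ hab, h4]
  refine ⟨fun h => ?_, fun h => ?_, by simpa using hd, by simpa using hH⟩
  · have := h .I4
    rw [h4, one_pow] at this
    exact absurd (pow_lt_one₀ (norm_nonneg _) hd (by decide)) (not_lt.mpr this)
  · have := h.2 .I4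
    rw [h4, one_pow] at this
    exact absurd (pow_lt_one₀ (norm_nonneg _) hH (by decide)) (not_lt.mpr this)

end Classification

/-! ### Ordering five points into cherries and normalizing them. -/

section FivePoints

/-- The points are ordered such that `{0, 1}` and `{2, 3}` are cherries of the tree with the given
distances. -/
structure IsCherryOrder (D : Fin 5 → Fin 5 → ℝ) : Prop where
  le_left : D 0 1 * D 2 4 ≤ D 1 2 * D 0 4
  eq_left : D 0 2 * D 1 4 = D 1 2 * D 0 4
  le_right : D 2 3 * D 0 4 ≤ D 0 3 * D 2 4
  eq_right : D 0 2 * D 3 4 = D 0 3 * D 2 4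
  eq_mid : D 1 3 * D 0 2 = D 1 2 * D 0 3

/-- Five points of the projective line have an ordering in which `{0, 1}` and `{2, 3}` are
cherries, provided that their distances satisfy the ultrametric Plücker relation. -/
theorem exists_isCherryOrder {D : Fin 5 → Fin 5 → ℝ} (hs : ∀ i j, D i j = D j i)
    (hpos : ∀ i j, i ≠ j → 0 < D i j)
    (hP : ∀ i j k l, D i j * D k l ≤ max (D i k * D j l) (D i l * D j k)) :
    ∃ σ : Equiv.Perm (Fin 5), IsCherryOrder (fun i j => D (σ i) (σ j)) := by
  -- The quotient is the distance between points 0 and 1 in a coordinate with point 4 at infinity. A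
  -- closest pair is a cherry, possibly a degenerate one.
  obtain ⟨σ, hσ⟩ := Finite.exists_min fun σ : Equiv.Perm (Fin 5) =>
    D (σ 0) (σ 1) / (D (σ 0) (σ 4) * D (σ 1) (σ 4))
  obtain ⟨E, hE⟩ : ∃ E : Fin 5 → Fin 5 → ℝ, E = fun i j => D (σ i) (σ j) := ⟨_, rfl⟩
  suffices ∃ τ : Equiv.Perm (Fin 5), IsCherryOrder (fun i j => E (τ i) (τ j)) by
    obtain ⟨τ, hτ⟩ := this
    exact ⟨τ.trans σ, by simpa [hE] using hτ⟩
  have hs' : ∀ i j, E i j = E j i := fun i j => by simp only [hE]; exact hs _ _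
  have hpos' : ∀ i j, i ≠ j → 0 < E i j := fun i j h => by
    simp only [hE]; exact hpos _ _ (σ.injective.ne h)
  have hP' : ∀ i j k l, E i j * E k l ≤ max (E i k * E j l) (E i l * E j k) := fun i j k l => by
    simp only [hE]; exact hP _ _ _ _
  have hmin : ∀ τ : Equiv.Perm (Fin 5), E 0 1 / (E 0 4 * E 1 4) ≤
      E (τ 0) (τ 1) / (E (τ 0) (τ 4) * E (τ 1) (τ 4)) := fun τ => by
    simpa [hE] using hσ (τ.trans σ)
  clear hE hσ hP hpos hs
  have p01 := hpos' 0 1 (by decide)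
  have p02 := hpos' 0 2 (by decide)
  have p03 := hpos' 0 3 (by decide)
  have p04 := hpos' 0 4 (by decide)
  have p12 := hpos' 1 2 (by decide)
  have p13 := hpos' 1 3 (by decide)
  have p14 := hpos' 1 4 (by decide)
  have p23 := hpos' 2 3 (by decide)
  have p24 := hpos' 2 4 (by decide)
  have p34 := hpos' 3 4 (by decide)
  have m02 : E 0 1 * E 2 4 ≤ E 0 2 * E 1 4 := by
    have h : E 0 1 / (E 0 4 * E 1 4) ≤ E 0 2 / (E 0 4 * E 2 4) := hmin (Equiv.swap 1 2)
    rw [div_le_div_iff₀ (mul_pos p04 p14) (mul_pos p04 p24)] at h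
    nlinarith
  have m03 : E 0 1 * E 3 4 ≤ E 0 3 * E 1 4 := by
    have h : E 0 1 / (E 0 4 * E 1 4) ≤ E 0 3 / (E 0 4 * E 3 4) := hmin (Equiv.swap 1 3)
    rw [div_le_div_iff₀ (mul_pos p04 p14) (mul_pos p04 p34)] at h
    nlinarith
  have m12 : E 0 1 * E 2 4 ≤ E 1 2 * E 0 4 := by
    have h : E 0 1 / (E 0 4 * E 1 4) ≤ E 2 1 / (E 2 4 * E 1 4) := hmin (Equiv.swap 0 2)
    rw [hs' 2 1, div_le_div_iff₀ (mul_pos p04 p14) (mul_pos p24 p14)] at h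
    nlinarith
  have m13 : E 0 1 * E 3 4 ≤ E 1 3 * E 0 4 := by
    have h : E 0 1 / (E 0 4 * E 1 4) ≤ E 3 1 / (E 3 4 * E 1 4) := hmin (Equiv.swap 0 3)
    rw [hs' 3 1, div_le_div_iff₀ (mul_pos p04 p14) (mul_pos p34 p14)] at h
    nlinarith
  have e2 : E 0 2 * E 1 4 = E 1 2 * E 0 4 := by
    have h1 := hP' 0 2 1 4
    have h2 := hP' 0 4 1 2
    rw [hs' 2 1, mul_comm (E 0 4) (E 1 2)] at h1
    rw [hs' 4 2, hs' 4 1, mul_comm (E 0 4) (E 1 2)] at h2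
    exact le_antisymm (h1.trans (max_le m12 le_rfl)) (h2.trans (max_le m02 le_rfl))
  have e3 : E 0 3 * E 1 4 = E 1 3 * E 0 4 := by
    have h1 := hP' 0 3 1 4
    have h2 := hP' 0 4 1 3
    rw [hs' 3 1, mul_comm (E 0 4) (E 1 3)] at h1
    rw [hs' 4 3, hs' 4 1, mul_comm (E 0 4) (E 1 3)] at h2
    exact le_antisymm (h1.trans (max_le m13 le_rfl)) (h2.trans (max_le m03 le_rfl))
  have e : E 1 3 * E 0 2 = E 1 2 * E 0 3 := by
    have h : (E 1 3 * E 0 2) * (E 0 4 * E 1 4) = (E 1 2 * E 0 3) * (E 0 4 * E 1 4) := by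
      linear_combination E 1 3 * E 0 4 * e2 - E 1 2 * E 0 4 * e3
    exact mul_right_cancel₀ (mul_pos p04 p14).ne' h
  have q1 := hP' 0 2 3 4
  have q2 := hP' 0 3 2 4
  have q3 := hP' 0 4 2 3
  have q4 := hP' 0 1 2 3
  rw [hs' 3 2] at q2
  rw [hs' 4 3, hs' 4 2] at q3
  rw [mul_comm (E 0 2), mul_comm (E 0 3), e, max_self] at q4
  -- The four-point tree of 0, 2, 3, 4 shows where the second cherry is. A strict inequality splits
  -- off {3, 4} or {2, 4}, which is then relabelled {2, 3}; with equality {2, 3} serves as it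
  -- stands, possibly degenerate.
  rcases lt_trichotomy (E 0 2 * E 3 4) (E 0 3 * E 2 4) with h | h | h
  · have h' : E 0 3 * E 2 4 = E 0 4 * E 2 3 :=
      le_antisymm ((le_max_iff.mp q2).resolve_left h.not_ge)
        (q3.trans (max_le h.le le_rfl))
    refine ⟨Equiv.swap 2 3 * Equiv.swap 3 4, ?_, ?_, ?_, ?_, ?_⟩
    · change E 0 1 * E 3 2 ≤ E 1 3 * E 0 2
      rw [hs' 3 2, e]
      exact q4
    · change E 0 3 * E 1 2 = E 1 3 * E 0 2
      rw [e, mul_comm]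
    · change E 3 4 * E 0 2 ≤ E 0 4 * E 3 2
      rw [hs' 3 2, ← h', mul_comm]
      exact h.le
    · change E 0 3 * E 4 2 = E 0 4 * E 3 2
      rw [hs' 3 2, hs' 4 2, h']
    · change E 1 4 * E 0 3 = E 1 3 * E 0 4
      rw [← e3, mul_comm]
  · refine ⟨1, m12, e2, ?_, h, e⟩
    rw [h, max_self] at q3
    simpa [mul_comm] using q3
  · have h' : E 0 2 * E 3 4 = E 0 4 * E 2 3 :=
      le_antisymm ((le_max_iff.mp q1).resolve_left h.not_ge)
        (q3.trans (max_le le_rfl h.le))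
    refine ⟨Equiv.swap 3 4, ?_, ?_, ?_, ?_, ?_⟩
    · change E 0 1 * E 2 3 ≤ E 1 2 * E 0 3
      exact q4
    · change E 0 2 * E 1 3 = E 1 2 * E 0 3
      rw [← e, mul_comm]
    · change E 2 4 * E 0 3 ≤ E 0 4 * E 2 3
      rw [← h', mul_comm]
      exact h.le
    · change E 0 2 * E 4 3 = E 0 4 * E 2 3
      rw [hs' 4 3, h']
    · change E 1 4 * E 0 2 = E 1 2 * E 0 4
      rw [← e2, mul_comm]

/-- The two cherries of an ordering can be interchanged. -/
theorem IsCherryOrder.swap {D : Fin 5 → Fin 5 → ℝ} (hs : ∀ i j, D i j = D j i)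
    (h : IsCherryOrder D) : IsCherryOrder fun i j =>
      D ((Equiv.swap 0 2 * Equiv.swap 1 3 : Equiv.Perm (Fin 5)) i)
        ((Equiv.swap 0 2 * Equiv.swap 1 3 : Equiv.Perm (Fin 5)) j) where
  le_left := by
    change D 2 3 * D 0 4 ≤ D 3 0 * D 2 4
    rw [hs 3 0]
    exact h.le_right
  eq_left := by
    change D 2 0 * D 3 4 = D 3 0 * D 2 4
    rw [hs 3 0, hs 2 0]
    exact h.eq_right
  le_right := by
    change D 0 1 * D 2 4 ≤ D 2 1 * D 0 4
    rw [hs 2 1]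
    exact h.le_left
  eq_right := by
    change D 2 0 * D 1 4 = D 2 1 * D 0 4
    rw [hs 2 0, hs 2 1]
    exact h.eq_left
  eq_mid := by
    change D 3 1 * D 2 0 = D 3 0 * D 2 1
    rw [hs 3 1, hs 2 0, hs 3 0, hs 2 1, h.eq_mid, mul_comm]

section Field

variable {K : Type*} [NontriviallyNormedField K] [IsUltrametricDist K]

theorem det₂_comm {A : Type*} [CommRing A] (v w : Fin 2 → A) : det₂ v w = -det₂ w v := by
  simp only [det₂]; ring

omit [IsUltrametricDist K] in
theorem norm_det₂_comm (v w : Fin 2 → K) : ‖det₂ v w‖ = ‖det₂ w v‖ := by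
  rw [det₂_comm, norm_neg]

theorem norm_det₂_mul_le (v w x y : Fin 2 → K) :
    ‖det₂ v w‖ * ‖det₂ x y‖ ≤ max (‖det₂ v x‖ * ‖det₂ w y‖) (‖det₂ v y‖ * ‖det₂ w x‖) := by
  have h : det₂ v w * det₂ x y = det₂ v x * det₂ w y + -(det₂ v y * det₂ w x) := by
    simp only [det₂]; ring
  rw [← norm_mul, h, ← norm_mul, ← norm_mul, ← norm_neg (det₂ v y * det₂ w x)]
  exact IsUltrametricDist.norm_add_le_max _ _

omit [IsUltrametricDist K] in
-- In the coordinate with zeros 0, 2, 4 at (1 : 0), (0 : 1), (1 : 1), the other two are (1 : y) and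
-- (x : 1) for cross-ratios x, y. The two inequalities of a cherry order say that x and y are
-- integral, the three equalities that 1 − y, x − 1 and 1 − yx are units.
theorem exists_isNormalized_of_isCherryOrder {p : Fin 5 → Fin 2 → K}
    (hp : ∀ i j, i ≠ j → det₂ (p i) (p j) ≠ 0)
    (h : IsCherryOrder fun i j => ‖det₂ (p i) (p j)‖) :
    ∃ (g : Matrix (Fin 2) (Fin 2) K) (u : Fin 5 → K) (q : Fin 5 → Fin 2 → K),
      g.det ≠ 0 ∧ (∀ i, u i ≠ 0) ∧ (∀ i, p i = u i • g.mulVec (q i)) ∧ IsNormalized q ∧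
      (‖det₂ (q 0) (q 1)‖ = 1 ↔ ‖det₂ (p 0) (p 1)‖ * ‖det₂ (p 2) (p 4)‖ =
        ‖det₂ (p 1) (p 2)‖ * ‖det₂ (p 0) (p 4)‖) ∧
      (‖det₂ (q 2) (q 3)‖ = 1 ↔ ‖det₂ (p 2) (p 3)‖ * ‖det₂ (p 0) (p 4)‖ =
        ‖det₂ (p 0) (p 3)‖ * ‖det₂ (p 2) (p 4)‖) := by
  obtain ⟨d, hd⟩ : ∃ d : Fin 5 → Fin 5 → K, ∀ i j, d i j = det₂ (p i) (p j) := ⟨_, fun _ _ => rfl⟩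
  have hd0 : ∀ i j, i ≠ j → d i j ≠ 0 := fun i j hij => by rw [hd]; exact hp i j hij
  have d01 := hd0 0 1 (by decide)
  have d02 := hd0 0 2 (by decide)
  have d03 := hd0 0 3 (by decide)
  have d04 := hd0 0 4 (by decide)
  have d12 := hd0 1 2 (by decide)
  have d13 := hd0 1 3 (by decide)
  have d14 := hd0 1 4 (by decide)
  have d23 := hd0 2 3 (by decide)
  have d24 := hd0 2 4 (by decide)
  have d34 := hd0 3 4 (by decide)
  obtain ⟨h1, h2, h3, h4, h5⟩ := h
  simp only [← hd, ← norm_mul] at h1 h2 h3 h4 h5 ⊢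
  let y := -(d 0 1 * d 2 4 / (d 1 2 * d 0 4))
  let x := d 2 3 * d 0 4 / (d 0 3 * d 2 4)
  have hy : y = -(d 0 1 * d 2 4 / (d 1 2 * d 0 4)) := rfl
  have hx : x = d 2 3 * d 0 4 / (d 0 3 * d 2 4) := rfl
  have hyle : ‖y‖ ≤ 1 := by
    rw [hy, norm_neg, norm_div]
    exact div_le_one_of_le₀ h1 (norm_nonneg _)
  have hxle : ‖x‖ ≤ 1 := by
    rw [hx, norm_div]
    exact div_le_one_of_le₀ h3 (norm_nonneg _)
  have hy1 : ‖1 - y‖ = 1 := by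
    have : 1 - y = d 0 2 * d 1 4 / (d 1 2 * d 0 4) := by
      rw [hy]
      field_simp
      simp only [hd, det₂]
      ring
    rw [this, norm_div, h2, div_self (norm_ne_zero_iff.mpr (mul_ne_zero d12 d04))]
  have hx1 : ‖x - 1‖ = 1 := by
    have : x - 1 = -(d 0 2 * d 3 4 / (d 0 3 * d 2 4)) := by
      rw [hx]
      field_simp
      simp only [hd, det₂]
      ring
    rw [this, norm_neg, norm_div, h4, div_self (norm_ne_zero_iff.mpr (mul_ne_zero d03 d24))]
  have hxy : ‖1 - y * x‖ = 1 := by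
    have : 1 - y * x = d 1 3 * d 0 2 / (d 1 2 * d 0 3) := by
      rw [hx, hy]
      field_simp
      simp only [hd, det₂]
      ring
    rw [this, norm_div, h5, div_self (norm_ne_zero_iff.mpr (mul_ne_zero d12 d03))]
  -- By Cramer's rule p 4 = α p 0 + β p 2, so the matrix with columns α p 0 and β p 2 sends (1, 1)
  -- to p 4.
  let α := -(d 2 4 / d 0 2)
  let β := d 0 4 / d 0 2
  have hα : α ≠ 0 := neg_ne_zero.mpr (div_ne_zero d24 d02)
  have hβ : β ≠ 0 := div_ne_zero d04 d02
  refine ⟨!![α * p 0 0, β * p 2 0; α * p 0 1, β * p 2 1],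
    ![1 / α, d 1 2 / d 0 2 / α, 1 / β, d 0 3 / d 0 2 / β, 1],
    ![![1, 0], ![1, y], ![0, 1], ![x, 1], ![1, 1]], ?_, ?_, ?_, ?_, ?_, ?_⟩
  · have : (!![α * p 0 0, β * p 2 0; α * p 0 1, β * p 2 1]).det = α * β * d 0 2 := by
      simp only [Matrix.det_fin_two, hd, det₂]
      simp
      ring
    rw [this]
    exact mul_ne_zero (mul_ne_zero hα hβ) d02
  · intro i
    fin_cases i
    · exact div_ne_zero one_ne_zero hα
    · exact div_ne_zero (div_ne_zero d12 d02) hα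
    · exact div_ne_zero one_ne_zero hβ
    · exact div_ne_zero (div_ne_zero d03 d02) hβ
    · exact one_ne_zero
  · intro i
    ext j
    fin_cases i <;> fin_cases j <;>
      simp [α, β, hx, hy] <;> field_simp <;>
      simp only [hd, det₂] <;> ring
  · constructor
    · intro i j
      fin_cases i <;> fin_cases j <;> simp [hxle, hyle]
    all_goals simp [det₂, hy1, hx1, hxy]
  · have : det₂ (![1, 0] : Fin 2 → K) ![1, y] = y := by simp [det₂]
    change ‖det₂ (![1, 0] : Fin 2 → K) ![1, y]‖ = 1 ↔ _
    rw [this, hy, norm_neg, norm_div,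
      div_eq_one_iff_eq (norm_ne_zero_iff.mpr (mul_ne_zero d12 d04))]
  · have : det₂ (![0, 1] : Fin 2 → K) ![x, 1] = -x := by simp [det₂]
    change ‖det₂ (![0, 1] : Fin 2 → K) ![x, 1]‖ = 1 ↔ _
    rw [this, hx, norm_neg, norm_div,
      div_eq_one_iff_eq (norm_ne_zero_iff.mpr (mul_ne_zero d03 d24))]

/-- Five distinct points of the projective line can be ordered and moved to normalized position. -/
theorem exists_isNormalized {p : Fin 5 → Fin 2 → K} (hp : ∀ i j, i ≠ j → det₂ (p i) (p j) ≠ 0) :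
    ∃ (σ : Equiv.Perm (Fin 5)) (g : Matrix (Fin 2) (Fin 2) K) (u : Fin 5 → K)
      (q : Fin 5 → Fin 2 → K), g.det ≠ 0 ∧ (∀ i, u i ≠ 0) ∧
      (∀ i, p (σ i) = u i • g.mulVec (q i)) ∧ IsNormalized q ∧
      (‖det₂ (q 0) (q 1)‖ = 1 → ‖det₂ (q 2) (q 3)‖ = 1) := by
  obtain ⟨σ, hσ⟩ := exists_isCherryOrder (D := fun i j => ‖det₂ (p i) (p j)‖)
    (fun _ _ => norm_det₂_comm _ _) (fun i j h => norm_pos_iff.mpr (hp i j h))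
    (fun _ _ _ _ => norm_det₂_mul_le _ _ _ _)
  have hpσ : ∀ τ : Equiv.Perm (Fin 5), ∀ i j, i ≠ j → det₂ (p (τ i)) (p (τ j)) ≠ 0 :=
    fun τ i j h => hp _ _ (τ.injective.ne h)
  -- If the cherry {0, 1} is degenerate, the two cherries are interchanged, so that the degenerate
  -- one becomes {2, 3}.
  by_cases hyx : ‖det₂ (p (σ 0)) (p (σ 1))‖ * ‖det₂ (p (σ 2)) (p (σ 4))‖ =
        ‖det₂ (p (σ 1)) (p (σ 2))‖ * ‖det₂ (p (σ 0)) (p (σ 4))‖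
  · obtain ⟨g, u, q, hg, hu, hq, hn, h01, h23⟩ := exists_isNormalized_of_isCherryOrder
      (p := fun i => p (σ (((Equiv.swap 0 2 * Equiv.swap 1 3 : Equiv.Perm (Fin 5)) i))))
      (hpσ ((Equiv.swap 0 2 * Equiv.swap 1 3 : Equiv.Perm (Fin 5)).trans σ))
      (hσ.swap fun _ _ => norm_det₂_comm _ _)
    refine ⟨(Equiv.swap 0 2 * Equiv.swap 1 3 : Equiv.Perm (Fin 5)).trans σ, g, u, q, hg, hu, hq, hn,
      fun _ => h23.mpr ?_⟩
    change ‖det₂ (p (σ 0)) (p (σ 1))‖ * ‖det₂ (p (σ 2)) (p (σ 4))‖ =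
      ‖det₂ (p (σ 2)) (p (σ 1))‖ * ‖det₂ (p (σ 0)) (p (σ 4))‖
    rw [hyx, norm_det₂_comm (p (σ 2))]
  · obtain ⟨g, u, q, hg, hu, hq, hn, h01, h23⟩ := exists_isNormalized_of_isCherryOrder
      (p := fun i => p (σ i)) (hpσ σ) hσ
    exact ⟨σ, g, u, q, hg, hu, hq, hn, fun h => absurd (h01.mp h) hyx⟩

end Field

end FivePoints

/-! ### Points of paths through their values on linear forms. -/

section Paths

variable {K : Type*} [NontriviallyNormedField K] [IsUltrametricDist K]

/-- The seminorm defining a point of a path. -/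
def pathNorm (P Q : ℙ K (Fin 2 → K)) (τ : unitInterval) (l : LinForm K) : ℝ :=
  max ((1 - τ) * ‖l P.rep‖) (τ * ‖l Q.rep‖)

theorem path_eq_path_iff {P Q P' Q' : ℙ K (Fin 2 → K)} {σ τ : unitInterval} :
    path P Q σ = path P' Q' τ ↔
      ∃ c : ℝ, 0 < c ∧ ∀ l : LinForm K, pathNorm P Q σ l = c * pathNorm P' Q' τ l :=
  Quotient.eq (r := homothety K)

/-- The linear form `v ↦ det (p, v)`. -/
def detForm (p : Fin 2 → K) : LinForm K where
  toFun v := det₂ p v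
  map_add' v w := by simp only [det₂, Pi.add_apply]; ring
  map_smul' c v := by simp only [det₂, Pi.smul_apply, smul_eq_mul, RingHom.id_apply]; ring

omit [IsUltrametricDist K] in
-- Cramer's rule expands v in p and q; then l is applied.
theorem apply_mul_det₂ (l : LinForm K) (p q v : Fin 2 → K) :
    l v * det₂ p q = l p * det₂ v q + l q * det₂ p v := by
  have h : det₂ p q • v = det₂ v q • p + det₂ p v • q := by
    ext i
    fin_cases i <;> simp [det₂] <;> ring
  have := congrArg l h
  simp only [map_add, map_smul, smul_eq_mul] at this
  linear_combination this

theorem norm_apply_mul_le (l : LinForm K) (p q v : Fin 2 → K) :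
    ‖l v‖ * ‖det₂ p q‖ ≤ max (‖l p‖ * ‖det₂ q v‖) (‖l q‖ * ‖det₂ p v‖) := by
  rw [← norm_mul, apply_mul_det₂, norm_det₂_comm q v, ← norm_mul, ← norm_mul]
  exact IsUltrametricDist.norm_add_le_max _ _

variable {ι : Type*} {P : ι → ℙ K (Fin 2 → K)} {p : ι → Fin 2 → K} {u : ι → K}

/-- The condition that a point lies on the path from `i` to `j`, in terms of the values `x k` of
its seminorm on the linear forms vanishing at the given points of the projective line with mutual
distances `D`. -/
def LiesBetween (D : ι → ι → ℝ) (x : ι → ℝ) (i j : ι) : Prop :=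
  ∀ k, x k * D i j = max (x j * D i k) (x i * D j k)

/-- The position of a point on the path from `i` to `j`. -/
def position (w x : ι → ℝ) (i j : ι) : unitInterval :=
  Set.projIcc 0 1 zero_le_one (x i * w i / (x i * w i + x j * w j))

theorem coe_position {w x : ι → ℝ} (hw : ∀ i, 0 < w i) (hx : ∀ i, 0 ≤ x i) (i j : ι) :
    (position w x i j : ℝ) = x i * w i / (x i * w i + x j * w j) := by
  have h1 : 0 ≤ x i * w i := mul_nonneg (hx i) (hw i).le
  have h2 : 0 ≤ x j * w j := mul_nonneg (hx j) (hw j).le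
  rw [position, Set.projIcc_of_mem zero_le_one ⟨by positivity, div_le_one_of_le₀ (by linarith)
    (by positivity)⟩]

/-- The weights w reflect the chosen representatives of the end points. They drop out, so order
along a path depends on the values x and y alone. -/
theorem position_lt_position_iff {w x y : ι → ℝ} (hw : ∀ i, 0 < w i) (hx : ∀ i, 0 ≤ x i)
    (hy : ∀ i, 0 ≤ y i) {i j : ι} (hxij : 0 < x i + x j) (hyij : 0 < y i + y j) :
    position w x i j < position w y i j ↔ x i * y j < x j * y i := by
  have pos : ∀ {z : ι → ℝ}, (∀ i, 0 ≤ z i) → 0 < z i + z j → 0 < z i * w i + z j * w j := by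
    intro z hz hzij
    rcases (hz i).lt_or_eq with h | h
    · exact add_pos_of_pos_of_nonneg (mul_pos h (hw i)) (mul_nonneg (hz j) (hw j).le)
    · rw [← h, zero_add] at hzij
      exact add_pos_of_nonneg_of_pos (mul_nonneg (hz i) (hw i).le) (mul_pos hzij (hw j))
  rw [← Subtype.coe_lt_coe, coe_position hw hx, coe_position hw hy,
    div_lt_div_iff₀ (pos hx hxij) (pos hy hyij)]
  have hww := mul_pos (hw i) (hw j)
  have key : y i * w i * (x i * w i + x j * w j) - x i * w i * (y i * w i + y j * w j) =
      (x j * y i - x i * y j) * (w i * w j) := by ring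
  rw [← sub_pos, key, mul_pos_iff_of_pos_right hww, sub_pos]

theorem LiesBetween.pos_add {D : ι → ι → ℝ} {x : ι → ℝ} {i j : ι} (h : LiesBetween D x i j)
    (hD : 0 < D i j) (hx : ∀ i, 0 ≤ x i) (hx0 : ∃ k, x k ≠ 0) : 0 < x i + x j := by
  refine lt_of_le_of_ne (add_nonneg (hx i) (hx j)) fun h0 => ?_
  have hi : x i = 0 := by linarith [hx i, hx j]
  have hj : x j = 0 := by linarith [hx i, hx j]
  obtain ⟨k, hk⟩ := hx0
  have := h k
  rw [hi, hj, zero_mul, zero_mul, max_self] at this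
  exact (mul_ne_zero hk hD.ne') this

variable (hP : ∀ i, (P i).rep = u i • p i) (hu : ∀ i, u i ≠ 0)
  (hp : ∀ i j, i ≠ j → det₂ (p i) (p j) ≠ 0)

include hP in
omit [IsUltrametricDist K] in
theorem pathNorm_eq (i j : ι) (τ : unitInterval) (l : LinForm K) :
    pathNorm (P i) (P j) τ l = max ((1 - τ) * ‖u i‖ * ‖l (p i)‖) (τ * ‖u j‖ * ‖l (p j)‖) := by
  simp only [pathNorm, hP, map_smul, smul_eq_mul, norm_mul, mul_assoc]

omit [IsUltrametricDist K] in
theorem norm_detForm_self (v : Fin 2 → K) : ‖detForm v v‖ = 0 := by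
  rw [norm_eq_zero]
  change v 0 * v 1 - v 1 * v 0 = 0
  ring

include hP in
omit [IsUltrametricDist K] in
theorem pathNorm_detForm (i j n : ι) (τ : unitInterval) :
    pathNorm (P i) (P j) τ (detForm (p n)) =
      max ((1 - τ) * ‖u i‖ * ‖det₂ (p i) (p n)‖) (τ * ‖u j‖ * ‖det₂ (p j) (p n)‖) := by
  rw [pathNorm_eq hP, norm_det₂_comm (p i), norm_det₂_comm (p j)]
  rfl

include hP in
omit [IsUltrametricDist K] in
theorem pathNorm_detForm_left (i j : ι) (τ : unitInterval) :
    pathNorm (P i) (P j) τ (detForm (p i)) = τ * ‖u j‖ * ‖det₂ (p i) (p j)‖ := by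
  rw [pathNorm_eq hP, norm_detForm_self, mul_zero]
  exact max_eq_right (mul_nonneg (mul_nonneg τ.2.1 (norm_nonneg _)) (norm_nonneg _))

include hP in
omit [IsUltrametricDist K] in
theorem pathNorm_detForm_right (i j : ι) (τ : unitInterval) :
    pathNorm (P i) (P j) τ (detForm (p j)) = (1 - τ) * ‖u i‖ * ‖det₂ (p i) (p j)‖ := by
  rw [pathNorm_eq hP, norm_detForm_self, mul_zero, norm_det₂_comm]
  exact max_eq_left (mul_nonneg (mul_nonneg (sub_nonneg.mpr τ.2.2) (norm_nonneg _)) (norm_nonneg _))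

include hP in
omit [IsUltrametricDist K] in
theorem pathNorm_mul_norm_det₂ (i j : ι) (τ : unitInterval) (l : LinForm K) :
    pathNorm (P i) (P j) τ l * ‖det₂ (p i) (p j)‖ =
      max (‖l (p i)‖ * pathNorm (P i) (P j) τ (detForm (p j)))
        (‖l (p j)‖ * pathNorm (P i) (P j) τ (detForm (p i))) := by
  rw [pathNorm_detForm_left hP, pathNorm_detForm_right hP, pathNorm_eq hP,
    max_mul_of_nonneg _ _ (norm_nonneg _)]
  congr 1 <;> ring

include hP in
-- For the ends of the path itself this is the equality `pathNorm_mul_norm_det₂`. For another pair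
-- the ultrametric inequality is all that remains, and it is enough to compare two paths from both
-- sides.
theorem pathNorm_mul_norm_det₂_le (i j k m : ι) (τ : unitInterval) (l : LinForm K) :
    pathNorm (P i) (P j) τ l * ‖det₂ (p k) (p m)‖ ≤
      max (‖l (p k)‖ * pathNorm (P i) (P j) τ (detForm (p m)))
        (‖l (p m)‖ * pathNorm (P i) (P j) τ (detForm (p k))) := by
  have h1 : 0 ≤ (1 - τ : ℝ) * ‖u i‖ := mul_nonneg (sub_nonneg.mpr τ.2.2) (norm_nonneg _)
  have h2 : 0 ≤ (τ : ℝ) * ‖u j‖ := mul_nonneg τ.2.1 (norm_nonneg _)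
  have key : ∀ (c : ℝ) (n : ι), 0 ≤ c →
      (∀ m, c * ‖det₂ (p m) (p n)‖ ≤ pathNorm (P i) (P j) τ (detForm (p m))) →
      c * ‖l (p n)‖ * ‖det₂ (p k) (p m)‖ ≤
        max (‖l (p k)‖ * pathNorm (P i) (P j) τ (detForm (p m)))
        (‖l (p m)‖ * pathNorm (P i) (P j) τ (detForm (p k))) := by
    intro c n hc hle
    rw [mul_assoc]
    refine (mul_le_mul_of_nonneg_left (norm_apply_mul_le l _ _ _) hc).trans ?_
    rw [mul_max_of_nonneg _ _ hc, mul_left_comm, mul_left_comm c]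
    exact max_le_max (mul_le_mul_of_nonneg_left (hle m) (norm_nonneg _))
      (mul_le_mul_of_nonneg_left (hle k) (norm_nonneg _))
  rw [pathNorm_eq hP i j τ l, max_mul_of_nonneg _ _ (norm_nonneg _)]
  refine max_le (key _ i h1 fun m => ?_) (key _ j h2 fun m => ?_)
  · rw [pathNorm_eq hP]
    exact le_max_left _ _
  · rw [pathNorm_eq hP]
    exact le_max_right _ _

include hP hp in
/-- A point of a path is determined by its seminorm on the linear forms that vanish at one of the
given points. -/
theorem path_eq_path_iff_detForm {i j k m : ι} (hij : i ≠ j) (hkm : k ≠ m) {σ τ : unitInterval} :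
    path (P i) (P j) σ = path (P k) (P m) τ ↔ ∃ c : ℝ, 0 < c ∧ ∀ n,
      pathNorm (P i) (P j) σ (detForm (p n)) = c * pathNorm (P k) (P m) τ (detForm (p n)) := by
  rw [path_eq_path_iff]
  refine ⟨fun ⟨c, hc, h⟩ => ⟨c, hc, fun n => h _⟩, fun ⟨c, hc, h⟩ => ⟨c, hc, fun l => ?_⟩⟩
  apply le_antisymm
  · refine le_of_mul_le_mul_right ?_ (norm_pos_iff.mpr (hp k m hkm))
    refine (pathNorm_mul_norm_det₂_le hP i j k m σ l).trans ?_
    rw [mul_assoc, pathNorm_mul_norm_det₂ hP, h, h, mul_max_of_nonneg _ _ hc.le,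
      mul_left_comm c ‖l (p k)‖, mul_left_comm c ‖l (p m)‖]
  · refine le_of_mul_le_mul_right ?_ (norm_pos_iff.mpr (hp i j hij))
    rw [mul_assoc]
    refine (mul_le_mul_of_nonneg_left (pathNorm_mul_norm_det₂_le hP k m i j τ l) hc.le).trans ?_
    rw [pathNorm_mul_norm_det₂ hP, h, h, mul_max_of_nonneg _ _ hc.le,
      mul_left_comm c ‖l (p i)‖, mul_left_comm c ‖l (p j)‖]

include hP hu in
omit [IsUltrametricDist K] in
-- The converse of `liesBetween_pathNorm`: every nonzero nonnegative family satisfying the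
-- betweenness equations comes, up to a factor, from a point of the path.
theorem exists_pathNorm_position {x : ι → ℝ} (hx : ∀ i, 0 ≤ x i) {i j : ι}
    (hp : det₂ (p i) (p j) ≠ 0) (hx0 : ∃ k, x k ≠ 0)
    (h : LiesBetween (fun i j => ‖det₂ (p i) (p j)‖) x i j) :
    ∃ c : ℝ, 0 < c ∧ ∀ n,
      pathNorm (P i) (P j) (position (fun i => ‖u i‖) x i j) (detForm (p n)) = c * x n := by
  have hD : 0 < ‖det₂ (p i) (p j)‖ := norm_pos_iff.mpr hp
  have hw : ∀ i, 0 < ‖u i‖ := fun i => norm_pos_iff.mpr (hu i)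
  have hxij := h.pos_add hD hx hx0
  have hs : 0 < x i * ‖u i‖ + x j * ‖u j‖ := by
    rcases (hx i).lt_or_eq with h | h
    · exact add_pos_of_pos_of_nonneg (mul_pos h (hw i)) (mul_nonneg (hx j) (hw j).le)
    · rw [← h, zero_add] at hxij
      exact add_pos_of_nonneg_of_pos (mul_nonneg (hx i) (hw i).le) (mul_pos hxij (hw j))
  -- With S = xᵢ|uᵢ| + xⱼ|uⱼ|, both terms of the path seminorm acquire the factor |uᵢ||uⱼ|/S, and
  -- the betweenness equation turns the maximum into x n · D i j.
  refine ⟨‖u i‖ * ‖u j‖ / (x i * ‖u i‖ + x j * ‖u j‖) * ‖det₂ (p i) (p j)‖, ?_, fun n => ?_⟩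
  · exact mul_pos (div_pos (mul_pos (hw i) (hw j)) hs) hD
  · rw [mul_assoc, mul_comm ‖det₂ (p i) (p j)‖, h n,
      mul_max_of_nonneg _ _ (div_nonneg (mul_nonneg (hw i).le (hw j).le) hs.le),
      pathNorm_detForm hP, coe_position hw hx]
    congr 1
    · field_simp
      ring
    · field_simp

include hP in
omit [IsUltrametricDist K] in
theorem liesBetween_pathNorm (i j : ι) (τ : unitInterval) :
    LiesBetween (fun i j => ‖det₂ (p i) (p j)‖)
      (fun n => pathNorm (P i) (P j) τ (detForm (p n))) i j := by
  intro k
  change _ = max (_ * ‖det₂ (p i) (p k)‖) (_ * ‖det₂ (p j) (p k)‖)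
  rw [pathNorm_mul_norm_det₂ hP, mul_comm, mul_comm ‖_‖ (pathNorm _ _ _ (detForm (p i))),
    norm_det₂_comm (p i), norm_det₂_comm (p j)]
  rfl

include hP hu in
omit [IsUltrametricDist K] in
theorem position_pathNorm {i j : ι} (hp : det₂ (p i) (p j) ≠ 0) (τ : unitInterval) :
    position (fun i => ‖u i‖) (fun n => pathNorm (P i) (P j) τ (detForm (p n))) i j = τ := by
  have hD : 0 < ‖det₂ (p i) (p j)‖ := norm_pos_iff.mpr hp
  have hw : ∀ i, 0 < ‖u i‖ := fun i => norm_pos_iff.mpr (hu i)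
  ext
  rw [coe_position hw (fun n => ?_), pathNorm_detForm_left hP, pathNorm_detForm_right hP,
    div_eq_iff]
  · ring
  · have : τ * ‖u j‖ * ‖det₂ (p i) (p j)‖ * ‖u i‖ + (1 - τ) * ‖u i‖ * ‖det₂ (p i) (p j)‖ * ‖u j‖ =
        ‖u i‖ * ‖u j‖ * ‖det₂ (p i) (p j)‖ := by ring
    rw [this]
    exact (mul_pos (mul_pos (hw i) (hw j)) hD).ne'
  · rw [pathNorm_eq hP]
    exact le_max_of_le_left (mul_nonneg (mul_nonneg (sub_nonneg.mpr τ.2.2) (hw i).le)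
      (norm_nonneg _))

theorem LiesBetween.of_smul {D : ι → ι → ℝ} {x y : ι → ℝ} {i j : ι} {c : ℝ} (hc : 0 < c)
    (hxy : ∀ n, x n = c * y n) (h : LiesBetween D x i j) : LiesBetween D y i j := by
  intro k
  have := h k
  rw [hxy, hxy, hxy, mul_assoc, mul_assoc, mul_assoc, ← mul_max_of_nonneg _ _ hc.le] at this
  exact mul_left_cancel₀ hc.ne' this

theorem position_of_smul {w x y : ι → ℝ} {c : ℝ} (hc : 0 < c) (hxy : ∀ n, x n = c * y n) (i j : ι) :
    position w x i j = position w y i j := by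
  rw [position, position, hxy, hxy, mul_assoc, mul_assoc, ← mul_add, mul_div_mul_left _ _ hc.ne']

include hP hu hp in
/-- Description of the points of a path. -/
theorem path_eq_path_position_iff {x : ι → ℝ} (hx : ∀ i, 0 ≤ x i) (hx0 : ∃ k, x k ≠ 0) {i j k m : ι}
    (hij : i ≠ j) (hkm : k ≠ m) (h : LiesBetween (fun i j => ‖det₂ (p i) (p j)‖) x k m)
    {τ : unitInterval} :
    path (P i) (P j) τ = path (P k) (P m) (position (fun i => ‖u i‖) x k m) ↔
      LiesBetween (fun i j => ‖det₂ (p i) (p j)‖) x i j ∧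
        τ = position (fun i => ‖u i‖) x i j := by
  obtain ⟨c, hc, hcx⟩ := exists_pathNorm_position hP hu hx (hp k m hkm) hx0 h
  rw [path_eq_path_iff_detForm hP hp hij hkm]
  constructor
  · rintro ⟨d, hd, hdx⟩
    have hxy : ∀ n, pathNorm (P i) (P j) τ (detForm (p n)) = d * c * x n := fun n => by
      rw [hdx, hcx, mul_assoc]
    exact ⟨(liesBetween_pathNorm hP i j τ).of_smul (mul_pos hd hc) hxy,
      by rw [← position_of_smul (mul_pos hd hc) hxy, position_pathNorm hP hu (hp i j hij)]⟩
  · rintro ⟨h', rfl⟩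
    obtain ⟨d, hd, hdx⟩ := exists_pathNorm_position hP hu hx (hp i j hij) hx0 h'
    exact ⟨d / c, div_pos hd hc, fun n => by rw [hdx, hcx, ← mul_assoc, div_mul_cancel₀ _ hc.ne']⟩

end Paths

/-! ### From a table of values to the graph of the tree. -/

section TreeModel

variable {ι V : Type*}

/-- A combinatorial description of the tree spanned by points with mutual distances `D`: the
vertex `a` is given by the values `x a i` of its seminorm on the forms vanishing at the points. -/
structure IsTreeModel (D : ι → ι → ℝ) (x : V → ι → ℝ) : Prop where
  nonneg : ∀ a k, 0 ≤ x a k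
  ne_zero : ∀ a, ∃ k, x a k ≠ 0
  separated : ∀ a b, a ≠ b → ∃ i j, i ≠ j ∧ LiesBetween D (x a) i j ∧
    x a i * x b j ≠ x a j * x b i
  leaf : ∀ i, ∃ a j, i ≠ j ∧ LiesBetween D (x a) i j ∧ x a i = 0
  branch : ∀ i j k, i ≠ j → j ≠ k → i ≠ k →
    ∃ a, LiesBetween D (x a) i j ∧ x a i * D j k = x a j * D i k
  vertex : ∀ a, (∃ i j, i ≠ j ∧ LiesBetween D (x a) i j ∧ x a i = 0) ∨
    ∃ i j k, i ≠ j ∧ j ≠ k ∧ i ≠ k ∧ LiesBetween D (x a) i j ∧ LiesBetween D (x a) j k ∧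
      LiesBetween D (x a) i k ∧ x a i ≠ 0 ∧ x a j ≠ 0 ∧ x a k ≠ 0

/-- The vertex `b` follows the vertex `a` on some path. -/
def Follows (D : ι → ι → ℝ) (x : V → ι → ℝ) (a b : V) : Prop :=
  ∃ i j, i ≠ j ∧ LiesBetween D (x a) i j ∧ LiesBetween D (x b) i j ∧
    x a i * x b j < x a j * x b i ∧ ∀ c, LiesBetween D (x c) i j →
      ¬ (x a i * x c j < x a j * x c i ∧ x c i * x b j < x c j * x b i)

theorem liesBetween_mul_iff {D : ι → ι → ℝ} {δ : ℝ} (hδ : 0 < δ) {x : ι → ℝ} {i j : ι} :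
    LiesBetween (fun i j => δ * D i j) x i j ↔ LiesBetween D x i j := by
  refine forall_congr' fun k => ?_
  rw [mul_left_comm, mul_left_comm (x j), mul_left_comm (x i), ← mul_max_of_nonneg _ _ hδ.le]
  exact mul_right_inj' hδ.ne'

theorem IsTreeModel.mul {D : ι → ι → ℝ} {x : V → ι → ℝ} {δ : ℝ} (hδ : 0 < δ)
    (h : IsTreeModel D x) : IsTreeModel (fun i j => δ * D i j) x where
  nonneg := h.nonneg
  ne_zero := h.ne_zero
  separated := by simpa only [liesBetween_mul_iff hδ] using h.separated
  leaf := by simpa only [liesBetween_mul_iff hδ] using h.leaf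
  branch i j k h1 h2 h3 := by
    obtain ⟨a, ha, h⟩ := h.branch i j k h1 h2 h3
    exact ⟨a, (liesBetween_mul_iff hδ).mpr ha, by linear_combination δ * h⟩
  vertex := by simpa only [liesBetween_mul_iff hδ] using h.vertex

theorem follows_mul_iff {D : ι → ι → ℝ} {x : V → ι → ℝ} {δ : ℝ} (hδ : 0 < δ) {a b : V} :
    Follows (fun i j => δ * D i j) x a b ↔ Follows D x a b := by
  simp only [Follows, liesBetween_mul_iff hδ]

variable {K : Type*} [NontriviallyNormedField K] [IsUltrametricDist K]
  {P : ι → ℙ K (Fin 2 → K)} {p : ι → Fin 2 → K} {u : ι → K} {x : V → ι → ℝ}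

theorem path_zero (P Q : ℙ K (Fin 2 → K)) : path P Q 0 = classicalPoint P := by
  refine path_eq_path_iff.mpr ⟨1, one_pos, fun l => ?_⟩
  simp [pathNorm]

theorem position_eq_position {w x y : ι → ℝ} (hw : ∀ i, 0 < w i) (hx : ∀ i, 0 ≤ x i)
    (hy : ∀ i, 0 ≤ y i) {i j : ι} (hxij : 0 < x i + x j) (hyij : 0 < y i + y j)
    (h : x i * y j = x j * y i) : position w x i j = position w y i j := by
  apply le_antisymm
  · rw [← not_lt, position_lt_position_iff hw hy hx hyij hxij, not_lt]
    linarith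
  · rw [← not_lt, position_lt_position_iff hw hx hy hxij hyij, not_lt]
    linarith

theorem position_eq_zero {w x : ι → ℝ} {i : ι} (h : x i = 0) (j : ι) : position w x i j = 0 := by
  rw [position, h, zero_mul, zero_div]
  exact Set.projIcc_left _

theorem position_mem_Ioo {w x : ι → ℝ} (hw : ∀ i, 0 < w i) (hx : ∀ i, 0 ≤ x i) {i j : ι}
    (hi : x i ≠ 0) (hj : x j ≠ 0) : position w x i j ∈ Set.Ioo 0 1 := by
  have h1 : 0 < x i * w i := mul_pos (lt_of_le_of_ne (hx i) hi.symm) (hw i)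
  have h2 : 0 < x j * w j := mul_pos (lt_of_le_of_ne (hx j) hj.symm) (hw j)
  constructor
  · rw [← Subtype.coe_lt_coe, coe_position hw hx]
    exact div_pos h1 (by positivity)
  · rw [← Subtype.coe_lt_coe, coe_position hw hx]
    exact (div_lt_one (by positivity)).mpr (by linarith)

/-- Each betweenness relation yields one of the two inequalities. The resulting ratio determines the
position of a branch point on the path from i to j. -/
theorem proportional_of_liesBetween {D : ι → ι → ℝ} (hD : ∀ i j, D i j = D j i) {y : ι → ℝ}
    {i j k : ι} (h1 : LiesBetween D y j k) (h2 : LiesBetween D y i k) :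
    y i * D j k = y j * D i k := by
  have h1 := h1 i
  have h2 := h2 j
  rw [hD k i, hD j i] at h1
  rw [hD k j] at h2
  apply le_antisymm
  · rw [h2]
    exact le_max_right _ _
  · rw [h1]
    exact le_max_right _ _

variable (hP : ∀ i, (P i).rep = u i • p i) (hu : ∀ i, u i ≠ 0)
  (hp : ∀ i j, i ≠ j → det₂ (p i) (p j) ≠ 0)
  (hx : IsTreeModel (fun i j => ‖det₂ (p i) (p j)‖) x)
include hP hu hp

omit [IsUltrametricDist K] in
theorem injective_of_det₂_ne_zero : Function.Injective P := by
  intro i j hij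
  by_contra hne
  have h : u i • p i = u j • p j := by rw [← hP, ← hP, hij]
  have h1 : det₂ (u i • p i) (u j • p j) = 0 := by rw [h]; simp only [det₂]; ring
  rw [det₂_smul_smul] at h1
  exact mul_ne_zero (mul_ne_zero (hu i) (hu j)) (hp i j hne) h1

include hx

theorem IsTreeModel.exists_vertex :
    ∃ X : V → BerkovichLine K, ∀ a i j, i ≠ j → ∀ τ, path (P i) (P j) τ = X a ↔
      LiesBetween (fun i j => ‖det₂ (p i) (p j)‖) (x a) i j ∧
        τ = position (fun i => ‖u i‖) (x a) i j := by
  have hon : ∀ a, ∃ i j, i ≠ j ∧ LiesBetween (fun i j => ‖det₂ (p i) (p j)‖) (x a) i j := by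
    intro a
    rcases hx.vertex a with ⟨i, j, h, h', -⟩ | ⟨i, j, k, h, -, -, h', -⟩
    · exact ⟨i, j, h, h'⟩
    · exact ⟨i, j, h, h'⟩
  choose k m hkm hl using hon
  exact ⟨fun a => path (P (k a)) (P (m a)) (position (fun i => ‖u i‖) (x a) (k a) (m a)),
    fun a i j hij τ => path_eq_path_position_iff hP hu hp (hx.nonneg a) (hx.ne_zero a) hij (hkm a)
      (hl a)⟩

/-- The vertices are exactly the points of the model, and each is met on the path from i to j only
at its `position`. Adjacency thus translates into `Follows`. -/
theorem IsTreeModel.exists_equiv : ∃ e : V ≃ vertices (Set.range P), ∀ a b,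
    (treeGraph (Set.range P)).Adj (e a) (e b) ↔
      a ≠ b ∧ (Follows (fun i j => ‖det₂ (p i) (p j)‖) x a b ∨
        Follows (fun i j => ‖det₂ (p i) (p j)‖) x b a) := by
  obtain ⟨X, hX⟩ := hx.exists_vertex hP hu hp
  have hPinj := injective_of_det₂_ne_zero hP hu hp
  have hw : ∀ i, 0 < ‖u i‖ := fun i => norm_pos_iff.mpr (hu i)
  have hD : ∀ i j, i ≠ j → 0 < ‖det₂ (p i) (p j)‖ := fun i j h => norm_pos_iff.mpr (hp i j h)
  have hadd : ∀ {a i j}, i ≠ j → LiesBetween (fun i j => ‖det₂ (p i) (p j)‖) (x a) i j →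
      0 < x a i + x a j := fun hij h => h.pos_add (hD _ _ hij) (hx.nonneg _) (hx.ne_zero _)
  have hlt : ∀ {a b i j}, i ≠ j → LiesBetween (fun i j => ‖det₂ (p i) (p j)‖) (x a) i j →
      LiesBetween (fun i j => ‖det₂ (p i) (p j)‖) (x b) i j →
      (position (fun i => ‖u i‖) (x a) i j < position (fun i => ‖u i‖) (x b) i j ↔
        x a i * x b j < x a j * x b i) := fun hij ha hb =>
    position_lt_position_iff hw (hx.nonneg _) (hx.nonneg _) (hadd hij ha) (hadd hij hb)
  have hinj : Function.Injective X := by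
    intro a b hab
    by_contra hne
    obtain ⟨i, j, hij, ha, h⟩ := hx.separated a b hne
    have h1 := (hX a i j hij _).mpr ⟨ha, rfl⟩
    rw [hab] at h1
    obtain ⟨hb, hpos⟩ := (hX b i j hij _).mp h1
    rcases h.lt_or_gt with h | h
    · exact ((hlt hij ha hb).mpr h).ne hpos
    · refine ((hlt hij hb ha).mpr ?_).ne hpos.symm
      linarith
  have hrange : vertices (Set.range P) = Set.range X := by
    ext ξ
    constructor
    · rintro (⟨_, ⟨i, rfl⟩, rfl⟩ | ⟨_, ⟨i, rfl⟩, _, ⟨j, rfl⟩, _, ⟨k, rfl⟩, h1, h2, h3,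
        ⟨τ, -, h4⟩, ⟨τ', -, h5⟩, ⟨τ'', -, h6⟩⟩)
      · obtain ⟨a, j, hij, ha, h0⟩ := hx.leaf i
        refine ⟨a, ?_⟩
        rw [← path_zero _ (P j), eq_comm, hX a i j hij]
        exact ⟨ha, (position_eq_zero h0 j).symm⟩
      · have hij := hPinj.ne_iff.mp h1
        have hjk := hPinj.ne_iff.mp h2
        have hik := hPinj.ne_iff.mp h3
        obtain ⟨a, ha, hak⟩ := hx.branch i j k hij hjk hik
        refine ⟨a, ?_⟩
        rw [← h4, eq_comm, hX a i j hij]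
        refine ⟨ha, ?_⟩
        have hy := liesBetween_pathNorm hP i j τ
        have hy2 : LiesBetween (fun i j => ‖det₂ (p i) (p j)‖)
            (fun n => pathNorm (P i) (P j) τ (detForm (p n))) j k := by
          obtain ⟨c, hc, h⟩ := (path_eq_path_iff_detForm hP hp hjk hij).mp (h5.trans h4.symm)
          exact (liesBetween_pathNorm hP j k τ').of_smul hc h
        have hy3 : LiesBetween (fun i j => ‖det₂ (p i) (p j)‖)
            (fun n => pathNorm (P i) (P j) τ (detForm (p n))) i k := by
          obtain ⟨c, hc, h⟩ := (path_eq_path_iff_detForm hP hp hik hij).mp (h6.trans h4.symm)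
          exact (liesBetween_pathNorm hP i k τ'').of_smul hc h
        -- The actual branch point and the vertex provided by `branch` have the same ratio of values
        -- at i and j, so they coincide on the path.
        have hyk := proportional_of_liesBetween (fun _ _ => norm_det₂_comm _ _) hy2 hy3
        rw [← position_pathNorm hP hu (hp i j hij) τ]
        have hnn : ∀ n, 0 ≤ pathNorm (P i) (P j) τ (detForm (p n)) := fun n =>
          le_max_of_le_left (mul_nonneg (sub_nonneg.mpr τ.2.2) (norm_nonneg _))
        have hy0 : ∃ n, pathNorm (P i) (P j) τ (detForm (p n)) ≠ 0 := by
          by_cases h0 : (τ : ℝ) = 0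
          · refine ⟨j, ?_⟩
            rw [pathNorm_detForm_right hP, h0, sub_zero, one_mul]
            exact (mul_pos (hw i) (hD i j hij)).ne'
          · refine ⟨i, ?_⟩
            rw [pathNorm_detForm_left hP]
            exact mul_ne_zero (mul_ne_zero h0 (hw j).ne') (hD i j hij).ne'
        refine position_eq_position hw hnn (hx.nonneg a) (hy.pos_add (hD i j hij) hnn hy0)
          (hadd hij ha) ?_
        refine mul_right_cancel₀ (mul_pos (hD j k hjk) (hD i k hik)).ne' ?_
        linear_combination (x a j * ‖det₂ (p i) (p k)‖) * hyk -
          (pathNorm (P i) (P j) τ (detForm (p j)) * ‖det₂ (p i) (p k)‖) * hak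
    · rintro ⟨a, rfl⟩
      rcases hx.vertex a with ⟨i, j, hij, ha, h0⟩ | ⟨i, j, k, hij, hjk, hik, h1, h2, h3, hi, hj, hk⟩
      · left
        refine ⟨P i, ⟨i, rfl⟩, ?_⟩
        rw [← path_zero _ (P j), hX a i j hij]
        exact ⟨ha, (position_eq_zero h0 j).symm⟩
      · right
        exact ⟨P i, ⟨i, rfl⟩, P j, ⟨j, rfl⟩, P k, ⟨k, rfl⟩, hPinj.ne hij, hPinj.ne hjk, hPinj.ne hik,
          ⟨_, position_mem_Ioo hw (hx.nonneg a) hi hj, (hX a i j hij _).mpr ⟨h1, rfl⟩⟩,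
          ⟨_, position_mem_Ioo hw (hx.nonneg a) hj hk, (hX a j k hjk _).mpr ⟨h2, rfl⟩⟩,
          ⟨_, position_mem_Ioo hw (hx.nonneg a) hi hk, (hX a i k hik _).mpr ⟨h3, rfl⟩⟩⟩
  have hfollows : ∀ a b, (∃ Q ∈ Set.range P, ∃ R ∈ Set.range P, Q ≠ R ∧ ∃ σ τ : unitInterval,
      σ < τ ∧ path Q R σ = X a ∧ path Q R τ = X b ∧
        ∀ ρ ∈ Set.Ioo σ τ, path Q R ρ ∉ vertices (Set.range P)) ↔
      Follows (fun i j => ‖det₂ (p i) (p j)‖) x a b := by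
    intro a b
    constructor
    · rintro ⟨_, ⟨i, rfl⟩, _, ⟨j, rfl⟩, hne, σ, τ, hστ, hσ, hτ, hno⟩
      have hij := hPinj.ne_iff.mp hne
      obtain ⟨ha, rfl⟩ := (hX a i j hij σ).mp hσ
      obtain ⟨hb, rfl⟩ := (hX b i j hij τ).mp hτ
      refine ⟨i, j, hij, ha, hb, (hlt hij ha hb).mp hστ, fun c hc ⟨h1, h2⟩ => ?_⟩
      refine hno (position (fun i => ‖u i‖) (x c) i j)
        ⟨(hlt hij ha hc).mpr h1, (hlt hij hc hb).mpr h2⟩ ?_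
      rw [hrange]
      exact ⟨c, ((hX c i j hij _).mpr ⟨hc, rfl⟩).symm⟩
    · rintro ⟨i, j, hij, ha, hb, hab, hno⟩
      refine ⟨_, ⟨i, rfl⟩, _, ⟨j, rfl⟩, hPinj.ne hij, _, _, (hlt hij ha hb).mpr hab,
        (hX a i j hij _).mpr ⟨ha, rfl⟩, (hX b i j hij _).mpr ⟨hb, rfl⟩, fun ρ hρ hmem => ?_⟩
      rw [hrange] at hmem
      obtain ⟨c, hc⟩ := hmem
      obtain ⟨hlc, rfl⟩ := (hX c i j hij ρ).mp hc.symm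
      exact hno c hlc ⟨(hlt hij ha hlc).mp hρ.1, (hlt hij hlc hb).mp hρ.2⟩
  refine ⟨(Equiv.ofInjective X hinj).trans (Equiv.setCongr hrange.symm), fun a b => ?_⟩
  rw [treeGraph, SimpleGraph.fromRel_adj]
  refine and_congr (Equiv.apply_eq_iff_eq _).not (or_congr (hfollows a b) (hfollows b a))

end TreeModel

/-! ### Decidable models with symbolic distances. -/

section SymbolicModels

/-- Zero and the monomials in two symbols standing for real numbers between `0` and `1`. -/
abbrev Symbolic : Type := Option (ℕ × ℕ)

namespace Symbolic

/-- The value of a symbolic expression. -/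
def value (r s : ℝ) : Symbolic → ℝ
  | none => 0
  | some (m, n) => r ^ m * s ^ n

/-- The product of symbolic expressions. -/
def mul : Symbolic → Symbolic → Symbolic
  | some (m, n), some (m', n') => some (m + m', n + n')
  | _, _ => none

/-- A symbolic inequality that holds for all values of the symbols between `0` and `1`. -/
def lt : Symbolic → Symbolic → Bool
  | none, some _ => true
  | some (m, n), some (m', n') => decide (m' ≤ m ∧ n' ≤ n ∧ (m' < m ∨ n' < n))
  | _, none => false

variable {r s : ℝ}

theorem value_mul (x y : Symbolic) : value r s (mul x y) = value r s x * value r s y := by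
  rcases x with _ | ⟨m, n⟩ <;> rcases y with _ | ⟨m', n'⟩ <;> simp [mul, value]
  ring

variable (hr : 0 < r) (hr' : r < 1) (hs : 0 < s) (hs' : s < 1)

include hr hs in
theorem value_nonneg (x : Symbolic) : 0 ≤ value r s x := by
  rcases x with _ | ⟨m, n⟩
  · exact le_rfl
  · exact (mul_pos (pow_pos hr _) (pow_pos hs _)).le

include hr hs in
theorem value_ne_zero {x : Symbolic} (hx : x ≠ none) : value r s x ≠ 0 := by
  rcases x with _ | ⟨m, n⟩
  · exact absurd rfl hx
  · exact (mul_pos (pow_pos hr _) (pow_pos hs _)).ne'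

include hr hr' hs hs'

theorem value_lt {x y : Symbolic} (h : lt x y = true) : value r s x < value r s y := by
  rcases x with _ | ⟨m, n⟩ <;> rcases y with _ | ⟨m', n'⟩ <;> simp only [lt] at h
  · exact absurd h (by decide)
  · exact mul_pos (pow_pos hr _) (pow_pos hs _)
  · exact absurd h (by decide)
  · obtain ⟨h1, h2, h3⟩ := of_decide_eq_true h
    rcases h3 with h3 | h3
    · exact mul_lt_mul (pow_lt_pow_right_of_lt_one₀ hr hr' h3)
        (pow_le_pow_of_le_one hs.le hs'.le h2) (pow_pos hs _) (pow_pos hr _).le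
    · exact mul_lt_mul' (pow_le_pow_of_le_one hr.le hr'.le h1)
        (pow_lt_pow_right_of_lt_one₀ hs hs' h3) (pow_pos hs _).le (pow_pos hr _)

end Symbolic

open Symbolic

variable {n : ℕ} (D : Fin 5 → Fin 5 → Symbolic) (x : Fin n → Fin 5 → Symbolic)

/-- Symbolic version of `LiesBetween`. -/
def symLiesBetween (y : Fin 5 → Symbolic) (i j : Fin 5) : Bool :=
  decide (∀ k, (mul (y k) (D i j) = mul (y j) (D i k) ∧
      (mul (y i) (D j k) = mul (y k) (D i j) ∨ lt (mul (y i) (D j k)) (mul (y k) (D i j)))) ∨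
    (mul (y k) (D i j) = mul (y i) (D j k) ∧
      (mul (y j) (D i k) = mul (y k) (D i j) ∨ lt (mul (y j) (D i k)) (mul (y k) (D i j)))))

/-- A symbolic inequality that violates `LiesBetween`. -/
def symNotBetween (y : Fin 5 → Symbolic) (i j : Fin 5) : Bool :=
  decide (∃ k, lt (mul (y k) (D i j)) (mul (y j) (D i k)) ∨
    lt (mul (y k) (D i j)) (mul (y i) (D j k)))

/-- Symbolic comparison of positions on a path. -/
def symBefore (y z : Fin 5 → Symbolic) (i j : Fin 5) : Bool :=
  lt (mul (y i) (z j)) (mul (y j) (z i))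

/-- Symbolic version of `Follows`. -/
def symFollows (a b : Fin n) : Bool :=
  decide (∃ i j, i ≠ j ∧ symLiesBetween D (x a) i j ∧ symLiesBetween D (x b) i j ∧
    symBefore (x a) (x b) i j ∧ ∀ c, symLiesBetween D (x c) i j →
      ¬ (symBefore (x a) (x c) i j ∧ symBefore (x c) (x b) i j))

/-- A symbolic tree model. -/
structure IsSymbolicModel : Prop where
  between : ∀ a i j, i ≠ j → symLiesBetween D (x a) i j ∨ symNotBetween D (x a) i j
  compare : ∀ a b i j, i ≠ j → symLiesBetween D (x a) i j → symLiesBetween D (x b) i j →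
    symBefore (x a) (x b) i j ∨ mul (x a i) (x b j) = mul (x a j) (x b i) ∨
      symBefore (x b) (x a) i j
  ne_zero : ∀ a, ∃ k, x a k ≠ none
  separated : ∀ a b, a ≠ b → ∃ i j, i ≠ j ∧ symLiesBetween D (x a) i j ∧
    (symBefore (x a) (x b) i j ∨ symBefore (x b) (x a) i j)
  leaf : ∀ i, ∃ a j, i ≠ j ∧ symLiesBetween D (x a) i j ∧ x a i = none
  branch : ∀ i j k, i ≠ j ∧ j ≠ k ∧ i ≠ k →
    ∃ a, symLiesBetween D (x a) i j ∧ mul (x a i) (D j k) = mul (x a j) (D i k)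
  vertex : ∀ a, (∃ i j, i ≠ j ∧ symLiesBetween D (x a) i j ∧ x a i = none) ∨
    ∃ i j k, i ≠ j ∧ j ≠ k ∧ i ≠ k ∧ symLiesBetween D (x a) i j ∧ symLiesBetween D (x a) j k ∧
      symLiesBetween D (x a) i k ∧ x a i ≠ none ∧ x a j ≠ none ∧ x a k ≠ none

variable {D x} {r s : ℝ} (hr : 0 < r) (hr' : r < 1) (hs : 0 < s) (hs' : s < 1)
include hr hr' hs hs'

theorem liesBetween_of_symLiesBetween {y : Fin 5 → Symbolic} {i j : Fin 5}
    (h : symLiesBetween D y i j) :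
    LiesBetween (fun i j => value r s (D i j)) (fun k => value r s (y k)) i j := by
  intro k
  have h := of_decide_eq_true h k
  have key : ∀ {A B : Symbolic}, (A = B ∨ lt A B) → value r s A ≤ value r s B := by
    rintro A B (rfl | h)
    · exact le_rfl
    · exact (value_lt hr hr' hs hs' h).le
  simp only [← value_mul]
  rcases h with ⟨h1, h2⟩ | ⟨h1, h2⟩
  · rw [max_eq_left (h1 ▸ key h2), h1]
  · rw [max_eq_right (h1 ▸ key h2), h1]

theorem not_liesBetween_of_symNotBetween {y : Fin 5 → Symbolic} {i j : Fin 5}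
    (h : symNotBetween D y i j) :
    ¬ LiesBetween (fun i j => value r s (D i j)) (fun k => value r s (y k)) i j := by
  intro h'
  obtain ⟨k, h⟩ := of_decide_eq_true h
  have h' := h' k
  simp only [← value_mul] at h'
  rcases h with h | h
  · exact (value_lt hr hr' hs hs' h).not_ge (h' ▸ le_max_left _ _)
  · exact (value_lt hr hr' hs hs' h).not_ge (h' ▸ le_max_right _ _)

theorem lt_of_symBefore {y z : Fin 5 → Symbolic} {i j : Fin 5} (h : symBefore y z i j) :
    value r s (y i) * value r s (z j) < value r s (y j) * value r s (z i) := by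
  rw [← value_mul, ← value_mul]
  exact value_lt hr hr' hs hs' h

variable (h : IsSymbolicModel D x)
include h

namespace IsSymbolicModel

/-- Symbolic comparison certifies only inequalities valid for all values of the symbols. The field
`between` guarantees that betweenness or its failure is always certified, so the symbolic test is
also necessary. -/
theorem liesBetween_iff (a : Fin n) {i j : Fin 5} (hij : i ≠ j) :
    LiesBetween (fun i j => value r s (D i j)) (fun k => value r s (x a k)) i j ↔
      symLiesBetween D (x a) i j := by
  refine ⟨fun h' => (h.between a i j hij).resolve_right fun h'' => ?_,
    liesBetween_of_symLiesBetween hr hr' hs hs'⟩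
  exact not_liesBetween_of_symNotBetween hr hr' hs hs' h'' h'

theorem lt_iff {a b : Fin n} {i j : Fin 5} (hij : i ≠ j) (ha : symLiesBetween D (x a) i j)
    (hb : symLiesBetween D (x b) i j) :
    value r s (x a i) * value r s (x b j) < value r s (x a j) * value r s (x b i) ↔
      symBefore (x a) (x b) i j := by
  refine ⟨fun hlt => ?_, lt_of_symBefore hr hr' hs hs'⟩
  rcases h.compare a b i j hij ha hb with h1 | h1 | h1
  · exact h1
  · rw [← value_mul, ← value_mul, h1] at hlt
    exact absurd hlt (lt_irrefl _)
  · have := lt_of_symBefore hr hr' hs hs' h1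
    linarith

theorem isTreeModel :
    IsTreeModel (fun i j => value r s (D i j)) (fun a k => value r s (x a k)) where
  nonneg _ _ := value_nonneg hr hs _
  ne_zero a := (h.ne_zero a).imp fun _ hk => value_ne_zero hr hs hk
  separated a b hab := by
    obtain ⟨i, j, hij, h1, h2⟩ := h.separated a b hab
    refine ⟨i, j, hij, liesBetween_of_symLiesBetween hr hr' hs hs' h1, ?_⟩
    rcases h2 with h2 | h2
    · exact (lt_of_symBefore hr hr' hs hs' h2).ne
    · have := lt_of_symBefore hr hr' hs hs' h2
      intro h3
      linarith
  leaf i := by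
    obtain ⟨a, j, hij, h1, h2⟩ := h.leaf i
    exact ⟨a, j, hij, liesBetween_of_symLiesBetween hr hr' hs hs' h1, by rw [h2]; rfl⟩
  branch i j k h1 h2 h3 := by
    obtain ⟨a, h4, h5⟩ := h.branch i j k ⟨h1, h2, h3⟩
    exact ⟨a, liesBetween_of_symLiesBetween hr hr' hs hs' h4, by
      rw [← value_mul, h5, value_mul]⟩
  vertex a := by
    rcases h.vertex a with ⟨i, j, hij, h1, h2⟩ | ⟨i, j, k, hij, hjk, hik, h1, h2, h3, h4, h5, h6⟩
    · exact .inl ⟨i, j, hij, liesBetween_of_symLiesBetween hr hr' hs hs' h1, by rw [h2]; rfl⟩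
    · exact .inr ⟨i, j, k, hij, hjk, hik, liesBetween_of_symLiesBetween hr hr' hs hs' h1,
        liesBetween_of_symLiesBetween hr hr' hs hs' h2,
        liesBetween_of_symLiesBetween hr hr' hs hs' h3,
        value_ne_zero hr hs h4, value_ne_zero hr hs h5, value_ne_zero hr hs h6⟩

theorem follows_iff {a b : Fin n} :
    Follows (fun i j => value r s (D i j)) (fun a k => value r s (x a k)) a b ↔
      symFollows D x a b := by
  rw [symFollows, decide_eq_true_iff]
  refine exists_congr fun i => exists_congr fun j => and_congr_right fun hij => ?_
  rw [h.liesBetween_iff hr hr' hs hs' a hij, h.liesBetween_iff hr hr' hs hs' b hij]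
  refine and_congr_right fun ha => and_congr_right fun hb => ?_
  rw [h.lt_iff hr hr' hs hs' hij ha hb]
  refine and_congr_right fun _ => forall_congr' fun c => ?_
  rw [h.liesBetween_iff hr hr' hs hs' c hij]
  refine imp_congr_right fun hc => ?_
  rw [h.lt_iff hr hr' hs hs' hij ha hc, h.lt_iff hr hr' hs hs' hij hc hb]

end IsSymbolicModel

end SymbolicModels

/-! ### The tables of the three types. -/

section Tables

/-- The distances of five points such that `{0, 1}` and `{2, 3}` have distances `ρ` and `σ` and all
other pairs have distance `1`. -/
def cherryDistances (ρ σ : Symbolic) : Fin 5 → Fin 5 → Symbolic :=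
  ![![none, ρ, some 0, some 0, some 0], ![ρ, none, some 0, some 0, some 0],
    ![some 0, some 0, none, σ, some 0], ![some 0, some 0, σ, none, some 0],
    ![some 0, some 0, some 0, some 0, none]]

/-- The vertices of the tree of Type I. -/
def verticesTypeI : Fin 6 → Fin 5 → Symbolic :=
  ![fun _ => some 0, cherryDistances (some 0) (some 0) 0, cherryDistances (some 0) (some 0) 1,
    cherryDistances (some 0) (some 0) 2, cherryDistances (some 0) (some 0) 3,
    cherryDistances (some 0) (some 0) 4]

/-- The vertices of the tree of Type II. -/
def verticesTypeII : Fin 7 → Fin 5 → Symbolic :=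
  ![![some (1, 0), some (1, 0), some 0, some 0, some 0], fun _ => some 0,
    cherryDistances (some (1, 0)) (some 0) 0, cherryDistances (some (1, 0)) (some 0) 1,
    cherryDistances (some (1, 0)) (some 0) 2, cherryDistances (some (1, 0)) (some 0) 3,
    cherryDistances (some (1, 0)) (some 0) 4]

/-- The vertices of the tree of Type III. -/
def verticesTypeIII : Fin 8 → Fin 5 → Symbolic :=
  ![![some (1, 0), some (1, 0), some 0, some 0, some 0], fun _ => some 0,
    ![some 0, some 0, some (0, 1), some (0, 1), some 0],
    cherryDistances (some (1, 0)) (some (0, 1)) 0, cherryDistances (some (1, 0)) (some (0, 1)) 1,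
    cherryDistances (some (1, 0)) (some (0, 1)) 4, cherryDistances (some (1, 0)) (some (0, 1)) 2,
    cherryDistances (some (1, 0)) (some (0, 1)) 3]

theorem isSymbolicModel_typeI :
    IsSymbolicModel (cherryDistances (some 0) (some 0)) verticesTypeI := by
  constructor <;> decide +kernel

theorem isSymbolicModel_typeII :
    IsSymbolicModel (cherryDistances (some (1, 0)) (some 0)) verticesTypeII := by
  constructor <;> decide +kernel

theorem isSymbolicModel_typeIII :
    IsSymbolicModel (cherryDistances (some (1, 0)) (some (0, 1))) verticesTypeIII := by
  constructor <;> decide +kernel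

/-- The tables list the vertices in the order of the labels of the graphs, so adjacency can be
compared label by label; likewise for the other two types. -/
theorem typeI_adj_iff (a b : Fin 6) : typeI.Adj a b ↔
    a ≠ b ∧ (symFollows (cherryDistances (some 0) (some 0)) verticesTypeI a b ∨
      symFollows (cherryDistances (some 0) (some 0)) verticesTypeI b a) := by
  simp only [typeI, SimpleGraph.fromEdgeSet_adj, Set.mem_insert_iff, Set.mem_singleton_iff]
  revert a b
  decide +kernel

theorem typeII_adj_iff (a b : Fin 7) : typeII.Adj a b ↔
    a ≠ b ∧ (symFollows (cherryDistances (some (1, 0)) (some 0)) verticesTypeII a b ∨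
      symFollows (cherryDistances (some (1, 0)) (some 0)) verticesTypeII b a) := by
  simp only [typeII, SimpleGraph.fromEdgeSet_adj, Set.mem_insert_iff, Set.mem_singleton_iff]
  revert a b
  decide +kernel

theorem typeIII_adj_iff (a b : Fin 8) : typeIII.Adj a b ↔
    a ≠ b ∧ (symFollows (cherryDistances (some (1, 0)) (some (0, 1))) verticesTypeIII a b ∨
      symFollows (cherryDistances (some (1, 0)) (some (0, 1))) verticesTypeIII b a) := by
  simp only [typeIII, SimpleGraph.fromEdgeSet_adj, Set.mem_insert_iff, Set.mem_singleton_iff]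
  revert a b
  decide +kernel

end Tables

/-! ### The tree of a normalized quintic. -/

section TreeTypes

open MvPolynomial

theorem Symbolic.value_some_zero (r s : ℝ) : Symbolic.value r s (some 0) = 1 := by
  change r ^ 0 * s ^ 0 = 1
  simp

theorem exists_smul_eq_of_det₂_eq_zero {F : Type*} [Field F] {v w : Fin 2 → F} (hv : v ≠ 0)
    (h : det₂ v w = 0) : ∃ c : F, c • v = w := by
  have h' : v 0 * w 1 = v 1 * w 0 := sub_eq_zero.mp h
  by_cases h0 : v 0 = 0
  · have h1 : v 1 ≠ 0 := fun h1 => hv (by ext i; fin_cases i <;> assumption)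
    refine ⟨w 1 / v 1, ?_⟩
    have hw : w 0 = 0 := by
      rw [h0, zero_mul] at h'
      exact (mul_eq_zero.mp h'.symm).resolve_left h1
    ext i
    fin_cases i
    · simp [h0, hw]
    · simp [h1]
  · refine ⟨w 0 / v 0, ?_⟩
    ext i
    fin_cases i
    · simp [h0]
    · simp only [Fin.mk_one, Pi.smul_apply, smul_eq_mul]
      field_simp
      linear_combination -h'

variable {F : Type*} [Field F]

theorem eval_quintic (a : Fin 6 → F) (v : Fin 2 → F) :
    eval v (quintic a) = ∑ i : Fin 6, a i * v 0 ^ (5 - (i : ℕ)) * v 1 ^ (i : ℕ) := by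
  simp [quintic]

theorem eval_rootForm (p : Fin 5 → Fin 2 → F) (v : Fin 2 → F) :
    eval v (rootForm p) = ∏ i, -det₂ (p i) v := by
  simp only [rootForm, map_prod]
  refine Finset.prod_congr rfl fun i _ => ?_
  simp [det₂]

theorem zeros_eq_range {a : Fin 6 → F} {c : F} {p : Fin 5 → Fin 2 → F} (hc : c ≠ 0)
    (hp : ∀ i, p i ≠ 0) (h : quintic a = C c * rootForm p) :
    zeros a = Set.range fun i => Projectivization.mk F (p i) (hp i) := by
  ext R
  have hR : R ∈ zeros a ↔ ∃ i, det₂ (p i) R.rep = 0 := by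
    change ∑ i : Fin 6, a i * R.rep 0 ^ (5 - (i : ℕ)) * R.rep 1 ^ (i : ℕ) = 0 ↔ _
    rw [← eval_quintic, h, map_mul, eval_C, eval_rootForm, mul_eq_zero, or_iff_right hc,
      Finset.prod_eq_zero_iff]
    simp
  rw [hR]
  refine exists_congr fun i => ⟨fun hi => ?_, fun hi => ?_⟩
  · obtain ⟨d, hd⟩ := exists_smul_eq_of_det₂_eq_zero (hp i) hi
    change Projectivization.mk F (p i) (hp i) = R
    rw [← R.mk_rep, eq_comm, Projectivization.mk_eq_mk_iff']
    exact ⟨d, hd⟩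
  · obtain ⟨d, hd⟩ := Projectivization.exists_smul_eq_mk_rep F (p i) (hp i)
    rw [← hi]
    change det₂ (p i) (Projectivization.mk F (p i) (hp i)).rep = 0
    rw [← hd, Units.smul_def]
    simp only [det₂, Pi.smul_apply, smul_eq_mul]
    ring

variable {K : Type*} [NontriviallyNormedField K] [IsUltrametricDist K]

/-- The tree of a form whose zeros have the distances of a symbolic model. -/
theorem IsSymbolicModel.hasTreeType {n : ℕ} {T : SimpleGraph (Fin n)}
    {D : Fin 5 → Fin 5 → Symbolic} {x : Fin n → Fin 5 → Symbolic} (h : IsSymbolicModel D x)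
    (hT : ∀ a b, T.Adj a b ↔ a ≠ b ∧ (symFollows D x a b ∨ symFollows D x b a)) {r s : ℝ}
    (hr : 0 < r) (hr' : r < 1) (hs : 0 < s) (hs' : s < 1) {a : Fin 6 → K} {c : K}
    {p : Fin 5 → Fin 2 → K} (hc : c ≠ 0) (ha : quintic a = C c * rootForm p)
    (hp : ∀ i j, i ≠ j → det₂ (p i) (p j) ≠ 0) {g : Matrix (Fin 2) (Fin 2) K} {u : Fin 5 → K}
    {q : Fin 5 → Fin 2 → K} (hg : g.det ≠ 0) (hu : ∀ i, u i ≠ 0)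
    (hpq : ∀ i, p i = u i • g.mulVec (q i))
    (hq : ∀ i j, ‖det₂ (q i) (q j)‖ = Symbolic.value r s (D i j)) : HasTreeType a T := by
  have hp0 : ∀ i, p i ≠ 0 := by
    intro i hi
    obtain ⟨j, hij⟩ := exists_ne i
    refine hp i j hij.symm ?_
    rw [hi]
    simp [det₂]
  have hrep : ∀ i, ∃ v : K, v ≠ 0 ∧
      (Projectivization.mk K (p i) (hp0 i)).rep = v • g.mulVec (q i) := by
    intro i
    obtain ⟨d, hd⟩ := Projectivization.exists_smul_eq_mk_rep K (p i) (hp0 i)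
    refine ⟨d * u i, mul_ne_zero d.ne_zero (hu i), ?_⟩
    rw [← hd, hpq i, Units.smul_def, smul_smul]
  choose v hv hrep using hrep
  -- The coordinate change multiplies all distances by |det g|, which affects neither the model nor
  -- adjacency. The factors of the individual vectors go into the representatives.
  have hD : (fun i j => ‖det₂ (g.mulVec (q i)) (g.mulVec (q j))‖) =
      fun i j => ‖g.det‖ * Symbolic.value r s (D i j) := by
    ext i j
    rw [det₂_mulVec, norm_mul, hq]
  have hdet : ∀ i j, i ≠ j → det₂ (g.mulVec (q i)) (g.mulVec (q j)) ≠ 0 := by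
    intro i j hij h0
    refine hp i j hij ?_
    rw [hpq, hpq, det₂_smul_smul, h0, mul_zero]
  have hgn : 0 < ‖g.det‖ := norm_pos_iff.mpr hg
  have hmodel := (h.isTreeModel hr hr' hs hs').mul hgn
  rw [← hD] at hmodel
  obtain ⟨e, he⟩ := hmodel.exists_equiv (P := fun i => Projectivization.mk K (p i) (hp0 i)) hrep hv
    hdet
  rw [HasTreeType, zeros_eq_range hc hp0 ha]
  refine ⟨⟨e.symm, fun {x y} => ?_⟩⟩
  obtain ⟨b, rfl⟩ := e.surjective x
  obtain ⟨b', rfl⟩ := e.surjective y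
  rw [he, Equiv.symm_apply_apply, Equiv.symm_apply_apply, hT, hD, follows_mul_iff hgn,
    follows_mul_iff hgn, h.follows_iff hr hr' hs hs', h.follows_iff hr hr' hs hs']

/-- Types I, II and III have 6, 7 and 8 vertices, so counting makes them mutually exclusive. -/
theorem HasTreeType.card_eq {a : Fin 6 → K} {m n : ℕ} {T : SimpleGraph (Fin m)}
    {T' : SimpleGraph (Fin n)} (h : HasTreeType a T) (h' : HasTreeType a T') : m = n := by
  obtain ⟨e⟩ := h
  obtain ⟨e'⟩ := h'
  simpa using Fintype.card_congr (e.toEquiv.symm.trans e'.toEquiv)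

omit [IsUltrametricDist K] in
theorem IsNormalized.norm_det₂_eq {q : Fin 5 → Fin 2 → K} (hq : IsNormalized q) {r s : ℝ}
    {ρ σ : Symbolic} (h01 : ‖det₂ (q 0) (q 1)‖ = Symbolic.value r s ρ)
    (h23 : ‖det₂ (q 2) (q 3)‖ = Symbolic.value r s σ) (i j : Fin 5) :
    ‖det₂ (q i) (q j)‖ = Symbolic.value r s (cherryDistances ρ σ i j) := by
  have hself : ∀ i, ‖det₂ (q i) (q i)‖ = Symbolic.value r s none := fun i => by
    rw [show det₂ (q i) (q i) = 0 by simp only [det₂]; ring, norm_zero]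
    rfl
  have h1 : ∀ {x : ℝ}, x = 1 → x = Symbolic.value r s (some 0) := fun h => by
    rw [h, Symbolic.value_some_zero]
  have hlt : ∀ i j, i < j →
      ‖det₂ (q i) (q j)‖ = Symbolic.value r s (cherryDistances ρ σ i j) := by
    intro i j hij
    fin_cases i <;> fin_cases j <;> first
      | exact absurd hij (by decide)
      | exact h01
      | exact h23
      | exact h1 hq.d02
      | exact h1 hq.d03
      | exact h1 hq.d04
      | exact h1 hq.d12
      | exact h1 hq.d13
      | exact h1 hq.d14
      | exact h1 hq.d24
      | exact h1 hq.d34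
  have hsymm : cherryDistances ρ σ i j = cherryDistances ρ σ j i := by
    fin_cases i <;> fin_cases j <;> rfl
  rcases lt_trichotomy i j with h | rfl | h
  · exact hlt i j h
  · rw [hself]
    fin_cases i <;> rfl
  · rw [norm_det₂_comm, hlt j i h, hsymm]

end TreeTypes

end BinaryQuintic

end

/-! ### The theorem. -/

open BinaryQuintic in
theorem theorem1p1 (K : Type*) [NontriviallyNormedField K] [IsUltrametricDist K] [CompleteSpace K]
    [IsAlgClosed K] [CharZero K] (h2 : ringChar (ResidueField K) ≠ 2)
    (h3 : ringChar (ResidueField K) ≠ 3) (h11 : ringChar (ResidueField K) ≠ 11)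
    (a : Fin 6 → K) (ha : IsSeparable a) :
    (HasTreeType a typeI ↔
      ∀ I : Inv, I.deg • val (Inv.disc.eval a) ≤ 8 • val (I.eval a)) ∧
    (HasTreeType a typeII ↔
      (2 • val (Inv.I4.eval a) < val (Inv.disc.eval a) ∨
        4 • val (Inv.I18.eval a) < 9 • val (Inv.disc.eval a)) ∧
      ∀ I : Inv, I.deg • val (Inv.H.eval a) ≤ 12 • val (I.eval a)) ∧
    (HasTreeType a typeIII ↔
      2 • val (Inv.I4.eval a) < val (Inv.disc.eval a) ∧
        3 • val (Inv.I4.eval a) < val (Inv.H.eval a)) := by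
  change (HasTreeType a typeI ↔ ConditionI a) ∧ (HasTreeType a typeII ↔ ConditionII a) ∧
    (HasTreeType a typeIII ↔ ConditionIII a)
  have n2 : ‖(2 : K)‖ = 1 := by
    exact_mod_cast norm_natCast_eq_one_of_ringChar_ne Nat.prime_two h2
  have n3 : ‖(3 : K)‖ = 1 := by
    exact_mod_cast norm_natCast_eq_one_of_ringChar_ne Nat.prime_three h3
  have n11 : ‖(11 : K)‖ = 1 := by
    exact_mod_cast norm_natCast_eq_one_of_ringChar_ne (by norm_num : Nat.Prime 11) h11
  obtain ⟨c, p, hcp⟩ := exists_quintic_eq_C_mul_rootForm a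
  have hdisc : c ^ 8 * detSqProd p ≠ 0 := by
    rw [← norm_ne_zero_iff, ← norm_eval_disc hcp]
    exact norm_ne_zero_iff.mpr ha
  have hc : c ≠ 0 := by
    rintro rfl
    simp at hdisc
  have hp : ∀ i j, i ≠ j → det₂ (p i) (p j) ≠ 0 := by
    have hlt : ∀ i j, i < j → det₂ (p i) (p j) ≠ 0 := by
      intro i j hij h0
      refine hdisc ?_
      fin_cases i <;> fin_cases j <;> first
        | exact absurd hij (by decide)
        | (simp only [detSqProd]; simp at h0; simp [h0])
    intro i j hij
    rcases hij.lt_or_gt with h | h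
    · exact hlt i j h
    · rw [det₂_comm]
      exact neg_ne_zero.mpr (hlt j i h)
  obtain ⟨σ, g, u, q, hg, hu, hpq, hq, hor⟩ := exists_isNormalized hp
  have haσ : quintic a = MvPolynomial.C c * rootForm fun i => p (σ i) := by
    rw [rootForm_perm, hcp]
  have hpσ : ∀ i j, i ≠ j → det₂ (p (σ i)) (p (σ j)) ≠ 0 := fun i j h => hp _ _ (σ.injective.ne h)
  obtain ⟨μ, hμ, hab⟩ := exists_norm_eval_eq hg hc hu (q := q) (a := a) (by
    rw [haσ]
    exact congrArg (fun p => MvPolynomial.C c * rootForm p) (funext hpq))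
  have hqdet : ∀ i j, i ≠ j → 0 < ‖det₂ (q i) (q j)‖ := by
    intro i j hij
    refine norm_pos_iff.mpr fun h0 => hpσ i j hij ?_
    rw [hpq, hpq, det₂_smul_smul, det₂_mulVec, h0, mul_zero, mul_zero]
  have h01 := hqdet 0 1 (by decide)
  have h23 := hqdet 2 3 (by decide)
  -- Arbitrary values in (0, 1) for symbols that do not occur in the tables of Types I and II.
  have half0 : (0 : ℝ) < 1 / 2 := by norm_num
  have half1 : (1 / 2 : ℝ) < 1 := by norm_num
  -- In each case the type and the truth of all three conditions are known outright, so every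
  -- equivalence is between two true or two false statements.
  rcases (norm_det₂_le_one (hq.norm_le 0) (hq.norm_le 1)).lt_or_eq with r01 | r01
  · rcases (norm_det₂_le_one (hq.norm_le 2) (hq.norm_le 3)).lt_or_eq with r23 | r23
    · have hT : HasTreeType a typeIII := isSymbolicModel_typeIII.hasTreeType typeIII_adj_iff
        h01 r01 h23 r23 hc haσ hpσ hg hu hpq
        (hq.norm_det₂_eq (by simp [Symbolic.value]) (by simp [Symbolic.value]))
      obtain ⟨c1, c2, c3⟩ := hq.conditions_of_lt_of_lt n2 n3 n11 hμ hab r01 r23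
      exact ⟨iff_of_false (fun h => absurd (h.card_eq hT) (by decide)) c1,
        iff_of_false (fun h => absurd (h.card_eq hT) (by decide)) c2, iff_of_true hT c3⟩
    · have hT : HasTreeType a typeII := isSymbolicModel_typeII.hasTreeType typeII_adj_iff
        h01 r01 half0 half1 hc haσ hpσ hg hu hpq
        (hq.norm_det₂_eq (by simp [Symbolic.value]) (by rw [r23, Symbolic.value_some_zero]))
      obtain ⟨c1, c2, c3⟩ := hq.conditions_of_lt_of_eq n2 n3 n11 hμ hab r01 r23
      exact ⟨iff_of_false (fun h => absurd (h.card_eq hT) (by decide)) c1, iff_of_true hT c2,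
        iff_of_false (fun h => absurd (h.card_eq hT) (by decide)) c3⟩
  · have r23 := hor r01
    have hT : HasTreeType a typeI := isSymbolicModel_typeI.hasTreeType typeI_adj_iff
      half0 half1 half0 half1 hc haσ hpσ hg hu hpq
      (hq.norm_det₂_eq (by rw [r01, Symbolic.value_some_zero])
        (by rw [r23, Symbolic.value_some_zero]))
    obtain ⟨c1, c2, c3⟩ := hq.conditions_of_eq_of_eq hμ hab r01 r23
    exact ⟨iff_of_true hT c1, iff_of_false (fun h => absurd (h.card_eq hT) (by decide)) c2,
      iff_of_false (fun h => absurd (h.card_eq hT) (by decide)) c3⟩
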